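/- There are a randomized algorithm and absolute constants $C, d$ such that the following holds. The input consists of integers $n, f, k \ge 1$ and an undirected simple graph $G = (V,E)$ on $n$ vertices with $m$ edges, given as a list of edges in arbitrary order with weights $w : E \to \mathbb{R}_{\ge 0}$. The algorithm runs in expected time $$\widetilde{O}\left(f^{1-1/k}\, n^{2+1/k} + m f^2\right),$$ that is, at most $C\,(1+\log n)^{d}\,\bigl(f^{1-1/k} n^{2+1/k} + m f^2\bigr)$. With probability at least $1-1/n$ it returns a subgraph $H$ of $G$ which has at most $C\, f^{1-1/k} n^{1+1/k}$ edges and is an $f$-vertex-fault-tolerant $(2k-1)$-spanner of $G$, i.e., $$d_{H\setminus F}(u,v) \le (2k-1)\, d_{G\setminus F}(u,v) \quad \text{for all } u,v\in V \text{ and all } F\subseteq V\setminus\{u,v\} \text{ with } |F|\le f,$$ where $d_X(u,v)$ denotes the weighted shortest-path distance in $X$ ($\infty$ if there is no path). Time is counted on a randomized word RAM with words of $O(\log (n+f+k))$ bits and unit-cost word operations, memory accesses, fair coin tosses and comparisons of two edge weights, which are the only access to the weights. -/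

import Mathlib

open MeasureTheory
open scoped ENNReal NNReal

namespace FTSpanner

/-! ## Weighted graphs, distances, fault-tolerant spanners -/

section Graphs

variable {V : Type*}

/-- Shortest-path distance from `u` to `v` in `G` with edge weights `w`; it is `∞` if there is no
path from `u` to `v`. -/
noncomputable def wdist (G : SimpleGraph V) (w : Sym2 V → ℝ≥0) (u v : V) : ℝ≥0∞ :=
  ⨅ p : G.Walk u v, (p.edges.map fun x => (w x : ℝ≥0∞)).sum

/-- The graph `G \ F`: the vertices in `F` fail, so all edges that meet `F` disappear. (The
vertices of `F` stay as isolated points; distances are only ever taken between vertices outside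
`F`.) -/
def faulty (G : SimpleGraph V) (F : Finset V) : SimpleGraph V where
  Adj u v := G.Adj u v ∧ u ∉ F ∧ v ∉ F
  symm := ⟨fun _ _ h => ⟨h.1.symm, h.2.2, h.2.1⟩⟩
  loopless := ⟨fun _ h => h.1.ne rfl⟩

/-- `H` is an `f`-vertex-fault-tolerant `t`-spanner of the weighted graph `(G, w)`. -/
def IsVFTSpanner (G : SimpleGraph V) (w : Sym2 V → ℝ≥0) (f t : ℕ) (H : SimpleGraph V) : Prop :=
  H ≤ G ∧ ∀ F : Finset V, F.card ≤ f → ∀ u v : V, u ∉ F → v ∉ F →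
    wdist (faulty H F) w u v ≤ (t : ℝ≥0∞) * wdist (faulty G F) w u v

end Graphs

/-! ## A randomized word RAM

Programs are finite structured programs over registers and random-access arrays of `W`-bit words.
The edge weights are real numbers in a read-only array; a program can only compare two of them.
Randomness comes from a sequence of independent fair coins. Every operation costs one unit. -/

/-- Binary operations on words. -/
inductive BinOp
  | add | sub | mul | div | mod | lt | eq

/-- Value of a binary operation before the reduction modulo `2 ^ W`; subtraction is truncated at
zero, and a comparison gives `1` or `0`. -/
def BinOp.eval : BinOp → ℕ → ℕ → ℕ
  | .add, x, y => x + y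
  | .sub, x, y => x - y
  | .mul, x, y => x * y
  | .div, x, y => x / y
  | .mod, x, y => x % y
  | .lt, x, y => if x < y then 1 else 0
  | .eq, x, y => if x = y then 1 else 0

/-- Expressions: a literal, the content of a register, the entry of array `a` at a computed index,
a binary operation, and the test whether weight number `i` is at most weight number `j`. -/
inductive Expr
  | lit (c : ℕ)
  | reg (x : ℕ)
  | get (a : ℕ) (i : Expr)
  | bin (o : BinOp) (e₁ e₂ : Expr)
  | weightLe (i j : Expr)

/-- Programs. A condition counts as true when its value is not `0`. -/
inductive Cmd
  | skip
  /-- store the value of `e` in register `x` -/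
  | setReg (x : ℕ) (e : Expr)
  /-- store the value of `e` in array `a` at index `i` -/
  | setArr (a : ℕ) (i e : Expr)
  /-- toss a fair coin and store the result, `0` or `1`, in register `x` -/
  | toss (x : ℕ)
  | seq (p q : Cmd)
  | ite (e : Expr) (p q : Cmd)
  | loop (e : Expr) (p : Cmd)

/-- Memory contents, and the number of coins tossed so far. -/
structure State where
  reg : ℕ → ℕ
  arr : ℕ → ℕ → ℕ
  pos : ℕ

/-- Number of unit-cost operations in the evaluation of an expression. -/
def Expr.cost : Expr → ℕ
  | .lit _ => 1
  | .reg _ => 1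
  | .get _ i => 1 + i.cost
  | .bin _ e₁ e₂ => 1 + e₁.cost + e₂.cost
  | .weightLe i j => 1 + i.cost + j.cost

/-- Value of an expression on a machine with `W`-bit words and weight array `wt`. -/
noncomputable def Expr.eval (W : ℕ) (wt : ℕ → ℝ≥0) (s : State) : Expr → ℕ
  | .lit c => c % 2 ^ W
  | .reg x => s.reg x
  | .get a i => s.arr a (i.eval W wt s)
  | .bin o e₁ e₂ => o.eval (e₁.eval W wt s) (e₂.eval W wt s) % 2 ^ W
  | .weightLe i j => if wt (i.eval W wt s) ≤ wt (j.eval W wt s) then 1 else 0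

/-- `Exec W wt coin p s t s'`: started in state `s`, with coin sequence `coin`, the program `p`
halts after `t` steps in state `s'`. -/
inductive Exec (W : ℕ) (wt : ℕ → ℝ≥0) (coin : ℕ → Bool) : Cmd → State → ℕ → State → Prop
  | skip (s : State) : Exec W wt coin .skip s 1 s
  | setReg (x : ℕ) (e : Expr) (s : State) :
      Exec W wt coin (.setReg x e) s (1 + e.cost)
        { s with reg := Function.update s.reg x (e.eval W wt s) }
  | setArr (a : ℕ) (i e : Expr) (s : State) :
      Exec W wt coin (.setArr a i e) s (1 + i.cost + e.cost)
        { s with arr := Function.update s.arr a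
                          (Function.update (s.arr a) (i.eval W wt s) (e.eval W wt s)) }
  | toss (x : ℕ) (s : State) :
      Exec W wt coin (.toss x) s 1
        { s with reg := Function.update s.reg x (if coin s.pos then 1 else 0), pos := s.pos + 1 }
  | seq {p q : Cmd} {s s₁ s₂ : State} {t₁ t₂ : ℕ}
      (hp : Exec W wt coin p s t₁ s₁) (hq : Exec W wt coin q s₁ t₂ s₂) :
      Exec W wt coin (.seq p q) s (t₁ + t₂) s₂
  | iteTrue {e : Expr} {p q : Cmd} {s s' : State} {t : ℕ} (he : e.eval W wt s ≠ 0)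
      (hp : Exec W wt coin p s t s') : Exec W wt coin (.ite e p q) s (1 + e.cost + t) s'
  | iteFalse {e : Expr} {p q : Cmd} {s s' : State} {t : ℕ} (he : e.eval W wt s = 0)
      (hq : Exec W wt coin q s t s') : Exec W wt coin (.ite e p q) s (1 + e.cost + t) s'
  | loopTrue {e : Expr} {p : Cmd} {s s₁ s₂ : State} {t₁ t₂ : ℕ} (he : e.eval W wt s ≠ 0)
      (hp : Exec W wt coin p s t₁ s₁) (hl : Exec W wt coin (.loop e p) s₁ t₂ s₂) :
      Exec W wt coin (.loop e p) s (1 + e.cost + t₁ + t₂) s₂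
  | loopFalse {e : Expr} {p : Cmd} {s : State} (he : e.eval W wt s = 0) :
      Exec W wt coin (.loop e p) s (1 + e.cost) s

/-- For a fixed coin sequence there is at most one halting run. -/
theorem Exec.deterministic {W : ℕ} {wt : ℕ → ℝ≥0} {coin : ℕ → Bool} {p : Cmd} {s s₁ s₂ : State}
    {t₁ t₂ : ℕ} (h₁ : Exec W wt coin p s t₁ s₁) (h₂ : Exec W wt coin p s t₂ s₂) :
    t₁ = t₂ ∧ s₁ = s₂ := by
  induction h₁ generalizing t₂ s₂ with
  | skip | setReg | setArr | toss => cases h₂; exact ⟨rfl, rfl⟩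
  | seq _ _ ih₁ ih₂ =>
    cases h₂ with
    | seq hp hq =>
      obtain ⟨rfl, rfl⟩ := ih₁ hp
      obtain ⟨rfl, rfl⟩ := ih₂ hq
      exact ⟨rfl, rfl⟩
  | iteTrue he _ ih =>
    cases h₂ with
    | iteTrue _ hp => obtain ⟨rfl, rfl⟩ := ih hp; exact ⟨rfl, rfl⟩
    | iteFalse he' _ => exact absurd he' he
  | iteFalse he _ ih =>
    cases h₂ with
    | iteTrue he' _ => exact absurd he he'
    | iteFalse _ hq => obtain ⟨rfl, rfl⟩ := ih hq; exact ⟨rfl, rfl⟩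
  | loopTrue he _ _ ih₁ ih₂ =>
    cases h₂ with
    | loopTrue _ hp hl =>
      obtain ⟨rfl, rfl⟩ := ih₁ hp
      obtain ⟨rfl, rfl⟩ := ih₂ hl
      exact ⟨rfl, rfl⟩
    | loopFalse he' => exact absurd he' he
  | loopFalse he =>
    cases h₂ with
    | loopTrue he' _ _ => exact absurd he he'
    | loopFalse _ => exact ⟨rfl, rfl⟩

/-- The law of an infinite sequence of independent fair coins. -/
noncomputable def coinLaw : Measure (ℕ → Bool) :=
  Measure.infinitePi fun _ => (PMF.uniformOfFintype Bool).toMeasure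

/-- The running time of `p` from `s` with coin sequence `coin`, which is `∞` if `p` does not
halt. -/
noncomputable def runTime (W : ℕ) (wt : ℕ → ℝ≥0) (p : Cmd) (s : State) (coin : ℕ → Bool) :
    ℝ≥0∞ :=
  ⨅ (t : ℕ) (_ : ∃ s', Exec W wt coin p s t s'), (t : ℝ≥0∞)

/-- The expected running time of `p` from `s`. -/
noncomputable def expectedTime (W : ℕ) (wt : ℕ → ℝ≥0) (p : Cmd) (s : State) : ℝ≥0∞ :=
  ∫⁻ coin, runTime W wt p s coin ∂coinLaw

/-- The probability that `p`, started in `s`, halts in a state that satisfies `Q`. -/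
noncomputable def haltProb (W : ℕ) (wt : ℕ → ℝ≥0) (p : Cmd) (s : State) (Q : State → Prop) :
    ℝ≥0∞ :=
  coinLaw {coin | ∃ t s', Exec W wt coin p s t s' ∧ Q s'}

/-! ## Input and output conventions -/

section Conventions

variable {n m : ℕ}

/-- The list `e` contains every edge of `G` exactly once, in an arbitrary order and with an
arbitrary order of the two endpoints of each edge. -/
def IsEdgeList (G : SimpleGraph (Fin n)) (e : Fin m → Fin n × Fin n) : Prop :=
  Function.Injective (fun i => s((e i).1, (e i).2)) ∧
    Set.range (fun i => s((e i).1, (e i).2)) = G.edgeSet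

/-- The weight array: entry `i` is the weight of the `i`-th edge of the list. -/
noncomputable def weightArray (e : Fin m → Fin n × Fin n) (w : Sym2 (Fin n) → ℝ≥0) (i : ℕ) :
    ℝ≥0 :=
  if h : i < m then w s((e ⟨i, h⟩).1, (e ⟨i, h⟩).2) else 0

/-- The initial state: registers `0, 1, 2, 3` hold `n, m, f, k`, arrays `0` and `1` hold the first
and the second endpoints of the edges, and the rest of the memory is zero. -/
def initState (e : Fin m → Fin n × Fin n) (f k : ℕ) : State where
  reg
    | 0 => n
    | 1 => m
    | 2 => f
    | 3 => k
    | _ => 0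
  arr
    | 0, i => if h : i < m then ((e ⟨i, h⟩).1 : ℕ) else 0
    | 1, i => if h : i < m then ((e ⟨i, h⟩).2 : ℕ) else 0
    | _, _ => 0
  pos := 0

/-- The graph that is returned in a final state: edge number `i` of the input belongs to it if and
only if entry `i` of array `2` is nonzero. -/
def outGraph (e : Fin m → Fin n × Fin n) (s : State) : SimpleGraph (Fin n) :=
  SimpleGraph.fromEdgeSet {x | ∃ i : Fin m, s.arr 2 i ≠ 0 ∧ x = s((e i).1, (e i).2)}

end Conventions

end FTSpanner

open FTSpanner

namespace FTSpanner

/-! ## Program verification with exact running times -/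

/-- The parameters of a run: word length, weight array and coin sequence. -/
structure Machine where
  W : ℕ
  wt : ℕ → ℝ≥0
  coin : ℕ → Bool

namespace State

/-- The state after writing `v` to register `x`. -/
def setR (s : State) (x v : ℕ) : State := { s with reg := Function.update s.reg x v }

/-- The state after writing `v` to array `a` at index `i`. -/
def setA (s : State) (a i v : ℕ) : State :=
  { s with arr := Function.update s.arr a (Function.update (s.arr a) i v) }

@[simp] theorem setR_reg (s : State) (x v y : ℕ) :
    (s.setR x v).reg y = if y = x then v else s.reg y := by
  simp [setR, Function.update_apply]

@[simp] theorem setR_arr (s : State) (x v : ℕ) : (s.setR x v).arr = s.arr := rfl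

@[simp] theorem setA_reg (s : State) (a i v : ℕ) : (s.setA a i v).reg = s.reg := rfl

@[simp] theorem setA_arr (s : State) (a i v b : ℕ) :
    (s.setA a i v).arr b = if b = a then Function.update (s.arr a) i v else s.arr b := by
  simp [setA, Function.update_apply]

end State

namespace Expr

/-- Value of an expression without reduction modulo the word size. -/
noncomputable def val (wt : ℕ → ℝ≥0) (s : State) : Expr → ℕ
  | .lit c => c
  | .reg x => s.reg x
  | .get a i => s.arr a (i.val wt s)
  | .bin o e₁ e₂ => o.eval (e₁.val wt s) (e₂.val wt s)
  | .weightLe i j => if wt (i.val wt s) ≤ wt (j.val wt s) then 1 else 0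

/-- No literal and no intermediate result exceeds the word size. -/
def Fits (W : ℕ) (wt : ℕ → ℝ≥0) (s : State) : Expr → Prop
  | .lit c => c < 2 ^ W
  | .reg _ => True
  | .get _ i => i.Fits W wt s
  | .bin o e₁ e₂ => e₁.Fits W wt s ∧ e₂.Fits W wt s ∧
      match o with
      | .lt => 1 < 2 ^ W
      | .eq => 1 < 2 ^ W
      | .sub => e₁.val wt s < 2 ^ W
      | .div => e₁.val wt s < 2 ^ W
      | .mod => e₁.val wt s < 2 ^ W
      | .add => e₁.val wt s + e₂.val wt s < 2 ^ W
      | .mul => e₁.val wt s * e₂.val wt s < 2 ^ W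
  | .weightLe i j => i.Fits W wt s ∧ j.Fits W wt s

theorem eval_eq_val {W : ℕ} {wt : ℕ → ℝ≥0} {s : State} {e : Expr} (h : e.Fits W wt s) :
    e.eval W wt s = e.val wt s := by
  induction e with
  | lit c => exact Nat.mod_eq_of_lt h
  | reg x => rfl
  | get a i ih => simp only [eval, val, ih h]
  | bin o e₁ e₂ ih₁ ih₂ =>
    obtain ⟨h₁, h₂, h₃⟩ := h
    simp only [eval, val, ih₁ h₁, ih₂ h₂]
    apply Nat.mod_eq_of_lt
    cases o <;> simp only [BinOp.eval] at h₃ ⊢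
    · exact h₃
    · omega
    · exact h₃
    · exact (Nat.div_le_self _ _).trans_lt h₃
    · exact (Nat.mod_le _ _).trans_lt h₃
    · split_ifs <;> omega
    · split_ifs <;> omega
  | weightLe i j ih₁ ih₂ => simp only [eval, val, ih₁ h.1, ih₂ h.2]

end Expr

/-- The registers that a program may write. -/
def Cmd.regs : Cmd → List ℕ
  | .skip => []
  | .setReg x _ => [x]
  | .setArr _ _ _ => []
  | .toss x => [x]
  | .seq p q => p.regs ++ q.regs
  | .ite _ p q => p.regs ++ q.regs
  | .loop _ p => p.regs

/-- The arrays that a program may write. -/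
def Cmd.arrs : Cmd → List ℕ
  | .skip => []
  | .setReg _ _ => []
  | .setArr a _ _ => [a]
  | .toss _ => []
  | .seq p q => p.arrs ++ q.arrs
  | .ite _ p q => p.arrs ++ q.arrs
  | .loop _ p => p.arrs

/-- `s'` differs from `s` at most in what `p` may write. -/
structure Frame (p : Cmd) (s s' : State) : Prop where
  reg : ∀ x, x ∉ p.regs → s'.reg x = s.reg x
  arr : ∀ a, a ∉ p.arrs → s'.arr a = s.arr a

theorem Frame.refl (p : Cmd) (s : State) : Frame p s s := ⟨fun _ _ => rfl, fun _ _ => rfl⟩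

theorem Frame.trans {p : Cmd} {s₁ s₂ s₃ : State} (h₁ : Frame p s₁ s₂) (h₂ : Frame p s₂ s₃) :
    Frame p s₁ s₃ :=
  ⟨fun x hx => (h₂.reg x hx).trans (h₁.reg x hx), fun a ha => (h₂.arr a ha).trans (h₁.arr a ha)⟩

theorem Frame.mono {p q : Cmd} {s s' : State} (h : Frame p s s') (hr : p.regs ⊆ q.regs)
    (ha : p.arrs ⊆ q.arrs) : Frame q s s' :=
  ⟨fun x hx => h.reg x fun h' => hx (hr h'), fun a hx => h.arr a fun h' => hx (ha h')⟩

theorem Exec.frame {W : ℕ} {wt : ℕ → ℝ≥0} {coin : ℕ → Bool} {p : Cmd} {s s' : State} {t : ℕ}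
    (h : Exec W wt coin p s t s') : Frame p s s' := by
  induction h with
  | skip s => exact Frame.refl _ _
  | setReg x e s =>
    refine ⟨fun y hy => ?_, fun _ _ => rfl⟩
    simp only [Cmd.regs, List.mem_singleton] at hy
    simp [hy]
  | setArr a i e s =>
    refine ⟨fun _ _ => rfl, fun b hb => ?_⟩
    simp only [Cmd.arrs, List.mem_singleton] at hb
    simp [hb]
  | toss x s =>
    refine ⟨fun y hy => ?_, fun _ _ => rfl⟩
    simp only [Cmd.regs, List.mem_singleton] at hy
    simp [hy]
  | seq _ _ ih₁ ih₂ =>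
    exact (ih₁.mono (by simp [Cmd.regs]) (by simp [Cmd.arrs])).trans
      (ih₂.mono (by simp [Cmd.regs]) (by simp [Cmd.arrs]))
  | iteTrue _ _ ih => exact ih.mono (by simp [Cmd.regs]) (by simp [Cmd.arrs])
  | iteFalse _ _ ih => exact ih.mono (by simp [Cmd.regs]) (by simp [Cmd.arrs])
  | loopTrue _ _ _ ih₁ ih₂ => exact Frame.trans (ih₁.mono (fun _ h => h) (fun _ h => h)) ih₂
  | loopFalse _ => exact Frame.refl _ _

/-- Started in `s` at time `τ`, the program `p` halts in a state `s'` at a time `τ'` with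
`Q s' τ'`. -/
def WP (μ : Machine) (p : Cmd) (Q : State → ℕ → Prop) (s : State) (τ : ℕ) : Prop :=
  ∃ t s', Exec μ.W μ.wt μ.coin p s t s' ∧ Q s' (τ + t)

/-- The expression `e` has the value `v` in the state `s`, and no overflow occurs. -/
def Ev (μ : Machine) (s : State) (e : Expr) (v : ℕ) : Prop :=
  e.Fits μ.W μ.wt s ∧ e.val μ.wt s = v

namespace Ev

variable {μ : Machine} {s : State} {e e₁ e₂ : Expr} {a b x v : ℕ}

theorem reg (h : s.reg x = v) : Ev μ s (.reg x) v := ⟨trivial, h⟩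

theorem lit (h : v < 2 ^ μ.W) : Ev μ s (.lit v) v := ⟨h, rfl⟩

theorem get (hi : Ev μ s e a) (h : s.arr x a = v) : Ev μ s (.get x e) v :=
  ⟨hi.1, by rw [Expr.val, hi.2, h]⟩

theorem add (h₁ : Ev μ s e₁ a) (h₂ : Ev μ s e₂ b) (h : a + b < 2 ^ μ.W) :
    Ev μ s (.bin .add e₁ e₂) (a + b) :=
  ⟨⟨h₁.1, h₂.1, by simpa only [h₁.2, h₂.2] using h⟩,
    by simp only [Expr.val, h₁.2, h₂.2, BinOp.eval]⟩

theorem mul (h₁ : Ev μ s e₁ a) (h₂ : Ev μ s e₂ b) (h : a * b < 2 ^ μ.W) :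
    Ev μ s (.bin .mul e₁ e₂) (a * b) :=
  ⟨⟨h₁.1, h₂.1, by simpa only [h₁.2, h₂.2] using h⟩,
    by simp only [Expr.val, h₁.2, h₂.2, BinOp.eval]⟩

theorem sub (h₁ : Ev μ s e₁ a) (h₂ : Ev μ s e₂ b) (h : a < 2 ^ μ.W) :
    Ev μ s (.bin .sub e₁ e₂) (a - b) :=
  ⟨⟨h₁.1, h₂.1, by simpa only [h₁.2, h₂.2] using h⟩,
    by simp only [Expr.val, h₁.2, h₂.2, BinOp.eval]⟩

theorem div (h₁ : Ev μ s e₁ a) (h₂ : Ev μ s e₂ b) (h : a < 2 ^ μ.W) :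
    Ev μ s (.bin .div e₁ e₂) (a / b) :=
  ⟨⟨h₁.1, h₂.1, by simpa only [h₁.2, h₂.2] using h⟩,
    by simp only [Expr.val, h₁.2, h₂.2, BinOp.eval]⟩

theorem lt (h₁ : Ev μ s e₁ a) (h₂ : Ev μ s e₂ b) (h : 1 < 2 ^ μ.W) :
    Ev μ s (.bin .lt e₁ e₂) (if a < b then 1 else 0) :=
  ⟨⟨h₁.1, h₂.1, h⟩, by simp only [Expr.val, h₁.2, h₂.2, BinOp.eval]⟩

theorem eq (h₁ : Ev μ s e₁ a) (h₂ : Ev μ s e₂ b) (h : 1 < 2 ^ μ.W) :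
    Ev μ s (.bin .eq e₁ e₂) (if a = b then 1 else 0) :=
  ⟨⟨h₁.1, h₂.1, h⟩, by simp only [Expr.val, h₁.2, h₂.2, BinOp.eval]⟩

theorem weightLe (h₁ : Ev μ s e₁ a) (h₂ : Ev μ s e₂ b) :
    Ev μ s (.weightLe e₁ e₂) (if μ.wt a ≤ μ.wt b then 1 else 0) :=
  ⟨⟨h₁.1, h₂.1⟩, by simp only [Expr.val, h₁.2, h₂.2]⟩

theorem congr (h : Ev μ s e a) (hab : a = b) : Ev μ s e b := hab ▸ h

end Ev

namespace WP

variable {μ : Machine} {p q : Cmd} {Q Q' : State → ℕ → Prop} {s : State} {τ : ℕ}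

theorem mono (h : WP μ p Q s τ) (hQ : ∀ s' τ', Frame p s s' → Q s' τ' → Q' s' τ') :
    WP μ p Q' s τ := by
  obtain ⟨t, s', he, hq⟩ := h
  exact ⟨t, s', he, hQ _ _ he.frame hq⟩

theorem skip (h : Q s (τ + 1)) : WP μ .skip Q s τ := ⟨1, s, .skip s, h⟩

theorem setReg {x v : ℕ} {e : Expr} (hv : Ev μ s e v)
    (h : Q (s.setR x v) (τ + (1 + e.cost))) : WP μ (.setReg x e) Q s τ := by
  refine ⟨_, _, .setReg x e s, ?_⟩
  rw [Expr.eval_eq_val hv.1, hv.2]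
  exact h

theorem setArr {a j v : ℕ} {i e : Expr} (hj : Ev μ s i j) (hv : Ev μ s e v)
    (h : Q (s.setA a j v) (τ + (1 + i.cost + e.cost))) : WP μ (.setArr a i e) Q s τ := by
  refine ⟨_, _, .setArr a i e s, ?_⟩
  rw [Expr.eval_eq_val hv.1, Expr.eval_eq_val hj.1, hv.2, hj.2]
  exact h

theorem seq (h : WP μ p (fun s' τ' => WP μ q Q s' τ') s τ) : WP μ (.seq p q) Q s τ := by
  obtain ⟨t₁, s₁, h₁, t₂, s₂, h₂, hq⟩ := h
  exact ⟨_, _, .seq h₁ h₂, by rwa [add_assoc] at hq⟩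

theorem seqSetReg {x v : ℕ} {e : Expr} (hv : Ev μ s e v)
    (h : WP μ q Q (s.setR x v) (τ + (1 + e.cost))) :
    WP μ (.seq (.setReg x e) q) Q s τ := seq (setReg hv h)

theorem seqSetArr {a j v : ℕ} {i e : Expr} (hj : Ev μ s i j) (hv : Ev μ s e v)
    (h : WP μ q Q (s.setA a j v) (τ + (1 + i.cost + e.cost))) :
    WP μ (.seq (.setArr a i e) q) Q s τ := seq (setArr hj hv h)

theorem ite {e : Expr} {v : ℕ} (hv : Ev μ s e v) (ht : v ≠ 0 → WP μ p Q s (τ + (1 + e.cost)))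
    (hn : v = 0 → WP μ q Q s (τ + (1 + e.cost))) : WP μ (.ite e p q) Q s τ := by
  obtain ⟨hf, rfl⟩ := hv
  by_cases he : e.val μ.wt s = 0
  · obtain ⟨t, s', h, hq⟩ := hn he
    exact ⟨_, s', .iteFalse (by rwa [Expr.eval_eq_val hf]) h, by rwa [add_assoc] at hq⟩
  · obtain ⟨t, s', h, hq⟩ := ht he
    exact ⟨_, s', .iteTrue (by rwa [Expr.eval_eq_val hf]) h, by rwa [add_assoc] at hq⟩

theorem iteLt {e₁ e₂ : Expr} {a b : ℕ} (h₁ : Ev μ s e₁ a) (h₂ : Ev μ s e₂ b) (hW : 1 < 2 ^ μ.W)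
    (ht : a < b → WP μ p Q s (τ + (2 + e₁.cost + e₂.cost)))
    (hn : b ≤ a → WP μ q Q s (τ + (2 + e₁.cost + e₂.cost))) :
    WP μ (.ite (.bin .lt e₁ e₂) p q) Q s τ := by
  have hc : 1 + (Expr.bin .lt e₁ e₂).cost = 2 + e₁.cost + e₂.cost := by simp [Expr.cost]; ring
  refine ite (.lt h₁ h₂ hW) (fun h => ?_) (fun h => ?_) <;> rw [hc]
  · exact ht (by by_contra hab; simp [hab] at h)
  · exact hn (by by_contra hab; simp [not_le.1 hab] at h)

theorem iteEq {e₁ e₂ : Expr} {a b : ℕ} (h₁ : Ev μ s e₁ a) (h₂ : Ev μ s e₂ b) (hW : 1 < 2 ^ μ.W)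
    (ht : a = b → WP μ p Q s (τ + (2 + e₁.cost + e₂.cost)))
    (hn : a ≠ b → WP μ q Q s (τ + (2 + e₁.cost + e₂.cost))) :
    WP μ (.ite (.bin .eq e₁ e₂) p q) Q s τ := by
  have hc : 1 + (Expr.bin .eq e₁ e₂).cost = 2 + e₁.cost + e₂.cost := by simp [Expr.cost]; ring
  refine ite (.eq h₁ h₂ hW) (fun h => ?_) (fun h => ?_) <;> rw [hc]
  · exact ht (by by_contra hab; simp [hab] at h)
  · exact hn (by rintro rfl; simp at h)

/-- A loop with an invariant that bounds the elapsed time by `T` terminates. -/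
theorem loop {e : Expr} (Inv : State → ℕ → Prop) (T : ℕ) (h₀ : Inv s τ)
    (hT : ∀ s' τ', Inv s' τ' → τ' ≤ T)
    (hf : ∀ s' τ', Frame p s s' → Inv s' τ' → e.Fits μ.W μ.wt s')
    (hb : ∀ s' τ', Frame p s s' → Inv s' τ' → e.val μ.wt s' ≠ 0 →
      WP μ p Inv s' (τ' + (1 + e.cost)))
    (hx : ∀ s' τ', Frame p s s' → Inv s' τ' → e.val μ.wt s' = 0 → Q s' (τ' + (1 + e.cost))) :
    WP μ (.loop e p) Q s τ := by
  suffices H : ∀ d s' τ', Frame p s s' → Inv s' τ' → T - τ' ≤ d →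
      WP μ (.loop e p) Q s' τ' from H _ s τ (Frame.refl _ _) h₀ le_rfl
  intro d
  induction d with
  | zero =>
    intro s' τ' hfr hi hd
    by_cases he : e.val μ.wt s' = 0
    · exact ⟨_, _, .loopFalse (by rwa [Expr.eval_eq_val (hf _ _ hfr hi)]), hx _ _ hfr hi he⟩
    · obtain ⟨t, s'', h, hq⟩ := hb _ _ hfr hi he
      have := hT _ _ hq
      omega
  | succ d ih =>
    intro s' τ' hfr hi hd
    by_cases he : e.val μ.wt s' = 0
    · exact ⟨_, _, .loopFalse (by rwa [Expr.eval_eq_val (hf _ _ hfr hi)]), hx _ _ hfr hi he⟩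
    · obtain ⟨t, s'', h, hq⟩ := hb _ _ hfr hi he
      obtain ⟨t', s₃, h', hq'⟩ := ih _ _ (hfr.trans h.frame) hq (by omega)
      exact ⟨_, _, .loopTrue (by rwa [Expr.eval_eq_val (hf _ _ hfr hi)]) h h',
        by rw [← add_assoc, ← add_assoc]; exact hq'⟩

end WP

/-- `for i < b do p`, with loop counter in register `i`; the bound is evaluated anew in every
iteration. -/
def Cmd.forLt (i : ℕ) (b : Expr) (p : Cmd) : Cmd :=
  .seq (.setReg i (.lit 0)) (.loop (.bin .lt (.reg i) b)
    (.seq p (.setReg i (.bin .add (.reg i) (.lit 1)))))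

theorem WP.forLt {μ : Machine} {p : Cmd} {Q : State → ℕ → Prop} {s : State} {τ i : ℕ} {b : Expr}
    (B : ℕ) (Inv : ℕ → State → ℕ → Prop) (hW : 1 < 2 ^ μ.W) (hB : B < 2 ^ μ.W)
    (h₀ : Inv 0 (s.setR i 0) (τ + 2))
    (hf : ∀ j s' τ', Frame (Cmd.forLt i b p) s s' → s'.reg i = j → j ≤ B → Inv j s' τ' →
      Ev μ s' b B)
    (hb : ∀ j s' τ', Frame (Cmd.forLt i b p) s s' → s'.reg i = j → j < B → Inv j s' τ' →
      WP μ p (fun s'' τ'' => s''.reg i = j ∧ Inv (j + 1) (s''.setR i (j + 1)) (τ'' + 4)) s'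
        (τ' + (3 + b.cost)))
    (hx : ∀ s' τ', Frame (Cmd.forLt i b p) s s' → s'.reg i = B → Inv B s' τ' →
      Q s' (τ' + (3 + b.cost))) :
    WP μ (Cmd.forLt i b p) Q s τ := by
  have hreg : Frame (Cmd.forLt i b p) s (s.setR i 0) :=
    ⟨fun x hx => by simp [Cmd.forLt, Cmd.regs] at hx; simp [hx], fun _ _ => rfl⟩
  refine WP.seqSetReg (.lit (by omega)) ?_
  suffices H : ∀ d j s' τ', d + j = B → Frame (Cmd.forLt i b p) s s' → s'.reg i = j →
      Inv j s' τ' → WP μ (.loop (.bin .lt (.reg i) b)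
        (.seq p (.setReg i (.bin .add (.reg i) (.lit 1))))) Q s' τ' from
    H B 0 _ _ rfl hreg (by simp) h₀
  intro d
  induction d with
  | zero =>
    intro j s' τ' hd hfr hj hi
    obtain ⟨h₁, h₂⟩ := hf j s' τ' hfr hj (by omega) hi
    have hfit : (Expr.bin .lt (.reg i) b).Fits μ.W μ.wt s' := ⟨trivial, h₁, hW⟩
    refine ⟨_, _, .loopFalse ?_, ?_⟩
    · rw [Expr.eval_eq_val hfit]
      simp only [Expr.val, BinOp.eval, h₂, hj]
      rw [if_neg (by omega)]
    · have : B = j := by omega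
      subst this
      have := hx s' τ' hfr hj hi
      simp only [Expr.cost]
      convert this using 1
      ring
  | succ d ih =>
    intro j s' τ' hd hfr hj hi
    obtain ⟨h₁, h₂⟩ := hf j s' τ' hfr hj (by omega) hi
    have hfit : (Expr.bin .lt (.reg i) b).Fits μ.W μ.wt s' := ⟨trivial, h₁, hW⟩
    obtain ⟨t, s'', he, hj', hi'⟩ := hb j s' τ' hfr hj (by omega) hi
    have hfr'' : Frame (Cmd.forLt i b p) s s'' := hfr.trans
      (he.frame.mono (by intro x hx; simp [Cmd.forLt, Cmd.regs, hx])
        (by intro x hx; simp [Cmd.forLt, Cmd.arrs, hx]))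
    have hfr' : Frame (Cmd.forLt i b p) s (s''.setR i (j + 1)) := hfr''.trans
      ⟨fun x hx => by simp [Cmd.forLt, Cmd.regs] at hx; simp [hx], fun _ _ => rfl⟩
    obtain ⟨t', s₃, he', hq⟩ := ih (j + 1) _ _ (by omega) hfr' (by simp) hi'
    have hinc : Exec μ.W μ.wt μ.coin (.setReg i (.bin .add (.reg i) (.lit 1))) s'' 4
        (s''.setR i (j + 1)) := by
      have := Exec.setReg (W := μ.W) (wt := μ.wt) (coin := μ.coin) i
        (.bin .add (.reg i) (.lit 1)) s''
      have hfit' : (Expr.bin .add (.reg i) (.lit 1)).Fits μ.W μ.wt s'' :=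
        ⟨trivial, hW, by show s''.reg i + 1 < 2 ^ μ.W; omega⟩
      rw [Expr.eval_eq_val hfit'] at this
      simp only [Expr.val, BinOp.eval, hj', Expr.cost] at this
      exact this
    refine ⟨_, _, .loopTrue ?_ (.seq he hinc) he', ?_⟩
    · rw [Expr.eval_eq_val hfit]
      simp only [Expr.val, BinOp.eval, h₂, hj]
      rw [if_pos (by omega)]
      exact one_ne_zero
    · simp only [Expr.cost]
      convert hq using 1
      ring

/-! ## Graphs without short cycles -/

section Girth

variable {V : Type*}

/-- `G` has no cycle of length at most `2 * k`. -/
def HighGirth (k : ℕ) (G : SimpleGraph V) : Prop :=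
  ∀ x y, G.Adj x y → ∀ p : (G.deleteEdges {s(x, y)}).Walk x y, 2 * k ≤ p.length

theorem HighGirth.mono {k : ℕ} {G H : SimpleGraph V} (h : HighGirth k G) (hle : H ≤ G) :
    HighGirth k H := fun x y hxy p => by
  simpa using h x y (hle hxy) (p.mapLe (SimpleGraph.deleteEdges_mono hle))

theorem highGirth_bot (k : ℕ) : HighGirth k (⊥ : SimpleGraph V) := fun _ _ h => absurd h id

/-- A walk that may use one extra edge either avoids it or splits at it. -/
theorem walk_sup_edge {K : SimpleGraph V} {u v x y : V} (p : (K ⊔ SimpleGraph.edge u v).Walk x y) :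
    (∃ q : K.Walk x y, q.length ≤ p.length) ∨
    (∃ (q : K.Walk x u) (r : K.Walk v y), q.length + r.length + 1 ≤ p.length) ∨
    (∃ (q : K.Walk x v) (r : K.Walk u y), q.length + r.length + 1 ≤ p.length) := by
  induction p with
  | nil => exact .inl ⟨.nil, le_rfl⟩
  | @cons a b c h p ih =>
    simp only [SimpleGraph.Walk.length_cons]
    rcases h with h | h
    · rcases ih with ⟨q, hq⟩ | ⟨q, r, hq⟩ | ⟨q, r, hq⟩
      · exact .inl ⟨.cons h q, by simp; omega⟩
      · exact .inr (.inl ⟨.cons h q, r, by simp; omega⟩)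
      · exact .inr (.inr ⟨.cons h q, r, by simp; omega⟩)
    · rw [SimpleGraph.edge_adj] at h
      rcases h.1 with ⟨rfl, rfl⟩ | ⟨rfl, rfl⟩
      · rcases ih with ⟨q, hq⟩ | ⟨q, r, hq⟩ | ⟨q, r, hq⟩
        · exact .inr (.inl ⟨.nil, q, by simp; omega⟩)
        · exact .inr (.inl ⟨.nil, r, by simp; omega⟩)
        · exact .inl ⟨r, by omega⟩
      · rcases ih with ⟨q, hq⟩ | ⟨q, r, hq⟩ | ⟨q, r, hq⟩
        · exact .inr (.inr ⟨.nil, q, by simp; omega⟩)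
        · exact .inl ⟨r, by omega⟩
        · exact .inr (.inr ⟨.nil, r, by simp; omega⟩)

theorem HighGirth.sup_edge {k : ℕ} {G : SimpleGraph V} (h : HighGirth k G) {u v : V}
    (huv : ∀ p : G.Walk u v, 2 * k ≤ p.length) : HighGirth k (G ⊔ SimpleGraph.edge u v) := by
  intro x y hxy p
  by_cases hs : s(x, y) = s(u, v)
  · have hle : (G ⊔ SimpleGraph.edge u v).deleteEdges {s(x, y)} ≤ G := by
      intro a b hab
      rw [SimpleGraph.deleteEdges_adj] at hab
      rcases hab.1 with h | h
      · exact h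
      · rw [SimpleGraph.edge_adj] at h
        exact absurd (by rw [hs]; simpa using h.1) hab.2
    have hs' := hs
    rw [Sym2.eq_iff] at hs'
    rcases hs' with ⟨rfl, rfl⟩ | ⟨rfl, rfl⟩
    · simpa using huv (p.mapLe hle)
    · simpa using huv (p.mapLe hle).reverse
  · have hxy' : G.Adj x y := by
      rcases hxy with h | h
      · exact h
      · rw [SimpleGraph.edge_adj] at h
        exact absurd (by simpa using h.1) hs
    have hle : (G ⊔ SimpleGraph.edge u v).deleteEdges {s(x, y)} ≤
        G.deleteEdges {s(x, y)} ⊔ SimpleGraph.edge u v := by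
      intro a b hab
      rw [SimpleGraph.deleteEdges_adj] at hab
      rcases hab.1 with h | h
      · exact .inl (SimpleGraph.deleteEdges_adj.2 ⟨h, hab.2⟩)
      · exact .inr h
    have hK : G.deleteEdges {s(x, y)} ≤ G := SimpleGraph.deleteEdges_le _
    rcases walk_sup_edge (p.mapLe hle) with ⟨q, hq⟩ | ⟨q, r, hq⟩ | ⟨q, r, hq⟩
    · have := h x y hxy' q
      simp at hq; omega
    · have := huv ((q.mapLe hK).reverse.append (.cons hxy' (r.mapLe hK).reverse))
      simp at hq this; omega
    · have := huv ((r.mapLe hK).append (.cons hxy'.symm (q.mapLe hK)))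
      simp at hq this; omega

theorem ncard_edgeSet_sup_edge [Finite V] {G : SimpleGraph V} {u v : V} (hne : u ≠ v)
    (h : ¬ G.Adj u v) :
    (G ⊔ SimpleGraph.edge u v).edgeSet.ncard = G.edgeSet.ncard + 1 := by
  rw [SimpleGraph.edgeSet_sup, SimpleGraph.edgeSet_edge_of_ne hne, Set.union_singleton,
    Set.ncard_insert_of_notMem (by simpa using h)]

theorem edist_lt_of_mem_support {G : SimpleGraph V} {v x y : V} (p : G.Walk v y)
    (hx : x ∈ p.support) (hxy : x ≠ y) : G.edist v x < p.length := by
  classical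
  refine (G.edist_le (p.takeUntil x hx)).trans_lt ?_
  exact_mod_cast SimpleGraph.Walk.length_takeUntil_lt_length hx hxy

theorem HighGirth.unique_parent {k j : ℕ} {G : SimpleGraph V} (h : HighGirth k G) (hj : j + 1 ≤ k)
    {v x y y' : V} (hy : G.Adj x y) (hy' : G.Adj x y') (hd : G.edist v y ≤ j)
    (hd' : G.edist v y' ≤ j) (hx : (j : ℕ∞) ≤ G.edist v x) : y = y' := by
  by_contra hne
  have key : ∀ z, G.Adj x z → G.edist v z ≤ j →
      ∃ p : (G.deleteEdges {s(x, y)}).Walk v z, p.length ≤ j := by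
    intro z hz hzj
    obtain ⟨p, hp⟩ := SimpleGraph.exists_walk_of_edist_ne_top
      (ne_top_of_le_ne_top (ENat.natCast_ne_top j) hzj)
    have hpj : p.length ≤ j := by rw [← hp] at hzj; exact_mod_cast hzj
    have hxp : x ∉ p.support := fun hmem => by
      have h1 := edist_lt_of_mem_support p hmem hz.ne
      have : (j : ℕ∞) < p.length := hx.trans_lt h1
      have : j < p.length := by exact_mod_cast this
      omega
    refine ⟨p.toDeleteEdges {s(x, y)} ?_, by simpa using hpj⟩
    intro e he hxy
    rw [Set.mem_singleton_iff] at hxy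
    subst hxy
    exact hxp (p.fst_mem_support_of_mem_edges he)
  obtain ⟨p, hp⟩ := key y hy hd
  obtain ⟨q, hq⟩ := key y' hy' hd'
  have hadj : (G.deleteEdges {s(x, y)}).Adj x y' := by
    rw [SimpleGraph.deleteEdges_adj]
    refine ⟨hy', fun hc => ?_⟩
    rw [Set.mem_singleton_iff, Sym2.eq_iff] at hc
    rcases hc with ⟨-, rfl⟩ | ⟨rfl, -⟩
    · exact hne rfl
    · exact hy.ne rfl
  have := h x y hy (.cons hadj (q.reverse.append p))
  simp at this
  omega

theorem HighGirth.pow_le_card_sphere [Fintype V] {k D : ℕ} {G : SimpleGraph V}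
    (h : HighGirth k G) {v : V}
    (hdeg : ∀ x, G.Reachable v x → D + 1 ≤ (G.neighborSet x).ncard) {j : ℕ} (hj : j ≤ k) :
    D ^ j ≤ {x | G.edist v x = j}.ncard := by
  classical
  induction j with
  | zero =>
    rw [pow_zero, Nat.one_le_iff_ne_zero, ← Nat.pos_iff_ne_zero, Set.ncard_pos]
    exact ⟨v, by simp⟩
  | succ j ih =>
    have ih := ih (by omega)
    have hsub : ∀ x, G.edist v x = j →
        D ≤ {y | G.Adj x y ∧ G.edist v y = (j + 1 : ℕ)}.ncard := by
      intro x hx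
      have hr : G.Reachable v x := SimpleGraph.reachable_of_edist_ne_top (by rw [hx]; simp)
      have h1 := hdeg x hr
      have hcover : G.neighborSet x ⊆ {y | G.Adj x y ∧ G.edist v y = (j + 1 : ℕ)} ∪
          {y | G.Adj x y ∧ G.edist v y ≤ j} := by
        intro y hy
        have hy : G.Adj x y := hy
        have : G.edist v y ≤ (j + 1 : ℕ) := by
          refine (SimpleGraph.edist_triangle (v := x)).trans ?_
          rw [hx, SimpleGraph.edist_eq_one_iff_adj.2 hy]
          exact_mod_cast le_rfl
        rcases this.eq_or_lt with h | h
        · exact .inl ⟨hy, h⟩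
        · exact .inr ⟨hy, ENat.lt_natCast_add_one_iff.1 (by exact_mod_cast h)⟩
      have hone : {y | G.Adj x y ∧ G.edist v y ≤ j}.ncard ≤ 1 := by
        rw [Set.ncard_le_one]
        intro a ha b hb
        exact h.unique_parent hj ha.1 hb.1 ha.2 hb.2 hx.ge
      have := (Set.ncard_le_ncard hcover).trans (Set.ncard_union_le _ _)
      omega
    have hfin : ∀ j : ℕ, {x | G.edist v x = j}.ncard =
        (Finset.univ.filter fun x => G.edist v x = j).card := by
      intro j
      rw [← Set.ncard_coe_finset]; simp
    have hfin' : ∀ x, {y | G.Adj x y ∧ G.edist v y = (j + 1 : ℕ)}.ncard =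
        (Finset.univ.filter fun y => G.Adj x y ∧ G.edist v y = (j + 1 : ℕ)).card := by
      intro j
      rw [← Set.ncard_coe_finset]; simp
    rw [hfin] at ih ⊢
    have hdisj : ((Finset.univ.filter fun x => G.edist v x = j : Finset V) : Set V).PairwiseDisjoint
        fun x => Finset.univ.filter fun y => G.Adj x y ∧ G.edist v y = (j + 1 : ℕ) := by
      intro a ha b hb hab
      refine Finset.disjoint_left.2 fun z hza hzb => hab ?_
      simp only [Finset.coe_filter, Finset.mem_univ, true_and, Set.mem_ofPred_eq,
        Finset.mem_filter] at ha hb hza hzb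
      refine h.unique_parent hj hza.1.symm hzb.1.symm ha.le hb.le ?_
      rw [hza.2]
      exact_mod_cast Nat.le_succ j
    calc D ^ (j + 1) = D ^ j * D := pow_succ _ _
      _ ≤ (Finset.univ.filter fun x => G.edist v x = j).card * D := Nat.mul_le_mul_right _ ih
      _ = ∑ x ∈ Finset.univ.filter fun x => G.edist v x = j, D := by simp
      _ ≤ ∑ x ∈ Finset.univ.filter fun x => G.edist v x = j,
          (Finset.univ.filter fun y => G.Adj x y ∧ G.edist v y = (j + 1 : ℕ)).card := by
        refine Finset.sum_le_sum fun x hx => ?_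
        rw [← hfin']
        exact hsub x (by simpa using hx)
      _ = _ := (Finset.card_biUnion hdisj).symm
      _ ≤ _ := by
        refine Finset.card_le_card fun y hy => ?_
        simp only [Finset.mem_biUnion, Finset.mem_filter, Finset.mem_univ, true_and] at hy ⊢
        obtain ⟨_, _, h⟩ := hy
        exact h.2

theorem HighGirth.ncard_edgeSet_le_of_support [Fintype V] {k D S : ℕ} (hk : 1 ≤ k) (hD : S ≤ D ^ k)
    (s : Finset V) : ∀ G : SimpleGraph V, HighGirth k G →
      (∀ v, {x | G.Reachable v x}.ncard ≤ S) → (∀ x y, G.Adj x y → x ∈ s) →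
      G.edgeSet.ncard ≤ D * s.card := by
  classical
  induction s using Finset.strongInduction with
  | H s ih =>
    intro G hG hS hs
    by_cases hex : ∃ v ∈ s, (G.neighborSet v).ncard ≤ D
    · obtain ⟨v, hv, hdeg⟩ := hex
      have hle := G.deleteIncidenceSet_le v
      have := ih (s.erase v) (Finset.erase_ssubset hv) (G.deleteIncidenceSet v) (hG.mono hle)
        (fun x => (Set.ncard_le_ncard fun y hy => hy.mono hle).trans (hS x))
        (fun x y hxy => by
          rw [SimpleGraph.deleteIncidenceSet_adj] at hxy
          exact Finset.mem_erase.2 ⟨hxy.2.1, hs x y hxy.1⟩)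
      have hcard := G.card_edgeFinset_deleteIncidenceSet v
      rw [Set.ncard_eq_toFinset_card' ] at this hdeg ⊢
      change (SimpleGraph.edgeFinset _).card ≤ _ at this
      change (SimpleGraph.edgeFinset _).card ≤ _
      rw [Finset.card_erase_of_mem hv] at this
      have hdeg : G.degree v ≤ D := hdeg
      rw [hcard] at this
      have hpos := Finset.card_pos.2 ⟨v, hv⟩
      obtain ⟨c, hc⟩ : ∃ c, s.card = c + 1 := ⟨s.card - 1, by omega⟩
      rw [hc] at this ⊢
      simp only [Nat.add_sub_cancel] at this
      rw [mul_add]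
      omega
    · push Not at hex
      by_cases hne : s.Nonempty
      · exfalso
        obtain ⟨v, hv⟩ := hne
        have hreach : ∀ x, G.Reachable v x → x ∈ s := by
          intro x ⟨p⟩
          by_cases hn : v = x
          · exact hn ▸ hv
          · cases hp : p.reverse with
            | nil => exact absurd rfl hn
            | cons h _ => exact hs _ _ h
        have h1 := hG.pow_le_card_sphere (v := v) (D := D) (fun x hx => hex x (hreach x hx)) le_rfl
        have h2 : insert v {x | G.edist v x = k} ⊆ {x | G.Reachable v x} := by
          rintro x (rfl | hx)
          · exact SimpleGraph.Reachable.rfl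
          · exact SimpleGraph.reachable_of_edist_ne_top
              (by rw [show G.edist v x = k from hx]; simp)
        have h3 := (Set.ncard_le_ncard h2).trans (hS v)
        rw [Set.ncard_insert_of_notMem] at h3
        · omega
        · simp only [Set.mem_ofPred_eq, SimpleGraph.edist_self]
          intro h0
          have : (0 : ℕ) = k := by exact_mod_cast h0
          omega
      · rw [Finset.not_nonempty_iff_eq_empty] at hne
        subst hne
        have : G.edgeSet = ∅ := by
          ext e
          induction e with
          | _ x y => simpa using fun h => hs x y h
        simp [this]

/-- A graph of girth more than `2 * k` with components of at most `D ^ k` vertices has average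
degree at most `2 * D`. -/
theorem HighGirth.ncard_edgeSet_le [Fintype V] {k D S : ℕ} (hk : 1 ≤ k) (hD : S ≤ D ^ k)
    {G : SimpleGraph V} (hG : HighGirth k G) (hS : ∀ v, {x | G.Reachable v x}.ncard ≤ S) :
    G.edgeSet.ncard ≤ D * Fintype.card V :=
  hG.ncard_edgeSet_le_of_support hk hD Finset.univ G hS fun _ _ _ => Finset.mem_univ _

end Girth

/-! ## Coloured edge insertion -/

section Spanner

variable {n m : ℕ}

/-- Stretching single edges suffices for a fault-tolerant spanner. -/
theorem isVFTSpanner_of_edges {V : Type*} {G H : SimpleGraph V} {w : Sym2 V → ℝ≥0} {f t : ℕ}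
    (ht : 1 ≤ t) (hle : H ≤ G)
    (h : ∀ F : Finset V, F.card ≤ f → ∀ u v, G.Adj u v → u ∉ F → v ∉ F →
      ∃ p : (faulty H F).Walk u v, p.length ≤ t ∧ ∀ x ∈ p.edges, w x ≤ w s(u, v)) :
    IsVFTSpanner G w f t H := by
  refine ⟨hle, fun F hF u v hu hv => ?_⟩
  have key : ∀ u v (p : (faulty G F).Walk u v), ∃ q : (faulty H F).Walk u v,
      (q.edges.map fun x => (w x : ℝ≥0∞)).sum ≤
        (t : ℝ≥0∞) * (p.edges.map fun x => (w x : ℝ≥0∞)).sum := by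
    intro u v p
    induction p with
    | nil => exact ⟨.nil, by simp⟩
    | @cons a b c hab p ih =>
      obtain ⟨q, hq⟩ := ih
      obtain ⟨r, hr, hw⟩ := h F hF a b hab.1 hab.2.1 hab.2.2
      refine ⟨r.append q, ?_⟩
      rw [SimpleGraph.Walk.edges_append, List.map_append, List.sum_append,
        SimpleGraph.Walk.edges_cons, List.map_cons, List.sum_cons, mul_add]
      refine add_le_add ?_ hq
      have h1 := List.sum_le_card_nsmul (r.edges.map fun x => (w x : ℝ≥0∞)) (w s(a, b)) (by
        intro x hx
        obtain ⟨y, hy, rfl⟩ := List.mem_map.1 hx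
        exact_mod_cast hw y hy)
      refine h1.trans ?_
      rw [List.length_map, SimpleGraph.Walk.length_edges, nsmul_eq_mul]
      gcongr
  unfold wdist
  rw [ENNReal.mul_iInf_of_ne (by simp; omega) (by simp)]
  refine le_iInf fun p => ?_
  obtain ⟨q, hq⟩ := key u v p
  exact (iInf_le _ q).trans hq

/-- A light walk of at most `2 * k - 1` edges joins `u` and `v` in the graph of position `a`. -/
def Near (col : Fin n → ℕ → ℕ) (w : Sym2 (Fin n) → ℝ≥0) (k : ℕ)
    (Hg : ℕ → ℕ → SimpleGraph (Fin n)) (u v : Fin n) (a : ℕ) : Prop :=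
  ∃ p : (Hg a (col u a + col v a)).Walk u v, p.length ≤ 2 * k - 1 ∧
    ∀ x ∈ p.edges, w x ≤ w s(u, v)

theorem Near.mono {col : Fin n → ℕ → ℕ} {w : Sym2 (Fin n) → ℝ≥0} {k a : ℕ}
    {Hg Hg' : ℕ → ℕ → SimpleGraph (Fin n)} {u v : Fin n} (h : Near col w k Hg u v a)
    (hle : ∀ a σ, Hg a σ ≤ Hg' a σ) : Near col w k Hg' u v a := by
  obtain ⟨p, h₁, h₂⟩ := h
  exact ⟨p.mapLe (hle _ _), by simpa using h₁, by simpa using h₂⟩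

/-- In a graph whose edges have colour sum `σ`, a walk uses two colours only. -/
theorem color_of_mem_support {H : SimpleGraph (Fin n)} {c : Fin n → ℕ} {σ : ℕ}
    (hc : ∀ t t', H.Adj t t' → c t + c t' = σ) {u v : Fin n} (p : H.Walk u v) {x : Fin n}
    (hx : x ∈ p.support) : c x = c u ∨ c x + c u = σ := by
  induction p with
  | nil => simp at hx; exact .inl (by rw [hx])
  | cons h p ih =>
    rw [SimpleGraph.Walk.support_cons, List.mem_cons] at hx
    rcases hx with rfl | hx
    · exact .inl rfl
    · have := hc _ _ h
      rcases ih hx with h | h <;> omega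

/-- The state of the greedy algorithm after the edges in `proc` have been processed in order of
weight and those in `acc` have been accepted; `Hg a σ` collects accepted edges whose colours at
position `a` add up to `σ`. -/
structure SpannerInv (e : Fin m → Fin n × Fin n) (w : Sym2 (Fin n) → ℝ≥0)
    (col : Fin n → ℕ → ℕ) (N k : ℕ) (Hg : ℕ → ℕ → SimpleGraph (Fin n))
    (proc acc : Finset (Fin m)) : Prop where
  acc_sub : acc ⊆ proc
  color : ∀ a σ t t', (Hg a σ).Adj t t' → col t a + col t' a = σ
  mem_acc : ∀ a σ t t', (Hg a σ).Adj t t' → ∃ i ∈ acc, s(t, t') = s((e i).1, (e i).2)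
  girth : ∀ a σ, HighGirth k (Hg a σ)
  near : ∀ i ∈ proc, i ∉ acc → ∃ A : Finset ℕ, A ⊆ Finset.range N ∧ N < 2 * A.card ∧
    ∀ a ∈ A, Near col w k Hg (e i).1 (e i).2 a
  order : ∀ i ∈ proc, ∀ j ∉ proc, w s((e i).1, (e i).2) ≤ w s((e j).1, (e j).2)

variable {e : Fin m → Fin n × Fin n} {w : Sym2 (Fin n) → ℝ≥0} {col : Fin n → ℕ → ℕ} {N k : ℕ}
  {Hg : ℕ → ℕ → SimpleGraph (Fin n)} {proc acc : Finset (Fin m)}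

theorem spannerInv_empty (e : Fin m → Fin n × Fin n) (w : Sym2 (Fin n) → ℝ≥0)
    (col : Fin n → ℕ → ℕ) (N k : ℕ) : SpannerInv e w col N k (fun _ _ => ⊥) ∅ ∅ where
  acc_sub := subset_rfl
  color _ _ _ _ h := absurd h id
  mem_acc _ _ _ _ h := absurd h id
  girth _ _ := highGirth_bot k
  near i hi := by simp at hi
  order i hi := by simp at hi

/-- The graphs after insertion of the edge `uv` at the positions in `A`. -/
def insertAt (col : Fin n → ℕ → ℕ) (Hg : ℕ → ℕ → SimpleGraph (Fin n)) (u v : Fin n)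
    (A : Finset ℕ) (a σ : ℕ) : SimpleGraph (Fin n) :=
  if a ∈ A ∧ σ = col u a + col v a then Hg a σ ⊔ SimpleGraph.edge u v else Hg a σ

theorem le_insertAt (u v : Fin n) (A : Finset ℕ) (a σ : ℕ) :
    Hg a σ ≤ insertAt col Hg u v A a σ := by
  unfold insertAt
  split_ifs
  · exact le_sup_left
  · exact le_rfl

theorem SpannerInv.near_of_walk (h : SpannerInv e w col N k Hg proc acc) {i : Fin m}
    (hi : i ∉ proc) {a : ℕ} (p : (Hg a (col (e i).1 a + col (e i).2 a)).Walk (e i).1 (e i).2)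
    (hp : p.length ≤ 2 * k - 1) : Near col w k Hg (e i).1 (e i).2 a := by
  refine ⟨p, hp, fun x hx => ?_⟩
  induction x with
  | _ x y =>
    obtain ⟨j, hj, hxy⟩ := h.mem_acc _ _ _ _ (p.adj_of_mem_edges hx)
    rw [hxy]
    exact h.order j (h.acc_sub hj) i hi

theorem SpannerInv.reject (h : SpannerInv e w col N k Hg proc acc) {i : Fin m} (hi : i ∉ proc)
    (hmin : ∀ j ∉ proc, w s((e i).1, (e i).2) ≤ w s((e j).1, (e j).2))
    {A : Finset ℕ} (hA : A ⊆ Finset.range N) (hcard : N < 2 * A.card)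
    (hnear : ∀ a ∈ A, ∃ p : (Hg a (col (e i).1 a + col (e i).2 a)).Walk (e i).1 (e i).2,
      p.length ≤ 2 * k - 1) : SpannerInv e w col N k Hg (insert i proc) acc where
  acc_sub := h.acc_sub.trans (Finset.subset_insert _ _)
  color := h.color
  mem_acc := h.mem_acc
  girth := h.girth
  near j hj hj' := by
    rcases Finset.mem_insert.1 hj with rfl | hj
    · exact ⟨A, hA, hcard, fun a ha => by
        obtain ⟨p, hp⟩ := hnear a ha
        exact h.near_of_walk hi p hp⟩
    · exact h.near j hj hj'
  order j hj j' hj' := by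
    rw [Finset.mem_insert, not_or] at hj'
    rcases Finset.mem_insert.1 hj with rfl | hj
    · exact hmin j' hj'.2
    · exact h.order j hj j' hj'.2

theorem SpannerInv.accept (h : SpannerInv e w col N k Hg proc acc) {i : Fin m} (hi : i ∉ proc)
    (hmin : ∀ j ∉ proc, w s((e i).1, (e i).2) ≤ w s((e j).1, (e j).2)) {A : Finset ℕ}
    (hfar : ∀ a ∈ A, ∀ p : (Hg a (col (e i).1 a + col (e i).2 a)).Walk (e i).1 (e i).2,
      2 * k ≤ p.length) :
    SpannerInv e w col N k (insertAt col Hg (e i).1 (e i).2 A) (insert i proc)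
      (insert i acc) where
  acc_sub := Finset.insert_subset_insert _ h.acc_sub
  color a σ t t' hadj := by
    unfold insertAt at hadj
    split_ifs at hadj with hc
    · rcases hadj with hadj | hadj
      · exact h.color a σ t t' hadj
      · rw [SimpleGraph.edge_adj] at hadj
        rcases hadj.1 with ⟨rfl, rfl⟩ | ⟨rfl, rfl⟩
        · exact hc.2.symm
        · rw [hc.2, add_comm]
    · exact h.color a σ t t' hadj
  mem_acc a σ t t' hadj := by
    have old : (Hg a σ).Adj t t' → ∃ j ∈ insert i acc, s(t, t') = s((e j).1, (e j).2) :=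
      fun hadj => by
        obtain ⟨j, hj, hjt⟩ := h.mem_acc a σ t t' hadj
        exact ⟨j, Finset.mem_insert_of_mem hj, hjt⟩
    unfold insertAt at hadj
    split_ifs at hadj with hc
    · rcases hadj with hadj | hadj
      · exact old hadj
      · rw [SimpleGraph.edge_adj] at hadj
        exact ⟨i, Finset.mem_insert_self _ _, Sym2.eq_iff.2 hadj.1⟩
    · exact old hadj
  girth a σ := by
    unfold insertAt
    split_ifs with hc
    · obtain ⟨ha, rfl⟩ := hc
      exact (h.girth a _).sup_edge (hfar a ha)
    · exact h.girth a σ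
  near j hj hj' := by
    rw [Finset.mem_insert, not_or] at hj'
    rcases Finset.mem_insert.1 hj with rfl | hj
    · exact absurd rfl hj'.1
    · obtain ⟨A', h₁, h₂, h₃⟩ := h.near j hj hj'.2
      exact ⟨A', h₁, h₂, fun a ha => (h₃ a ha).mono fun a σ => le_insertAt _ _ _ _ _⟩
  order j hj j' hj' := by
    rw [Finset.mem_insert, not_or] at hj'
    rcases Finset.mem_insert.1 hj with rfl | hj
    · exact hmin j' hj'.2
    · exact h.order j hj j' hj'.2

/-- A code with few agreements between any two words makes the accepted edges a fault-tolerant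
spanner. -/
theorem SpannerInv.isVFTSpanner {G : SimpleGraph (Fin n)} (he : IsEdgeList G e)
    (h : SpannerInv e w col N k Hg Finset.univ acc) (hk : 1 ≤ k) {f B : ℕ}
    (hcode : ∀ u v, u ≠ v → ((Finset.range N).filter fun a => col u a = col v a).card ≤ B)
    (hN : 4 * f * B ≤ N) {H : SimpleGraph (Fin n)}
    (hH : H = SimpleGraph.fromEdgeSet {x | ∃ i ∈ acc, x = s((e i).1, (e i).2)}) :
    IsVFTSpanner G w f (2 * k - 1) H := by
  classical
  have hHG : H ≤ G := by
    intro u v huv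
    rw [hH, SimpleGraph.fromEdgeSet_adj] at huv
    obtain ⟨⟨i, -, hi⟩, -⟩ := huv
    rw [← SimpleGraph.mem_edgeSet, ← he.2]
    exact ⟨i, hi.symm⟩
  refine isVFTSpanner_of_edges (by omega) hHG fun F hF u v huv hu hv => ?_
  suffices H' : ∀ u v, u ∉ F → v ∉ F → (∃ i, u = (e i).1 ∧ v = (e i).2) → u ≠ v →
      ∃ p : (faulty H F).Walk u v, p.length ≤ 2 * k - 1 ∧ ∀ x ∈ p.edges, w x ≤ w s(u, v) by
    rw [← SimpleGraph.mem_edgeSet, ← he.2] at huv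
    obtain ⟨i, hi⟩ := huv
    have hne : (e i).1 ≠ (e i).2 := by
      have : s((e i).1, (e i).2) ∈ G.edgeSet := by rw [← he.2]; exact ⟨i, rfl⟩
      exact (SimpleGraph.mem_edgeSet _).1 this |>.ne
    rcases Sym2.eq_iff.1 hi with ⟨rfl, rfl⟩ | ⟨rfl, rfl⟩
    · exact H' _ _ hu hv ⟨i, rfl, rfl⟩ hne
    · obtain ⟨p, hp, hw⟩ := H' _ _ hv hu ⟨i, rfl, rfl⟩ hne
      refine ⟨p.reverse, by simpa using hp, fun x hx => ?_⟩
      rw [Sym2.eq_swap]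
      exact hw x (by simpa using hx)
  rintro u v hu hv ⟨i, rfl, rfl⟩ hne
  by_cases hi : i ∈ acc
  · have hadj : (faulty H F).Adj (e i).1 (e i).2 := by
      refine ⟨?_, hu, hv⟩
      rw [hH, SimpleGraph.fromEdgeSet_adj]
      exact ⟨⟨i, hi, rfl⟩, hne⟩
    exact ⟨hadj.toWalk, by simp; omega, by simp⟩
  · obtain ⟨A, hAN, hA, hnear⟩ := h.near i (Finset.mem_univ _) hi
    let bad : Finset ℕ := F.biUnion fun x =>
      ((Finset.range N).filter fun a => col x a = col (e i).1 a) ∪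
      ((Finset.range N).filter fun a => col x a = col (e i).2 a)
    have hbad : bad.card ≤ f * (2 * B) := by
      refine (Finset.card_biUnion_le_card_mul _ _ (2 * B) fun x hx => ?_).trans
        (Nat.mul_le_mul_right _ hF)
      refine (Finset.card_union_le _ _).trans ?_
      have h1 := hcode x (e i).1 (by rintro rfl; exact hu hx)
      have h2 := hcode x (e i).2 (by rintro rfl; exact hv hx)
      omega
    obtain ⟨a, haA, habad⟩ : ∃ a ∈ A, a ∉ bad := by
      by_contra hcon
      push Not at hcon
      have := Finset.card_le_card (show A ⊆ bad from hcon)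
      nlinarith
    obtain ⟨p, hp, hw⟩ := hnear a haA
    have hsupp : ∀ x ∈ p.support, x ∉ F := by
      intro x hx hxF
      refine habad (Finset.mem_biUnion.2 ⟨x, hxF, ?_⟩)
      rw [Finset.mem_union, Finset.mem_filter, Finset.mem_filter]
      rcases color_of_mem_support (h.color a _) p hx with h' | h'
      · exact .inl ⟨hAN haA, h'⟩
      · exact .inr ⟨hAN haA, by omega⟩
    have hedges : ∀ x ∈ p.edges, x ∈ (faulty H F).edgeSet := by
      intro x hx
      induction x with
      | _ x y =>
        refine ⟨?_, hsupp x (p.fst_mem_support_of_mem_edges hx),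
          hsupp y (p.snd_mem_support_of_mem_edges hx)⟩
        have hadj := p.adj_of_mem_edges hx
        obtain ⟨j, hj, hxy⟩ := h.mem_acc _ _ _ _ hadj
        rw [hH, SimpleGraph.fromEdgeSet_adj]
        exact ⟨⟨j, hj, hxy⟩, hadj.ne⟩
    exact ⟨p.transfer _ hedges, by simpa using hp, by simpa using hw⟩

theorem SpannerInv.ncard_reachable_le (h : SpannerInv e w col N k Hg proc acc) {a cap : ℕ}
    (hcap : ∀ c, (Finset.univ.filter fun x => col x a = c).card ≤ cap) (σ : ℕ) (v : Fin n) :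
    {x | (Hg a σ).Reachable v x}.ncard ≤ 2 * cap := by
  classical
  have hsub : {x | (Hg a σ).Reachable v x} ⊆
      ((Finset.univ.filter fun x => col x a = col v a) ∪
        (Finset.univ.filter fun x => col x a = σ - col v a) : Finset (Fin n)) := by
    rintro x ⟨p⟩
    have := color_of_mem_support (h.color a σ) p p.end_mem_support
    simp only [Finset.coe_union, Finset.coe_filter, Finset.mem_univ, true_and, Set.mem_union,
      Set.mem_ofPred_eq]
    omega
  refine (Set.ncard_le_ncard hsub).trans ?_
  rw [Set.ncard_coe_finset]
  refine (Finset.card_union_le _ _).trans ?_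
  have h1 := hcap (col v a)
  have h2 := hcap (σ - col v a)
  omega

theorem SpannerInv.ncard_edgeSet_le (h : SpannerInv e w col N k Hg proc acc) (hk : 1 ≤ k)
    {a cap D : ℕ} (hcap : ∀ c, (Finset.univ.filter fun x => col x a = c).card ≤ cap)
    (hD : 2 * cap ≤ D ^ k) (σ : ℕ) : (Hg a σ).edgeSet.ncard ≤ D * n := by
  simpa using (h.girth a σ).ncard_edgeSet_le hk hD fun v => h.ncard_reachable_le hcap σ v

end Spanner

/-! ## Addresses and parameters -/

/-- The address of entry `(a, b)` of a two-dimensional table with rows of length `X`. -/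
def enc2 (X a b : ℕ) : ℕ := a * X + b

theorem enc2_inj {X a b a' b' : ℕ} (hb : b < X) (hb' : b' < X) :
    enc2 X a b = enc2 X a' b' ↔ a = a' ∧ b = b' := by
  refine ⟨fun h => ?_, by rintro ⟨rfl, rfl⟩; rfl⟩
  unfold enc2 at h
  have hX : 0 < X := by omega
  have h1 : (a * X + b) / X = a := by
    rw [add_comm, Nat.add_mul_div_right _ _ hX, Nat.div_eq_of_lt hb, zero_add]
  have h2 : (a' * X + b') / X = a' := by
    rw [add_comm, Nat.add_mul_div_right _ _ hX, Nat.div_eq_of_lt hb', zero_add]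
  have : a = a' := by rw [← h1, h, h2]
  subst this
  omega

theorem enc2_lt {X a b p : ℕ} (ha : a < X ^ p) (hb : b < X) : enc2 X a b < X ^ (p + 1) := by
  unfold enc2
  calc a * X + b < a * X + X := by omega
    _ = (a + 1) * X := by ring
    _ ≤ X ^ p * X := Nat.mul_le_mul_right _ ha
    _ = X ^ (p + 1) := (pow_succ _ _).symm

/-- The parameters of the algorithm: `X` is the base of all addresses, `2 ^ L` is about `n`. -/
structure Cfg (μ : Machine) where
  (n m f k L X : ℕ)
  hn : 1 ≤ n
  hf : 1 ≤ f
  hfn : f ≤ n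
  hk : 1 ≤ k
  hkL : k ≤ L
  hL : n ≤ 2 ^ L
  hL' : 2 ^ L ≤ 2 * n
  hm : 2 * m ≤ n ^ 2
  hX : X = 128 * n ^ 3
  hW : X ^ 6 ≤ 2 ^ μ.W

namespace Cfg

variable {μ : Machine} (c : Cfg μ)

/-- The number of colours. -/
def q : ℕ := 33 * c.f

/-- The number of colourings. -/
def N : ℕ := 32 * c.f * c.L

/-- The maximal size of a colour class. -/
def cap : ℕ := c.n / c.f + 1

/-- The address of entry `(a, b)`. -/
def adr (a b : ℕ) : ℕ := enc2 c.X a b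

theorem n_le_cube : c.n ≤ c.n ^ 3 := Nat.le_self_pow (by norm_num) _

theorem sq_le_cube : c.n ^ 2 ≤ c.n ^ 3 := Nat.pow_le_pow_right c.hn (by norm_num)

theorem X_ge : 128 ≤ c.X := by
  have := c.hn; have := c.n_le_cube; have := c.hX; omega

theorem n_lt : 2 * c.n + 1 < c.X := by
  have := c.hn; have := c.n_le_cube; have := c.hX; omega

theorem L_lt : c.L < 2 * c.n := (Nat.lt_two_pow_self).trans_le c.hL'

theorem N_lt : c.N + 1 < c.X := by
  have := c.L_lt
  have h1 : c.f * c.L ≤ c.n * (2 * c.n) := Nat.mul_le_mul c.hfn this.le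
  have h2 : c.n * (2 * c.n) = 2 * c.n ^ 2 := by ring
  have := c.sq_le_cube
  have := c.hX
  have := c.hn
  have := c.n_le_cube
  have : c.N = 32 * (c.f * c.L) := by unfold N; ring
  omega

theorem two_q_lt : 2 * c.q + 1 < c.X := by
  have := c.hfn; have := c.hn; have := c.n_le_cube; have := c.hX; unfold q; omega

theorem cap_lt : c.cap + 1 < c.X := by
  have := c.n_lt; have := Nat.div_le_self c.n c.f; have := c.hn; unfold cap; omega

theorem k_lt : 2 * c.k + 1 < c.X := by
  have := c.L_lt; have := c.hkL; have := c.n_le_cube; have := c.hX; omega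

theorem m_lt : 2 * c.m + 1 < c.X := by
  have := c.hm; have := c.sq_le_cube; have := c.hX; have := c.hn; have := c.n_le_cube; omega

theorem pow_le {p : ℕ} (hp : p ≤ 6) : c.X ^ p ≤ 2 ^ μ.W :=
  (Nat.pow_le_pow_right (by have := c.X_ge; omega) hp).trans c.hW

theorem sq_X_le : 128 * c.X ≤ 2 ^ μ.W := by
  have h1 := c.pow_le (p := 2) (by norm_num)
  have := Nat.mul_le_mul_right c.X c.X_ge
  rw [pow_two] at h1
  omega

theorem one_lt {μ : Machine} (c : Cfg μ) : 1 < 2 ^ μ.W := by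
  have := c.sq_X_le; have := c.X_ge; omega

theorem fit2 {a b : ℕ} (ha : a < c.X) (hb : b < c.X) : c.adr a b < 2 ^ μ.W :=
  (enc2_lt (p := 1) (by simpa using ha) hb).trans_le (c.pow_le (by norm_num))

theorem adr_lt {a b : ℕ} (ha : a < c.X) (hb : b < c.X) : c.adr a b < c.X ^ 2 :=
  enc2_lt (p := 1) (by simpa using ha) hb

theorem fit3 {g b : ℕ} (ha : g < c.X ^ 2) (hb : b < c.X) : c.adr g b < 2 ^ μ.W :=
  (enc2_lt ha hb).trans_le (c.pow_le (by norm_num))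

theorem adr_lt3 {a b : ℕ} (ha : a < c.X ^ 2) (hb : b < c.X) : c.adr a b < c.X ^ 3 :=
  enc2_lt ha hb

theorem fit4 {g b : ℕ} (ha : g < c.X ^ 3) (hb : b < c.X) : c.adr g b < 2 ^ μ.W :=
  (enc2_lt ha hb).trans_le (c.pow_le (by norm_num))

theorem adr_inj {a b a' b' : ℕ} (hb : b < c.X) (hb' : b' < c.X) :
    c.adr a b = c.adr a' b' ↔ a = a' ∧ b = b' := enc2_inj hb hb'

/-- Reading a two-dimensional table after an update. -/
theorem upd2 {F : ℕ → ℕ} {v a b a' b' : ℕ} (hb : b < c.X) (hb' : b' < c.X) :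
    Function.update F (c.adr a b) v (c.adr a' b') =
      if a' = a ∧ b' = b then v else F (c.adr a' b') := by
  simp only [Function.update_apply, c.adr_inj hb' hb]

/-- Reading a three-dimensional table after an update. -/
theorem upd3 {F : ℕ → ℕ} {v a b d a' b' d' : ℕ} (hb : b < c.X) (hb' : b' < c.X) (hd : d < c.X)
    (hd' : d' < c.X) :
    Function.update F (c.adr (c.adr a b) d) v (c.adr (c.adr a' b') d') =
      if a' = a ∧ b' = b ∧ d' = d then v else F (c.adr (c.adr a' b') d') := by
  simp only [c.upd2 hd hd', c.adr_inj hb' hb, and_assoc]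

/-- The registers that hold the parameters. -/
structure Regs (s : State) : Prop where
  r0 : s.reg 0 = c.n
  r1 : s.reg 1 = c.m
  r2 : s.reg 2 = c.f
  r3 : s.reg 3 = c.k
  r4 : s.reg 4 = c.L
  r6 : s.reg 6 = 2 * c.k
  r7 : s.reg 7 = c.q
  r8 : s.reg 8 = c.N
  r9 : s.reg 9 = c.cap
  r10 : s.reg 10 = c.X

variable {c}

theorem Regs.of_agree {s s' : State} (h : c.Regs s) (ha : ∀ x ≤ 10, s'.reg x = s.reg x) :
    c.Regs s' :=
  ⟨(ha 0 (by norm_num)).trans h.r0, (ha 1 (by norm_num)).trans h.r1,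
    (ha 2 (by norm_num)).trans h.r2, (ha 3 (by norm_num)).trans h.r3,
    (ha 4 (by norm_num)).trans h.r4, (ha 6 (by norm_num)).trans h.r6,
    (ha 7 (by norm_num)).trans h.r7, (ha 8 (by norm_num)).trans h.r8,
    (ha 9 (by norm_num)).trans h.r9, (ha 10 (by norm_num)).trans h.r10⟩

theorem Regs.setR {s : State} (h : c.Regs s) {x : ℕ} (v : ℕ) (hx : 10 < x) :
    c.Regs (s.setR x v) :=
  h.of_agree fun y hy => by simp; omega

theorem Regs.setA {s : State} (h : c.Regs s) (a i v : ℕ) : c.Regs (s.setA a i v) :=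
  h.of_agree fun _ _ => rfl

theorem Regs.frame {s s' : State} {p : Cmd} (h : c.Regs s) (hf : Frame p s s')
    (hp : ∀ x ∈ p.regs, 10 < x) : c.Regs s' :=
  h.of_agree fun x hx => hf.reg x fun hm => by have := hp x hm; omega

end Cfg

namespace Expr

/-- The address of entry `(i, j)`. -/
def adr (i j : Expr) : Expr := .bin .add (.bin .mul i (.reg 10)) j

@[simp] theorem adr_cost (i j : Expr) : (adr i j).cost = 3 + i.cost + j.cost := by
  simp [adr, cost]; ring

end Expr

theorem Ev.adr {μ : Machine} {c : Cfg μ} {s : State} {i j : Expr} {a b : ℕ} (hr : c.Regs s)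
    (hi : Ev μ s i a) (hj : Ev μ s j b) (h : c.adr a b < 2 ^ μ.W) :
    Ev μ s (Expr.adr i j) (c.adr a b) := by
  have h' : a * c.X + b < 2 ^ μ.W := h
  exact .add (.mul hi (.reg hr.r10) (by omega)) hj h'

/-! ## The program -/

open FTSpanner.Expr in
/-- Adds up, by colour at position `a`, the weights of the vertices before `v`. -/
def accLoop : Cmd :=
  .forLt 13 (.reg 11)
    (.setArr 7 (adr (adr (reg 11) (reg 12)) (get 3 (adr (reg 13) (reg 12))))
      (bin .add (get 7 (adr (adr (reg 11) (reg 12)) (get 3 (adr (reg 13) (reg 12)))))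
        (bin .add (get 6 (adr (reg 11) (reg 13))) (lit 1))))

open FTSpanner.Expr in
/-- Finds the lightest colour whose class is not full. -/
def argminLoop : Cmd :=
  .forLt 14 (.reg 7)
    (.ite (bin .lt (get 5 (adr (reg 12) (reg 14))) (reg 9))
      (.ite (bin .lt (get 7 (adr (adr (reg 11) (reg 12)) (reg 14))) (reg 15))
        (.seq (.setReg 15 (get 7 (adr (adr (reg 11) (reg 12)) (reg 14))))
          (.setReg 16 (reg 14)))
        .skip)
      .skip)

open FTSpanner.Expr in
/-- Doubles the weights of the vertices that agree with `v` at position `a`. -/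
def doubleLoop : Cmd :=
  .forLt 13 (.reg 11)
    (.ite (bin .eq (get 3 (adr (reg 13) (reg 12))) (reg 16))
      (.setArr 6 (adr (reg 11) (reg 13))
        (bin .add (bin .mul (lit 2) (get 6 (adr (reg 11) (reg 13)))) (lit 1)))
      .skip)

open FTSpanner.Expr in
/-- Chooses the colour of `v` at position `a`. -/
def codeStep : Cmd :=
  .seq accLoop <|
  .seq (.setReg 15 (reg 10)) <|
  .seq (.setReg 16 (lit 0)) <|
  .seq argminLoop <|
  .seq (.setArr 3 (adr (reg 11) (reg 12)) (reg 16)) <|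
  .seq (.setArr 4 (adr (adr (reg 12) (reg 16)) (get 5 (adr (reg 12) (reg 16)))) (reg 11)) <|
  .seq (.setArr 5 (adr (reg 12) (reg 16)) (bin .add (get 5 (adr (reg 12) (reg 16))) (lit 1)))
  doubleLoop

/-- Chooses all colours. -/
def buildCode : Cmd := .forLt 11 (.reg 0) (.forLt 12 (.reg 8) codeStep)

section Code

variable {μ : Machine} {c : Cfg μ}

theorem accLoop_spec {s : State} {τ v a : ℕ} (hr : c.Regs s) (hv : s.reg 11 = v) (ha : s.reg 12 = a)
    (hvn : v < c.n) (haN : a < c.N) (hcol : ∀ u < v, s.arr 3 (c.adr u a) < c.q)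
    (hsum : ∑ u ∈ Finset.range v, (s.arr 6 (c.adr v u) + 1) < c.X)
    (h0 : ∀ x < c.q, s.arr 7 (c.adr (c.adr v a) x) = 0) :
    WP μ accLoop (fun s' τ' =>
      (∀ x < c.q, s'.arr 7 (c.adr (c.adr v a) x) =
        ∑ u ∈ (Finset.range v).filter (fun u => s.arr 3 (c.adr u a) = x),
          (s.arr 6 (c.adr v u) + 1)) ∧
      (∀ v' a' x, a' < c.X → x < c.X → (v' ≠ v ∨ a' ≠ a) →
        s'.arr 7 (c.adr (c.adr v' a') x) = s.arr 7 (c.adr (c.adr v' a') x)) ∧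
      τ' ≤ τ + 60 * v + 60) s τ := by
  have hnX := c.n_lt
  have hNX := c.N_lt
  have hqX := c.two_q_lt
  have hX := c.sq_X_le
  have hva : c.adr v a < c.X ^ 2 := c.adr_lt (by omega) (by omega)
  refine WP.forLt v (fun j s' τ' =>
      (∀ x < c.q, s'.arr 7 (c.adr (c.adr v a) x) =
        ∑ u ∈ (Finset.range j).filter (fun u => s.arr 3 (c.adr u a) = x),
          (s.arr 6 (c.adr v u) + 1)) ∧
      (∀ v' a' x, a' < c.X → x < c.X → (v' ≠ v ∨ a' ≠ a) →
        s'.arr 7 (c.adr (c.adr v' a') x) = s.arr 7 (c.adr (c.adr v' a') x)) ∧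
      τ' ≤ τ + 60 * j + 2) c.one_lt (by omega) ?_ ?_ ?_ ?_
  · exact ⟨by simpa using h0, fun _ _ _ _ _ _ => rfl, by simp⟩
  · intro j s' τ' hfr _ _ _
    exact .reg ((hfr.reg 11 (by decide)).trans hv)
  · rintro j s' τ' hfr hj hjv ⟨h1, h2, h3⟩
    have hr' : c.Regs s' := hr.frame hfr (by decide)
    have hv' : s'.reg 11 = v := (hfr.reg 11 (by decide)).trans hv
    have ha' : s'.reg 12 = a := (hfr.reg 12 (by decide)).trans ha
    have e3 : s'.arr 3 = s.arr 3 := hfr.arr 3 (by decide)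
    have e6 : s'.arr 6 = s.arr 6 := hfr.arr 6 (by decide)
    have hx := hcol j hjv
    have hcell : s'.arr 7 (c.adr (c.adr v a) (s.arr 3 (c.adr j a))) +
        (s.arr 6 (c.adr v j) + 1) < c.X := by
      rw [h1 _ hx]
      refine lt_of_le_of_lt ?_ hsum
      rw [add_comm, ← Finset.sum_insert (f := fun u => s.arr 6 (c.adr v u) + 1) (by simp)]
      refine Finset.sum_le_sum_of_subset fun u hu => ?_
      simp only [Finset.mem_insert, Finset.mem_filter, Finset.mem_range] at hu ⊢
      omega
    have ecol : Ev μ s' (Expr.get 3 (Expr.adr (.reg 13) (.reg 12))) (s.arr 3 (c.adr j a)) :=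
      .get (.adr hr' (.reg hj) (.reg ha') (c.fit2 (by omega) (by omega))) (by rw [e3])
    have eadr := Ev.adr hr' (.adr hr' (.reg hv') (.reg ha') (c.fit2 (by omega) (by omega))) ecol
      (c.fit3 hva (by omega))
    refine WP.setArr eadr (.add (.get eadr rfl) (.add (.get (.adr hr' (.reg hv') (.reg hj)
      (c.fit2 (by omega) (by omega))) (by rw [e6])) (.lit c.one_lt) ?_) ?_) ?_
    · omega
    · omega
    · refine ⟨hj, fun x hxq => ?_, fun v' a' x hv'' ha'' hne => ?_, ?_⟩
      · simp only [State.setR_arr, State.setA_arr, if_true]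
        rw [c.upd2 (by omega) (by omega), Finset.range_add_one, Finset.filter_insert]
        by_cases hxx : x = s.arr 3 (c.adr j a)
        · rw [if_pos ⟨rfl, hxx⟩, if_pos hxx.symm, Finset.sum_insert (by simp), h1 _ hx, ← hxx]
          ring
        · rw [if_neg (by tauto), if_neg (Ne.symm hxx), h1 _ hxq]
      · simp only [State.setR_arr, State.setA_arr, if_true]
        rw [c.upd3 (by omega) (by omega) (by omega) (by omega), if_neg (by tauto)]
        exact h2 v' a' x hv'' ha'' hne
      · simp only [Expr.cost, Expr.adr_cost]
        omega
  · rintro s' τ' hfr _ ⟨h1, h2, h3⟩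
    refine ⟨h1, h2, ?_⟩
    simp only [Expr.cost]
    omega

theorem argminLoop_spec {s : State} {τ v a : ℕ} (hr : c.Regs s) (hv : s.reg 11 = v)
    (ha : s.reg 12 = a) (hvn : v < c.n) (haN : a < c.N) (h15 : s.reg 15 = c.X) :
    WP μ argminLoop (fun s' τ' =>
      (∀ x < c.q, s.arr 5 (c.adr a x) < c.cap →
        s'.reg 15 ≤ s.arr 7 (c.adr (c.adr v a) x)) ∧
      (s'.reg 15 = c.X ∨ s'.reg 16 < c.q ∧ s.arr 5 (c.adr a (s'.reg 16)) < c.cap ∧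
        s.arr 7 (c.adr (c.adr v a) (s'.reg 16)) = s'.reg 15) ∧
      τ' ≤ τ + 60 * c.q + 60) s τ := by
  have hnX := c.n_lt
  have hNX := c.N_lt
  have hqX := c.two_q_lt
  have hX := c.sq_X_le
  have hva : c.adr v a < c.X ^ 2 := c.adr_lt (by omega) (by omega)
  refine WP.forLt c.q (fun j s' τ' =>
      (∀ x < j, s.arr 5 (c.adr a x) < c.cap →
        s'.reg 15 ≤ s.arr 7 (c.adr (c.adr v a) x)) ∧
      (s'.reg 15 = c.X ∨ s'.reg 16 < c.q ∧ s.arr 5 (c.adr a (s'.reg 16)) < c.cap ∧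
        s.arr 7 (c.adr (c.adr v a) (s'.reg 16)) = s'.reg 15) ∧
      τ' ≤ τ + 60 * j + 2) c.one_lt (by omega) ?_ ?_ ?_ ?_
  · exact ⟨by simp, .inl (by simpa using h15), by simp⟩
  · intro j s' τ' hfr _ _ _
    exact .reg (hr.frame hfr (by decide)).r7
  · rintro j s' τ' hfr hj hjq ⟨h1, h2, h3⟩
    have hr' : c.Regs s' := hr.frame hfr (by decide)
    have hv' : s'.reg 11 = v := (hfr.reg 11 (by decide)).trans hv
    have ha' : s'.reg 12 = a := (hfr.reg 12 (by decide)).trans ha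
    have e5 : s'.arr 5 = s.arr 5 := hfr.arr 5 (by decide)
    have e7 : s'.arr 7 = s.arr 7 := hfr.arr 7 (by decide)
    have ev7 : Ev μ s' (Expr.get 7 (Expr.adr (Expr.adr (.reg 11) (.reg 12)) (.reg 14)))
        (s.arr 7 (c.adr (c.adr v a) j)) :=
      .get (.adr hr' (.adr hr' (.reg hv') (.reg ha') (c.fit2 (by omega) (by omega))) (.reg hj)
        (c.fit3 hva (by omega))) (by rw [e7])
    refine WP.iteLt (.get (.adr hr' (.reg ha') (.reg hj) (c.fit2 (by omega) (by omega)))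
      (by rw [e5])) (.reg hr'.r9) c.one_lt (fun hlt => ?_) (fun hle => ?_)
    · refine WP.iteLt ev7 (.reg rfl) c.one_lt (fun hlt' => ?_) (fun hle' => ?_)
      · refine WP.seqSetReg ev7 (WP.setReg (.reg (by simpa using hj)) ?_)
        refine ⟨by simpa using hj, fun x hx hxc => ?_, .inr ?_, ?_⟩
        · simp only [State.setR_reg, Nat.reduceEqDiff, if_false, if_true]
          rcases Nat.lt_succ_iff_lt_or_eq.1 hx with hx | rfl
          · exact hlt'.le.trans (h1 x hx hxc)
          · exact le_rfl
        · simp only [State.setR_reg, Nat.reduceEqDiff, if_false, if_true]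
          exact ⟨hjq, hlt, trivial⟩
        · simp only [Expr.cost, Expr.adr_cost]
          omega
      · refine WP.skip ⟨hj, fun x hx hxc => ?_, by simpa using h2, ?_⟩
        · simp only [State.setR_reg, Nat.reduceEqDiff, if_false]
          rcases Nat.lt_succ_iff_lt_or_eq.1 hx with hx | rfl
          · exact h1 x hx hxc
          · exact hle'
        · simp only [Expr.cost, Expr.adr_cost]
          omega
    · refine WP.skip ⟨hj, fun x hx hxc => ?_, by simpa using h2, ?_⟩
      · simp only [State.setR_reg, Nat.reduceEqDiff, if_false]
        rcases Nat.lt_succ_iff_lt_or_eq.1 hx with hx | rfl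
        · exact h1 x hx hxc
        · omega
      · simp only [Expr.cost, Expr.adr_cost]
        omega
  · rintro s' τ' hfr _ ⟨h1, h2, h3⟩
    refine ⟨h1, h2, ?_⟩
    simp only [Expr.cost]
    omega

theorem doubleLoop_spec {s : State} {τ v a : ℕ} (hr : c.Regs s) (hv : s.reg 11 = v)
    (ha : s.reg 12 = a) (hvn : v < c.n) (haN : a < c.N)
    (hwt : ∀ u < v, s.arr 6 (c.adr v u) < c.X) :
    WP μ doubleLoop (fun s' τ' =>
      (∀ u < v, s'.arr 6 (c.adr v u) + 1 =
        if s.arr 3 (c.adr u a) = s.reg 16 then 2 * (s.arr 6 (c.adr v u) + 1)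
        else s.arr 6 (c.adr v u) + 1) ∧
      (∀ v' u, u < c.X → v' ≠ v → s'.arr 6 (c.adr v' u) = s.arr 6 (c.adr v' u)) ∧
      τ' ≤ τ + 60 * v + 60) s τ := by
  have hnX := c.n_lt
  have hNX := c.N_lt
  have hX := c.sq_X_le
  refine WP.forLt v (fun j s' τ' =>
      (∀ u < j, s'.arr 6 (c.adr v u) + 1 =
        if s.arr 3 (c.adr u a) = s.reg 16 then 2 * (s.arr 6 (c.adr v u) + 1)
        else s.arr 6 (c.adr v u) + 1) ∧
      (∀ u < v, j ≤ u → s'.arr 6 (c.adr v u) = s.arr 6 (c.adr v u)) ∧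
      (∀ v' u, u < c.X → v' ≠ v → s'.arr 6 (c.adr v' u) = s.arr 6 (c.adr v' u)) ∧
      τ' ≤ τ + 60 * j + 2) c.one_lt (by omega) ?_ ?_ ?_ ?_
  · exact ⟨by simp, fun _ _ _ => rfl, fun _ _ _ _ => rfl, by simp⟩
  · intro j s' τ' hfr _ _ _
    exact .reg ((hfr.reg 11 (by decide)).trans hv)
  · rintro j s' τ' hfr hj hjv ⟨h1, h2, h3, h4⟩
    have hr' : c.Regs s' := hr.frame hfr (by decide)
    have hv' : s'.reg 11 = v := (hfr.reg 11 (by decide)).trans hv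
    have ha' : s'.reg 12 = a := (hfr.reg 12 (by decide)).trans ha
    have e3 : s'.arr 3 = s.arr 3 := hfr.arr 3 (by decide)
    have e16 : s'.reg 16 = s.reg 16 := hfr.reg 16 (by decide)
    have eadr : Ev μ s' (Expr.adr (.reg 11) (.reg 13)) (c.adr v j) :=
      .adr hr' (.reg hv') (.reg hj) (c.fit2 (by omega) (by omega))
    have hw := hwt j hjv
    have hold := h2 j hjv le_rfl
    refine WP.iteEq (.get (.adr hr' (.reg hj) (.reg ha') (c.fit2 (by omega) (by omega)))
      (by rw [e3])) (.reg e16) c.one_lt (fun heq => ?_) (fun hne => ?_)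
    · refine WP.setArr eadr (.add (.mul (.lit (by omega)) (.get eadr hold) (by omega))
        (.lit c.one_lt) (by omega)) ⟨hj, fun u hu => ?_, fun u hu hju => ?_,
          fun v' u hu hne => ?_, ?_⟩
      · simp only [State.setR_arr, State.setA_arr, if_true]
        rw [c.upd2 (by omega) (by omega)]
        rcases Nat.lt_succ_iff_lt_or_eq.1 hu with hu | rfl
        · rw [if_neg (by omega)]
          exact h1 u hu
        · rw [if_pos ⟨rfl, rfl⟩, if_pos heq]
          ring
      · simp only [State.setR_arr, State.setA_arr, if_true]
        rw [c.upd2 (by omega) (by omega), if_neg (by omega)]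
        exact h2 u hu (by omega)
      · simp only [State.setR_arr, State.setA_arr, if_true]
        rw [c.upd2 (by omega) (by omega), if_neg (by tauto)]
        exact h3 v' u hu hne
      · simp only [Expr.cost, Expr.adr_cost]
        omega
    · refine WP.skip ⟨hj, fun u hu => ?_, fun u hu hju => h2 u hu (by omega), h3, ?_⟩
      · rcases Nat.lt_succ_iff_lt_or_eq.1 hu with hu | rfl
        · exact h1 u hu
        · simp only [State.setR_arr]
          rw [if_neg hne, hold]
      · simp only [Expr.cost, Expr.adr_cost]
        omega
  · rintro s' τ' hfr _ ⟨h1, h2, h3, h4⟩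
    refine ⟨h1, h3, ?_⟩
    simp only [Expr.cost]
    omega

end Code

section Code

variable {μ : Machine} {c : Cfg μ}

theorem succ_pow_mul_le (x L : ℕ) (hx : 1 ≤ x) : (x + 1) ^ (x * L) ≤ 4 ^ L * x ^ (x * L) := by
  have hx' : (0 : ℝ) < x := by exact_mod_cast hx
  have h1 : ((x : ℝ) + 1) ^ x ≤ 4 * (x : ℝ) ^ x := by
    have h2 : (1 / (x : ℝ) + 1) ^ x ≤ Real.exp 1 := by
      calc (1 / (x : ℝ) + 1) ^ x ≤ Real.exp (1 / x) ^ x :=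
            pow_le_pow_left₀ (by positivity) (Real.add_one_le_exp _) _
        _ = Real.exp 1 := by
            rw [← Real.exp_nat_mul]; congr 1; field_simp
    have h3 : ((x : ℝ) + 1) ^ x = (1 / (x : ℝ) + 1) ^ x * (x : ℝ) ^ x := by
      rw [← mul_pow]; congr 1; field_simp; ring
    rw [h3]
    have := Real.exp_one_lt_d9
    gcongr
    linarith
  have h4 : (x + 1) ^ x ≤ 4 * x ^ x := by exact_mod_cast h1
  calc (x + 1) ^ (x * L) = ((x + 1) ^ x) ^ L := pow_mul _ _ _
    _ ≤ (4 * x ^ x) ^ L := Nat.pow_le_pow_left h4 L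
    _ = 4 ^ L * x ^ (x * L) := by rw [mul_pow, ← pow_mul]

theorem potential_le (c : Cfg μ) {Φ a v : ℕ} (hv : v ≤ c.n) (ha : a ≤ c.N)
    (h : Φ * (32 * c.f) ^ a ≤ v * (32 * c.f + 1) ^ a) : Φ ≤ c.n * 4 ^ c.L := by
  have hf := c.hf
  have hpos : 0 < (32 * c.f) ^ c.N := Nat.pow_pos (by omega)
  refine Nat.le_of_mul_le_mul_right ?_ hpos
  obtain ⟨d, hd⟩ := Nat.exists_eq_add_of_le ha
  have hN : (32 * c.f + 1) ^ c.N ≤ 4 ^ c.L * (32 * c.f) ^ c.N :=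
    succ_pow_mul_le (32 * c.f) c.L (by omega)
  calc Φ * (32 * c.f) ^ c.N = Φ * (32 * c.f) ^ a * (32 * c.f) ^ d := by rw [hd, pow_add]; ring
    _ ≤ v * (32 * c.f + 1) ^ a * (32 * c.f + 1) ^ d :=
        Nat.mul_le_mul h (Nat.pow_le_pow_left (by omega) _)
    _ = v * (32 * c.f + 1) ^ c.N := by rw [hd, pow_add]; ring
    _ ≤ c.n * (4 ^ c.L * (32 * c.f) ^ c.N) := Nat.mul_le_mul hv hN
    _ = c.n * 4 ^ c.L * (32 * c.f) ^ c.N := by ring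

theorem four_pow_le (c : Cfg μ) : 4 ^ c.L ≤ 4 * c.n ^ 2 := by
  calc 4 ^ c.L = (2 ^ c.L) ^ 2 := by rw [← pow_mul, mul_comm, pow_mul]; norm_num
    _ ≤ (2 * c.n) ^ 2 := Nat.pow_le_pow_left c.hL' 2
    _ = 4 * c.n ^ 2 := by ring

theorem potential_lt (c : Cfg μ) {Φ a v : ℕ} (hv : v ≤ c.n) (ha : a ≤ c.N)
    (h : Φ * (32 * c.f) ^ a ≤ v * (32 * c.f + 1) ^ a) : Φ < c.X := by
  have h1 := potential_le c hv ha h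
  have h2 := Nat.mul_le_mul_left c.n (four_pow_le c)
  have h3 : c.n * (4 * c.n ^ 2) = 4 * c.n ^ 3 := by ring
  have := c.hX
  have := c.hn
  have := c.n_le_cube
  omega

theorem agree_le (c : Cfg μ) {j : ℕ} (h : 2 ^ j ≤ c.n * 4 ^ c.L) : j ≤ 3 * c.L := by
  have h1 : 2 ^ j ≤ 2 ^ (3 * c.L) := by
    refine h.trans ((Nat.mul_le_mul_right _ c.hL).trans (le_of_eq ?_))
    rw [pow_mul, ← mul_pow]; norm_num
  exact (Nat.pow_le_pow_iff_right (by norm_num)).1 h1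

/-- Most colours are available, so the lightest available colour is light. -/
theorem card_available (c : Cfg μ) {load : ℕ → ℕ} {v : ℕ} (hv : v ≤ c.n)
    (hload : ∑ x ∈ Finset.range c.q, load x = v) :
    32 * c.f ≤ ((Finset.range c.q).filter fun x => load x < c.cap).card := by
  have h1 : ((Finset.range c.q).filter fun x => ¬ load x < c.cap).card * c.cap ≤ v := by
    rw [← hload, ← smul_eq_mul]
    refine le_trans (Finset.card_nsmul_le_sum _ load _ fun x hx => ?_)
      (Finset.sum_le_sum_of_subset (Finset.filter_subset _ _))
    exact not_lt.1 (Finset.mem_filter.1 hx).2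
  have h2 := Finset.card_filter_add_card_filter_not (s := Finset.range c.q)
    (fun x => load x < c.cap)
  rw [Finset.card_range] at h2
  have h3 : c.n < c.f * c.cap := by
    have := Nat.lt_mul_div_succ c.n (show 0 < c.f from c.hf)
    exact this
  have h4 : ((Finset.range c.q).filter fun x => ¬ load x < c.cap).card < c.f := by
    by_contra hcon
    have := Nat.mul_le_mul_right c.cap (not_lt.1 hcon)
    omega
  have : c.q = 33 * c.f := rfl
  omega

variable (c) in
/-- The class lists of position `a` hold the vertices below `v`. -/
structure ClassInv (s : State) (a v : ℕ) : Prop where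
  cnt : ∀ x < c.q, s.arr 5 (c.adr a x) =
    ((Finset.range v).filter fun u => s.arr 3 (c.adr u a) = x).card
  le : ∀ x < c.q, s.arr 5 (c.adr a x) ≤ c.cap
  lst : ∀ x < c.q, ∀ r < s.arr 5 (c.adr a x), s.arr 4 (c.adr (c.adr a x) r) < v
  mem : ∀ u < v, ∃ r < s.arr 5 (c.adr a (s.arr 3 (c.adr u a))),
    s.arr 4 (c.adr (c.adr a (s.arr 3 (c.adr u a))) r) = u
  col : ∀ u < v, s.arr 3 (c.adr u a) < c.q

variable (c) in
/-- The vertices below `v` have all their colours, and `v` has those at positions below `a`. -/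
structure CodeInv (s : State) (v a : ℕ) : Prop where
  done : ∀ a' < a, ClassInv c s a' (v + 1)
  todo : ∀ a' < c.N, a ≤ a' → ClassInv c s a' v
  wt : ∀ u < v, s.arr 6 (c.adr v u) + 1 = 2 ^ ((Finset.range a).filter fun a' =>
    s.arr 3 (c.adr u a') = s.arr 3 (c.adr v a')).card
  pot : (∑ u ∈ Finset.range v, (s.arr 6 (c.adr v u) + 1)) * (32 * c.f) ^ a ≤
    v * (32 * c.f + 1) ^ a
  acc : ∀ v' < c.n, ∀ a' < c.N, ∀ x < c.q, v < v' ∨ v' = v ∧ a ≤ a' →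
    s.arr 7 (c.adr (c.adr v' a') x) = 0
  fresh : ∀ v' < c.n, ∀ u < c.n, v < v' → s.arr 6 (c.adr v' u) = 0
  agree : ∀ u < v, ∀ u' < u, ((Finset.range c.N).filter fun a' =>
    s.arr 3 (c.adr u' a') = s.arr 3 (c.adr u a')).card ≤ 3 * c.L

theorem ClassInv.insert {s s' : State} {a v b : ℕ} (h : ClassInv c s a v)
    (ha : a < c.X) (hb : b < c.q) (hload : s.arr 5 (c.adr a b) < c.cap)
    (h3 : s'.arr 3 = Function.update (s.arr 3) (c.adr v a) b)
    (h4 : s'.arr 4 = Function.update (s.arr 4) (c.adr (c.adr a b) (s.arr 5 (c.adr a b))) v)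
    (h5 : s'.arr 5 = Function.update (s.arr 5) (c.adr a b) (s.arr 5 (c.adr a b) + 1)) :
    ClassInv c s' a (v + 1) := by
  have hqX := c.two_q_lt
  have hcX := c.cap_lt
  have c3 : ∀ u, s'.arr 3 (c.adr u a) = if u = v then b else s.arr 3 (c.adr u a) := by
    intro u
    rw [h3, c.upd2 ha ha]; simp
  have c5 : ∀ x < c.q, s'.arr 5 (c.adr a x) =
      if x = b then s.arr 5 (c.adr a b) + 1 else s.arr 5 (c.adr a x) := by
    intro x hx
    rw [h5, c.upd2 (by omega) (by omega)]; simp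
  have c4 : ∀ x < c.q, ∀ r < c.X, s'.arr 4 (c.adr (c.adr a x) r) =
      if x = b ∧ r = s.arr 5 (c.adr a b) then v else s.arr 4 (c.adr (c.adr a x) r) := by
    intro x hx r hr
    rw [h4, c.upd3 (by omega) (by omega) (by omega) (by omega)]; simp
  refine ⟨fun x hx => ?_, fun x hx => ?_, fun x hx r hr => ?_, fun u hu => ?_, fun u hu => ?_⟩
  · have hf : ((Finset.range v).filter fun u => s'.arr 3 (c.adr u a) = x) =
        (Finset.range v).filter fun u => s.arr 3 (c.adr u a) = x := by
      refine Finset.filter_congr fun u hu => ?_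
      rw [c3, if_neg (by have := Finset.mem_range.1 hu; omega)]
    rw [c5 x hx, Finset.range_add_one, Finset.filter_insert, hf, c3, if_pos rfl]
    by_cases hxb : x = b
    · subst hxb
      rw [if_pos rfl, if_pos rfl, Finset.card_insert_of_notMem (by simp), h.cnt x hx]
    · rw [if_neg hxb, if_neg (Ne.symm hxb), h.cnt x hx]
  · rw [c5 x hx]
    split_ifs
    · omega
    · exact h.le x hx
  · have hle := h.le x hx
    rw [c5 x hx] at hr
    by_cases h1 : x = b ∧ r = s.arr 5 (c.adr a b)
    · rw [c4 x hx r (by omega), if_pos h1]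
      exact Nat.lt_succ_self v
    · have hr' : r < s.arr 5 (c.adr a x) := by
        by_cases hxb : x = b
        · subst hxb
          rw [if_pos rfl] at hr
          have : r ≠ s.arr 5 (c.adr a x) := fun h => h1 ⟨rfl, h⟩
          omega
        · rwa [if_neg hxb] at hr
      rw [c4 x hx r (by omega), if_neg h1]
      exact (h.lst x hx r hr').trans (Nat.lt_succ_self v)
  · rw [c3]
    by_cases huv : u = v
    · rw [if_pos huv]
      refine ⟨s.arr 5 (c.adr a b), ?_, ?_⟩
      · rw [c5 b hb, if_pos rfl]; omega
      · rw [c4 b hb _ (by omega), if_pos ⟨rfl, rfl⟩, huv]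
    · rw [if_neg huv]
      have hcol := h.col u (by omega)
      obtain ⟨r, hr, hru⟩ := h.mem u (by omega)
      have := h.le _ hcol
      refine ⟨r, ?_, ?_⟩
      · rw [c5 _ hcol]; split_ifs with h1
        · rw [h1] at hr; omega
        · exact hr
      · rw [c4 _ hcol r (by omega), if_neg, hru]
        rintro ⟨h1, h2⟩
        rw [h1] at hr; omega
  · rw [c3]
    split_ifs
    · exact hb
    · exact h.col u (by omega)

theorem ClassInv.congr {s s' : State} {a v : ℕ} (h : ClassInv c s a v)
    (h3 : ∀ u < v, s'.arr 3 (c.adr u a) = s.arr 3 (c.adr u a))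
    (h4 : ∀ x < c.q, ∀ r < c.cap, s'.arr 4 (c.adr (c.adr a x) r) = s.arr 4 (c.adr (c.adr a x) r))
    (h5 : ∀ x < c.q, s'.arr 5 (c.adr a x) = s.arr 5 (c.adr a x)) : ClassInv c s' a v where
  cnt x hx := by
    rw [h5 x hx, h.cnt x hx]
    congr 1
    exact Finset.filter_congr fun u hu => by rw [h3 u (Finset.mem_range.1 hu)]
  le x hx := by rw [h5 x hx]; exact h.le x hx
  lst x hx r hr := by
    rw [h5 x hx] at hr
    rw [h4 x hx r (hr.trans_le (h.le x hx))]
    exact h.lst x hx r hr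
  mem u hu := by
    obtain ⟨r, hr, hru⟩ := h.mem u hu
    have hc := h.col u hu
    refine ⟨r, ?_, ?_⟩
    · rw [h3 u hu, h5 _ hc]; exact hr
    · rw [h3 u hu, h4 _ hc r (hr.trans_le (h.le _ hc)), hru]
  col u hu := by rw [h3 u hu]; exact h.col u hu

theorem CodeInv.step {s s' : State} {v a b : ℕ} (h : CodeInv c s v a) (hv : v < c.n)
    (ha : a < c.N) (hb : b < c.q) (hload : s.arr 5 (c.adr a b) < c.cap)
    (hmin : ∀ x < c.q, s.arr 5 (c.adr a x) < c.cap →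
      ∑ u ∈ (Finset.range v).filter (fun u => s.arr 3 (c.adr u a) = b),
          (s.arr 6 (c.adr v u) + 1) ≤
        ∑ u ∈ (Finset.range v).filter (fun u => s.arr 3 (c.adr u a) = x),
          (s.arr 6 (c.adr v u) + 1))
    (h3 : s'.arr 3 = Function.update (s.arr 3) (c.adr v a) b)
    (h4 : s'.arr 4 = Function.update (s.arr 4) (c.adr (c.adr a b) (s.arr 5 (c.adr a b))) v)
    (h5 : s'.arr 5 = Function.update (s.arr 5) (c.adr a b) (s.arr 5 (c.adr a b) + 1))
    (h6 : ∀ u < v, s'.arr 6 (c.adr v u) + 1 =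
        if s.arr 3 (c.adr u a) = b then 2 * (s.arr 6 (c.adr v u) + 1)
        else s.arr 6 (c.adr v u) + 1)
    (h6' : ∀ v' u, u < c.X → v' ≠ v → s'.arr 6 (c.adr v' u) = s.arr 6 (c.adr v' u))
    (h7 : ∀ v' a' x, a' < c.X → x < c.X → (v' ≠ v ∨ a' ≠ a) →
        s'.arr 7 (c.adr (c.adr v' a') x) = s.arr 7 (c.adr (c.adr v' a') x)) :
    CodeInv c s' v (a + 1) := by
  have hnX := c.n_lt
  have hNX := c.N_lt
  have hqX := c.two_q_lt
  have hcX := c.cap_lt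
  have hT := h.todo a ha le_rfl
  have c3 : ∀ u, ∀ a' < c.X, s'.arr 3 (c.adr u a') =
      if u = v ∧ a' = a then b else s.arr 3 (c.adr u a') := by
    intro u a' ha'
    rw [h3, c.upd2 (by omega) (by omega)]
  have other : ∀ a' < c.N, a' ≠ a → ∀ v', ClassInv c s a' v' → ClassInv c s' a' v' := by
    intro a' ha' hne v' hcl
    refine hcl.congr (fun u hu => ?_) (fun x hx r hr => ?_) (fun x hx => ?_)
    · rw [c3 _ _ (by omega), if_neg (by tauto)]
    · rw [h4, c.upd3 (by omega) (by omega) (by omega) (by omega), if_neg (by tauto)]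
    · rw [h5, c.upd2 (by omega) (by omega), if_neg (by tauto)]
  refine ⟨fun a' ha' => ?_, fun a' ha' haa => other a' ha' (by omega) v (h.todo a' ha' (by omega)),
    fun u hu => ?_, ?_, fun v' hv' a' ha' x hx hlt => ?_, fun v' hv' u hu hlt => ?_,
    fun u hu u' hu' => ?_⟩
  · rcases Nat.lt_succ_iff_lt_or_eq.1 ha' with ha' | rfl
    · exact other a' (by omega) (by omega) _ (h.done a' ha')
    · exact hT.insert (by omega) hb hload h3 h4 h5
  · have hf : ((Finset.range a).filter fun a' => s'.arr 3 (c.adr u a') = s'.arr 3 (c.adr v a')) =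
        (Finset.range a).filter fun a' => s.arr 3 (c.adr u a') = s.arr 3 (c.adr v a') := by
      refine Finset.filter_congr fun a' ha' => ?_
      have := Finset.mem_range.1 ha'
      rw [c3 _ _ (by omega), c3 _ _ (by omega), if_neg (by omega), if_neg (by omega)]
    have hu3 : s'.arr 3 (c.adr u a) = s.arr 3 (c.adr u a) := by
      rw [c3 _ _ (by omega), if_neg (by omega)]
    have hv3 : s'.arr 3 (c.adr v a) = b := by rw [c3 _ _ (by omega), if_pos ⟨rfl, rfl⟩]
    rw [h6 u hu, h.wt u hu, Finset.range_add_one, Finset.filter_insert, hf, hu3, hv3]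
    split_ifs
    · rw [Finset.card_insert_of_notMem (by simp), pow_succ, mul_comm]
    · rfl
  · set Φ := ∑ u ∈ Finset.range v, (s.arr 6 (c.adr v u) + 1) with hΦ
    set A : ℕ → ℕ := fun x => ∑ u ∈ (Finset.range v).filter (fun u => s.arr 3 (c.adr u a) = x),
          (s.arr 6 (c.adr v u) + 1) with hA
    have hnew : ∑ u ∈ Finset.range v, (s'.arr 6 (c.adr v u) + 1) = Φ + A b := by
      have hAb : A b = ∑ u ∈ Finset.range v,
          if s.arr 3 (c.adr u a) = b then s.arr 6 (c.adr v u) + 1 else 0 := Finset.sum_filter _ _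
      rw [hAb, hΦ, ← Finset.sum_add_distrib]
      refine Finset.sum_congr rfl fun u hu => ?_
      rw [h6 u (Finset.mem_range.1 hu)]
      split_ifs <;> ring
    have hsum : ∑ x ∈ Finset.range c.q, A x = Φ :=
      Finset.sum_fiberwise_of_maps_to (fun u hu =>
        Finset.mem_range.2 (hT.col u (Finset.mem_range.1 hu))) _
    have hav := card_available c (load := fun x => s.arr 5 (c.adr a x)) hv.le (by
      rw [Finset.sum_congr rfl fun x hx => hT.cnt x (Finset.mem_range.1 hx),
        ← Finset.card_eq_sum_card_fiberwise (fun u hu => by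
          have := hT.col u (Finset.mem_range.1 hu)
          simpa using this), Finset.card_range])
    have hlight : 32 * c.f * A b ≤ Φ := by
      refine (Nat.mul_le_mul_right _ hav).trans ?_
      rw [← smul_eq_mul, ← hsum]
      refine (Finset.card_nsmul_le_sum _ A _ fun x hx => ?_).trans
        (Finset.sum_le_sum_of_subset (Finset.filter_subset _ _))
      obtain ⟨hx, hx'⟩ := Finset.mem_filter.1 hx
      exact hmin x (Finset.mem_range.1 hx) hx'
    rw [hnew]
    calc (Φ + A b) * (32 * c.f) ^ (a + 1)
        = (Φ * (32 * c.f) + 32 * c.f * A b) * (32 * c.f) ^ a := by ring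
      _ ≤ (Φ * (32 * c.f) + Φ) * (32 * c.f) ^ a := by gcongr
      _ = Φ * (32 * c.f) ^ a * (32 * c.f + 1) := by ring
      _ ≤ v * (32 * c.f + 1) ^ a * (32 * c.f + 1) := Nat.mul_le_mul_right _ h.pot
      _ = _ := by ring
  · rw [h7 v' a' x (by omega) (by omega) (by omega)]
    exact h.acc v' hv' a' ha' x hx (by omega)
  · rw [h6' v' u (by omega) (by omega)]
    exact h.fresh v' hv' u hu hlt
  · have hf : ((Finset.range c.N).filter fun a' =>
          s'.arr 3 (c.adr u' a') = s'.arr 3 (c.adr u a')) =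
        (Finset.range c.N).filter fun a' => s.arr 3 (c.adr u' a') = s.arr 3 (c.adr u a') := by
      refine Finset.filter_congr fun a' ha' => ?_
      have := Finset.mem_range.1 ha'
      rw [c3 _ _ (by omega), c3 _ _ (by omega), if_neg (by omega), if_neg (by omega)]
    rw [hf]
    exact h.agree u hu u' hu'

theorem codeStep_spec {s : State} {τ v a : ℕ} (hr : c.Regs s) (hv : s.reg 11 = v)
    (ha : s.reg 12 = a) (hvn : v < c.n) (haN : a < c.N) (h : CodeInv c s v a) :
    WP μ codeStep (fun s' τ' => CodeInv c s' v (a + 1) ∧ τ' ≤ τ + 120 * v + 60 * c.q + 300)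
      s τ := by
  have hnX := c.n_lt
  have hNX := c.N_lt
  have hqX := c.two_q_lt
  have hcX := c.cap_lt
  have hX := c.sq_X_le
  have hT := h.todo a haN le_rfl
  have hΦ := potential_lt c hvn.le haN.le h.pot
  refine WP.seq (WP.mono (accLoop_spec hr hv ha hvn haN hT.col hΦ
    fun x hx => h.acc v hvn a haN x hx (.inr ⟨rfl, le_rfl⟩)) ?_)
  rintro s₁ τ₁ fr₁ ⟨hacc, hacc', ht₁⟩
  have hr₁ : c.Regs s₁ := hr.frame fr₁ (by decide)
  refine WP.seqSetReg (.reg hr₁.r10) (WP.seqSetReg (.lit (by omega)) ?_)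
  refine WP.seq (WP.mono (argminLoop_spec (v := v) (a := a) ((hr₁.setR _ (by norm_num)).setR _ (by norm_num))
    (by simpa using (fr₁.reg 11 (by decide)).trans hv)
    (by simpa using (fr₁.reg 12 (by decide)).trans ha) hvn haN (by simp)) ?_)
  rintro s₂ τ₂ fr₂ ⟨hmin, hbest, ht₂⟩
  have hr₂ : c.Regs s₂ := ((hr₁.setR _ (by norm_num)).setR _ (by norm_num)).frame fr₂ (by decide)
  have e3 : s₂.arr 3 = s.arr 3 := (fr₂.arr 3 (by decide)).trans (fr₁.arr 3 (by decide))
  have e4 : s₂.arr 4 = s.arr 4 := (fr₂.arr 4 (by decide)).trans (fr₁.arr 4 (by decide))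
  have e5 : s₂.arr 5 = s.arr 5 := (fr₂.arr 5 (by decide)).trans (fr₁.arr 5 (by decide))
  have e6 : s₂.arr 6 = s.arr 6 := (fr₂.arr 6 (by decide)).trans (fr₁.arr 6 (by decide))
  have e7 : s₂.arr 7 = s₁.arr 7 := fr₂.arr 7 (by decide)
  have hv₂ : s₂.reg 11 = v := by
    rw [fr₂.reg 11 (by decide)]; simpa using (fr₁.reg 11 (by decide)).trans hv
  have ha₂ : s₂.reg 12 = a := by
    rw [fr₂.reg 12 (by decide)]; simpa using (fr₁.reg 12 (by decide)).trans ha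
  simp only [State.setR_arr, fr₁.arr 5 (by decide)] at hmin hbest
  obtain ⟨b, hbv⟩ : ∃ b, s₂.reg 16 = b := ⟨_, rfl⟩
  rw [hbv] at hbest
  have hle : ∀ x < c.q, s₁.arr 7 (c.adr (c.adr v a) x) < c.X := fun x hx => by
    rw [hacc x hx]
    exact (Finset.sum_le_sum_of_subset (Finset.filter_subset _ _)).trans_lt hΦ
  have hav := card_available c (load := fun x => s.arr 5 (c.adr a x)) hvn.le (by
      rw [Finset.sum_congr rfl fun x hx => hT.cnt x (Finset.mem_range.1 hx),
        ← Finset.card_eq_sum_card_fiberwise (fun u hu => by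
          have := hT.col u (Finset.mem_range.1 hu)
          simpa using this), Finset.card_range])
  obtain ⟨hb, hbl, hb7⟩ : b < c.q ∧ s.arr 5 (c.adr a b) < c.cap ∧
      s₁.arr 7 (c.adr (c.adr v a) b) = s₂.reg 15 := by
    rcases hbest with hX' | hbest
    · exfalso
      obtain ⟨x, hx⟩ := Finset.card_pos.1 (show 0 < _ from lt_of_lt_of_le
        (by have := c.hf; omega) hav)
      obtain ⟨hx, hx'⟩ := Finset.mem_filter.1 hx
      have h1 := hmin x (Finset.mem_range.1 hx) hx'
      have h2 := hle x (Finset.mem_range.1 hx)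
      omega
    · exact hbest
  have hvX : c.adr v a < 2 ^ μ.W := c.fit2 (by omega) (by omega)
  have habX : c.adr a b < 2 ^ μ.W := c.fit2 (by omega) (by omega)
  have hab2 : c.adr a b < c.X ^ 2 := c.adr_lt (by omega) (by omega)
  refine WP.seqSetArr (.adr hr₂ (.reg hv₂) (.reg ha₂) hvX) (.reg hbv) ?_
  refine WP.seqSetArr (j := c.adr (c.adr a b) (s.arr 5 (c.adr a b))) (.adr (hr₂.setA _ _ _)
    (.adr (hr₂.setA _ _ _) (.reg ha₂) (.reg hbv) habX)
    (.get (.adr (hr₂.setA _ _ _) (.reg ha₂) (.reg hbv) habX) (by simp [e5]))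
    (c.fit3 hab2 (by omega))) (.reg hv₂) ?_
  refine WP.seqSetArr (.adr ((hr₂.setA _ _ _).setA _ _ _) (.reg ha₂) (.reg hbv) habX)
    (.add (.get (.adr ((hr₂.setA _ _ _).setA _ _ _) (.reg ha₂) (.reg hbv) habX)
      (v := s.arr 5 (c.adr a b)) (by simp [e5]))
      (.lit (by omega)) (by omega)) ?_
  refine WP.mono (doubleLoop_spec (v := v) (a := a) (((hr₂.setA _ _ _).setA _ _ _).setA _ _ _) hv₂ ha₂
    hvn haN (fun u hu => ?_)) ?_
  · have hwt : s.arr 6 (c.adr v u) + 1 ≤ ∑ u ∈ Finset.range v, (s.arr 6 (c.adr v u) + 1) :=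
      Finset.single_le_sum (f := fun u => s.arr 6 (c.adr v u) + 1) (fun _ _ => Nat.zero_le _)
        (Finset.mem_range.2 hu)
    simp only [State.setA_arr, Nat.reduceEqDiff, if_false, e6]
    omega
  rintro s₃ τ₃ fr₃ ⟨h6, h6', ht₃⟩
  simp only [State.setA_arr, State.setA_reg, Nat.reduceEqDiff, if_false, if_true, e3, e6, hbv]
    at h6 h6'
  refine ⟨h.step hvn haN hb hbl (fun x hx hxl => ?_) ?_ ?_ ?_ (fun u hu => ?_) h6' ?_, ?_⟩
  · rw [← hacc b hb, ← hacc x hx, hb7]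
    exact hmin x hx hxl
  · rw [fr₃.arr 3 (by decide)]; simp [e3]
  · rw [fr₃.arr 4 (by decide)]; simp [e4]
  · rw [fr₃.arr 5 (by decide)]; simp [e5]
  · have hu3 : Function.update (s.arr 3) (c.adr v a) b (c.adr u a) = s.arr 3 (c.adr u a) := by
      rw [c.upd2 (by omega) (by omega), if_neg (by omega)]
    rw [h6 u hu, hu3]
  · intro v' a' x h1 h2 h3
    rw [fr₃.arr 7 (by decide)]
    simp only [State.setA_arr, Nat.reduceEqDiff, if_false, e7]
    exact hacc' v' a' x h1 h2 h3
  · simp only [Expr.cost, Expr.adr_cost] at ht₃ ht₂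
    omega

variable (c) in
/-- The result of the colouring phase. -/
structure CodeDone (s : State) : Prop where
  cls : ∀ a < c.N, ClassInv c s a c.n
  agree : ∀ u < c.n, ∀ u' < u, ((Finset.range c.N).filter fun a =>
    s.arr 3 (c.adr u' a) = s.arr 3 (c.adr u a)).card ≤ 3 * c.L

theorem ClassInv.of_arr {s s' : State} {a v : ℕ} (h : ClassInv c s a v) (hA : s'.arr = s.arr) :
    ClassInv c s' a v :=
  h.congr (fun _ _ => by rw [hA]) (fun _ _ _ _ => by rw [hA]) (fun _ _ => by rw [hA])

theorem CodeInv.of_arr {s s' : State} {v a : ℕ} (h : CodeInv c s v a) (hA : s'.arr = s.arr) :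
    CodeInv c s' v a where
  done a' ha' := (h.done a' ha').of_arr hA
  todo a' ha' h' := (h.todo a' ha' h').of_arr hA
  wt := by rw [hA]; exact h.wt
  pot := by rw [hA]; exact h.pot
  acc := by rw [hA]; exact h.acc
  fresh := by rw [hA]; exact h.fresh
  agree := by rw [hA]; exact h.agree

theorem codeInv_zero {s : State} (hz : ∀ i, s.arr 5 i = 0 ∧ s.arr 6 i = 0 ∧ s.arr 7 i = 0) :
    CodeInv c s 0 0 where
  done _ h := by omega
  todo a _ _ := ⟨fun x _ => by simp [hz], fun x _ => by simp [hz], fun x _ r hr => by simp [hz] at hr,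
    fun _ h => by omega, fun _ h => by omega⟩
  wt _ h := by omega
  pot := by simp
  acc _ _ _ _ _ _ _ := (hz _).2.2
  fresh _ _ _ _ _ := (hz _).2.1
  agree _ h := by omega

theorem CodeInv.agree_last {s : State} {v : ℕ} (h : CodeInv c s v c.N) (hv : v < c.n) :
    ∀ u < v + 1, ∀ u' < u, ((Finset.range c.N).filter fun a' =>
      s.arr 3 (c.adr u' a') = s.arr 3 (c.adr u a')).card ≤ 3 * c.L := by
  intro u hu u' hu'
  rcases Nat.lt_succ_iff_lt_or_eq.1 hu with hu | rfl
  · exact h.agree u hu u' hu'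
  · refine agree_le c ?_
    rw [← h.wt u' hu']
    exact (Finset.single_le_sum (f := fun u' => s.arr 6 (c.adr u u') + 1)
      (fun _ _ => Nat.zero_le _) (Finset.mem_range.2 hu')).trans
      (potential_le c hv.le le_rfl h.pot)

theorem CodeInv.next {s : State} {v : ℕ} (h : CodeInv c s v c.N) (hv : v + 1 < c.n) :
    CodeInv c s (v + 1) 0 where
  done _ h := by omega
  todo a ha _ := h.done a ha
  wt u hu := by rw [h.fresh _ hv u (by omega) (by omega)]; simp
  pot := by
    rw [Finset.sum_congr rfl fun u hu => by
      rw [h.fresh _ hv u (by have := Finset.mem_range.1 hu; omega) (by omega)]]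
    simp
  acc v' hv' a' ha' x hx hlt := h.acc v' hv' a' ha' x hx (by omega)
  fresh v' hv' u hu hlt := h.fresh v' hv' u hu (by omega)
  agree := h.agree_last (by omega)

theorem buildCode_spec {s : State} {τ : ℕ} (hr : c.Regs s)
    (hz : ∀ i, s.arr 5 i = 0 ∧ s.arr 6 i = 0 ∧ s.arr 7 i = 0) :
    WP μ buildCode (fun s' τ' => CodeDone c s' ∧
      τ' ≤ τ + c.n * (c.N * (120 * c.n + 60 * c.q + 320) + 20) + 20) s τ := by
  have hnX := c.n_lt
  have hNX := c.N_lt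
  have hX := c.sq_X_le
  have hn := c.hn
  obtain ⟨K, hK⟩ : ∃ K, K = 120 * c.n + 60 * c.q + 320 := ⟨_, rfl⟩
  obtain ⟨K', hK'⟩ : ∃ K', K' = c.N * K + 20 := ⟨_, rfl⟩
  refine WP.forLt c.n (fun v s' τ' => (v < c.n → CodeInv c s' v 0) ∧
    (v = c.n → CodeDone c s') ∧ τ' ≤ τ + v * K' + 2) c.one_lt (by omega) ?_ ?_ ?_ ?_
  · refine ⟨fun _ => codeInv_zero hz, fun h => by omega, by simp⟩
  · intro j s' τ' hfr _ _ _
    exact .reg (hr.frame hfr (by decide)).r0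
  · rintro v s₁ τ₁ hfr₁ hv hvn ⟨h1, -, ht₁⟩
    have hr₁ : c.Regs s₁ := hr.frame hfr₁ (by decide)
    refine WP.mono (WP.forLt c.N (fun a s' τ' => CodeInv c s' v a ∧
      τ' ≤ τ₁ + 4 + a * K + 2) c.one_lt (by omega) ?_ ?_ ?_
      (Q := fun s' τ' => CodeInv c s' v c.N ∧ τ' ≤ τ₁ + 4 + c.N * K + 2 + 4) ?_) ?_
    · refine ⟨?_, by simp [Expr.cost]⟩
      exact (h1 hvn).of_arr rfl
    · intro j s' τ' hfr _ _ _
      exact .reg (hr₁.frame hfr (by decide)).r8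
    · rintro a s' τ' hfr ha haN ⟨h, ht⟩
      have hr' : c.Regs s' := hr₁.frame hfr (by decide)
      refine WP.mono (codeStep_spec hr' ((hfr.reg 11 (by decide)).trans hv) ha hvn haN h) ?_
      rintro s₂ τ₂ hfr₂ ⟨h', ht'⟩
      refine ⟨(hfr₂.reg 12 (by decide)).trans ha,
        h'.of_arr rfl, ?_⟩
      simp only [Expr.cost] at ht'
      rw [add_mul]
      omega
    · rintro s' τ' hfr _ ⟨h, ht⟩
      refine ⟨h, ?_⟩
      simp only [Expr.cost]
      omega
    · rintro s₂ τ₂ hfr₂ ⟨h, ht⟩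
      refine ⟨(hfr₂.reg 11 (by decide)).trans hv, fun hv' => ?_, fun hv' => ?_, ?_⟩
      · exact (h.next hv').of_arr rfl
      · refine ⟨fun a ha => ?_, ?_⟩
        · have := h.done a ha
          rw [hv'] at this
          exact this.of_arr rfl
        · have := h.agree_last hvn
          rw [hv'] at this
          exact this
      · rw [add_mul]
        omega
  · rintro s' τ' hfr _ ⟨-, h, ht⟩
    refine ⟨h rfl, ?_⟩
    simp only [Expr.cost]
    rw [← hK, ← hK']
    omega

end Code

/-! ## A tournament tree for extracting edges in order of weight -/

/-- The winner of a match; `0` stands for no player and `i + 1` for player `i`. -/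
noncomputable def better (wt : ℕ → ℝ≥0) (x y : ℕ) : ℕ :=
  if x = 0 then y else if y = 0 then x else if wt (x - 1) ≤ wt (y - 1) then x else y

/-- Leaf `m + i` holds player `i` or nobody. -/
def TreeLeaf (m : ℕ) (T : ℕ → ℕ) : Prop := ∀ i < m, T (m + i) = i + 1 ∨ T (m + i) = 0

/-- Node `v` holds the winner of its children. -/
def TreeNode (wt : ℕ → ℝ≥0) (T : ℕ → ℕ) (v : ℕ) : Prop :=
  T v = better wt (T (2 * v)) (T (2 * v + 1))

theorem better_child (wt : ℕ → ℝ≥0) {x y z : ℕ} (hz : z = x ∨ z = y) (h0 : z ≠ 0) :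
    better wt x y ≠ 0 ∧ wt (better wt x y - 1) ≤ wt (z - 1) := by
  unfold better
  rcases hz with rfl | rfl
  · rw [if_neg h0]
    split_ifs with h1 h2
    · exact ⟨h0, le_rfl⟩
    · exact ⟨h0, le_rfl⟩
    · exact ⟨h1, (not_le.1 h2).le⟩
  · split_ifs with h1 h2
    · exact ⟨h0, le_rfl⟩
    · exact ⟨h1, h2⟩
    · exact ⟨h0, le_rfl⟩

theorem tree_root_le {wt : ℕ → ℝ≥0} {m : ℕ} {T : ℕ → ℕ}
    (hn : ∀ v, 1 ≤ v → v < m → TreeNode wt T v) (v : ℕ) (hv : 1 ≤ v) (hvm : v < 2 * m)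
    (h0 : T v ≠ 0) : T 1 ≠ 0 ∧ wt (T 1 - 1) ≤ wt (T v - 1) := by
  induction v using Nat.strong_induction_on with
  | _ v ih =>
    by_cases h1 : v = 1
    · subst h1; exact ⟨h0, le_rfl⟩
    · have hp := hn (v / 2) (by omega) (by omega)
      have hz : T v = T (2 * (v / 2)) ∨ T v = T (2 * (v / 2) + 1) := by
        rcases Nat.mod_two_eq_zero_or_one v with h | h
        · left; congr 1; omega
        · right; congr 1; omega
      obtain ⟨h2, h3⟩ := better_child wt hz h0
      rw [← hp] at h2 h3
      obtain ⟨h4, h5⟩ := ih (v / 2) (by omega) (by omega) (by omega) h2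
      exact ⟨h4, h5.trans h3⟩

theorem tree_active {wt : ℕ → ℝ≥0} {m : ℕ} {T : ℕ → ℕ} (hl : TreeLeaf m T)
    (hn : ∀ v, 1 ≤ v → v < m → TreeNode wt T v) : ∀ d v, v + d = 2 * m → 1 ≤ v → 1 ≤ d →
    T v ≠ 0 → ∃ i < m, T v = i + 1 ∧ T (m + i) = i + 1 := by
  intro d
  induction d using Nat.strong_induction_on with
  | _ d ih =>
    intro v hvd hv hd h0
    by_cases hvm : m ≤ v
    · obtain ⟨i, rfl⟩ := Nat.exists_eq_add_of_le hvm
      rcases hl i (by omega) with h | h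
      · exact ⟨i, by omega, h, h⟩
      · exact absurd h h0
    · have hp := hn v hv (by omega)
      have hch : T v = T (2 * v) ∨ T v = T (2 * v + 1) := by
        rw [hp]; unfold better
        split_ifs <;> simp
      rcases hch with h | h
      · rw [h] at h0 ⊢
        exact ih (2 * m - 2 * v) (by omega) (2 * v) (by omega) (by omega) (by omega) h0
      · rw [h] at h0 ⊢
        exact ih (2 * m - (2 * v + 1)) (by omega) (2 * v + 1) (by omega) (by omega) (by omega) h0

open FTSpanner.Expr in
/-- Recomputes the winner at node `v`. -/
def treeUpd : Cmd :=
  .seq (.setReg 18 (get 8 (bin .mul (lit 2) (reg 17)))) <|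
  .seq (.setReg 19 (get 8 (bin .add (bin .mul (lit 2) (reg 17)) (lit 1)))) <|
  .ite (bin .eq (reg 18) (lit 0)) (.setArr 8 (reg 17) (reg 19)) <|
  .ite (bin .eq (reg 19) (lit 0)) (.setArr 8 (reg 17) (reg 18)) <|
  .ite (weightLe (bin .sub (reg 18) (lit 1)) (bin .sub (reg 19) (lit 1)))
    (.setArr 8 (reg 17) (reg 18)) (.setArr 8 (reg 17) (reg 19))

open FTSpanner.Expr in
/-- Builds the tree with all players present. -/
def buildTree : Cmd :=
  .seq (.forLt 17 (reg 1) (.setArr 8 (bin .add (reg 1) (reg 17)) (bin .add (reg 17) (lit 1)))) <|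
  .seq (.setReg 17 (bin .sub (reg 1) (lit 1))) <|
  .loop (reg 17) (.seq treeUpd (.setReg 17 (bin .sub (reg 17) (lit 1))))

open FTSpanner.Expr in
/-- Removes the player in register `20`. -/
def treePop : Cmd :=
  .seq (.setArr 8 (bin .add (reg 1) (reg 20)) (lit 0)) <|
  .seq (.setReg 17 (bin .div (bin .add (reg 1) (reg 20)) (lit 2))) <|
  .loop (reg 17) (.seq treeUpd (.setReg 17 (bin .div (reg 17) (lit 2))))

section Tree

variable {μ : Machine} {c : Cfg μ}

theorem treeUpd_spec (c : Cfg μ) {s : State} {τ v : ℕ} (hv : s.reg 17 = v) (hvm : v < c.m)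
    (h1 : s.arr 8 (2 * v) < c.X) (h2 : s.arr 8 (2 * v + 1) < c.X) :
    WP μ treeUpd (fun s' τ' => s'.arr 8 = Function.update (s.arr 8) v
      (better μ.wt (s.arr 8 (2 * v)) (s.arr 8 (2 * v + 1))) ∧ τ' ≤ τ + 40) s τ := by
  have hX := c.sq_X_le
  have hm := c.m_lt
  refine WP.seqSetReg (.get (.mul (.lit (by omega)) (.reg hv) (by omega)) rfl) ?_
  refine WP.seqSetReg (.get (.add (.mul (.lit (by omega)) (.reg (by simpa using hv)) (by omega))
    (.lit (by omega)) (by omega)) (v := s.arr 8 (2 * v + 1)) rfl) ?_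
  refine WP.iteEq (.reg (x := 18) (v := s.arr 8 (2 * v)) (by simp)) (.lit (by omega)) c.one_lt
    (fun h0 => ?_) (fun h0 => ?_)
  · refine WP.setArr (.reg (by simpa using hv)) (.reg (by simp; rfl)) ⟨?_, ?_⟩
    · simp [better, h0]
    · simp only [Expr.cost]; omega
  · refine WP.iteEq (.reg (x := 19) (v := s.arr 8 (2 * v + 1)) (by simp)) (.lit (by omega)) c.one_lt
      (fun h0' => ?_) (fun h0' => ?_)
    · refine WP.setArr (.reg (by simpa using hv)) (.reg (by simp; rfl)) ⟨?_, ?_⟩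
      · simp [better, h0, h0']
      · simp only [Expr.cost]; omega
    · refine WP.ite (.weightLe (a := s.arr 8 (2 * v) - 1) (b := s.arr 8 (2 * v + 1) - 1)
        (.sub (.reg (by simp)) (.lit (by omega)) (by omega))
        (.sub (.reg (by simp)) (.lit (by omega)) (by omega)))
        (fun h => ?_) (fun h => ?_)
      · refine WP.setArr (.reg (by simpa using hv)) (.reg (by simp; rfl)) ⟨?_, ?_⟩
        · simp only [better, if_neg h0, if_neg h0']
          rw [if_pos (by by_contra hc; simp [hc] at h)]
          simp
        · simp only [Expr.cost]; omega
      · refine WP.setArr (.reg (by simpa using hv)) (.reg (by simp; rfl)) ⟨?_, ?_⟩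
        · simp only [better, if_neg h0, if_neg h0']
          rw [if_neg (by intro hc; simp [hc] at h)]
          simp
        · simp only [Expr.cost]; omega

theorem better_lt {wt : ℕ → ℝ≥0} {x y B : ℕ} (hx : x < B) (hy : y < B) : better wt x y < B := by
  unfold better; split_ifs <;> assumption

variable (c) in
/-- The tournament tree is consistent. -/
structure TreeInv (s : State) : Prop where
  leaf : TreeLeaf c.m (s.arr 8)
  node : ∀ v, 1 ≤ v → v < c.m → TreeNode μ.wt (s.arr 8) v
  bound : ∀ v < 2 * c.m, s.arr 8 v < c.X

theorem TreeNode.update_of_ne {wt : ℕ → ℝ≥0} {T : ℕ → ℕ} {v r x : ℕ} (h : TreeNode wt T v)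
    (h1 : v ≠ r) (h2 : v ≠ r / 2) : TreeNode wt (Function.update T r x) v := by
  unfold TreeNode at *
  rw [Function.update_of_ne h1, Function.update_of_ne (by omega), Function.update_of_ne (by omega),
    h]

theorem treeNode_update_self {wt : ℕ → ℝ≥0} {T : ℕ → ℕ} {r : ℕ} (hr : 1 ≤ r) :
    TreeNode wt (Function.update T r (better wt (T (2 * r)) (T (2 * r + 1)))) r := by
  unfold TreeNode
  rw [Function.update_self, Function.update_of_ne (by omega), Function.update_of_ne (by omega)]

theorem buildTree_spec {s : State} {τ : ℕ} (hr : c.Regs s) (hz : ∀ i, s.arr 8 i = 0) :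
    WP μ buildTree (fun s' τ' => TreeInv c s' ∧ (∀ i < c.m, s'.arr 8 (c.m + i) = i + 1) ∧
      τ' ≤ τ + 100 * c.m + 40) s τ := by
  have hX := c.sq_X_le
  have hm := c.m_lt
  refine WP.seq (WP.forLt c.m (fun j s' τ' => (∀ i < j, s'.arr 8 (c.m + i) = i + 1) ∧
    (∀ v < 2 * c.m, s'.arr 8 v < c.X) ∧ τ' ≤ τ + 30 * j + 2) c.one_lt (by omega) ?_ ?_ ?_ ?_)
  · exact ⟨by simp, fun v _ => by simp only [State.setR_arr, hz]; omega, by simp⟩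
  · intro j s' τ' hfr _ _ _
    exact .reg (hr.frame hfr (by decide)).r1
  · rintro j s' τ' hfr hj hjm ⟨h1, h2, ht⟩
    have hr' : c.Regs s' := hr.frame hfr (by decide)
    refine WP.setArr (.add (.reg hr'.r1) (.reg hj) (by omega)) (.add (.reg hj) (.lit (by omega))
      (by omega)) ⟨hj, fun i hi => ?_, fun v hv => ?_, ?_⟩
    · simp only [State.setR_arr, State.setA_arr, if_true, Function.update_apply]
      split_ifs
      · omega
      · exact h1 i (by omega)
    · simp only [State.setR_arr, State.setA_arr, if_true, Function.update_apply]
      split_ifs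
      · omega
      · exact h2 v hv
    · simp only [Expr.cost]; omega
  · rintro s₁ τ₁ hfr₁ - ⟨h1, h2, ht₁⟩
    have hr₁ : c.Regs s₁ := hr.frame hfr₁ (by decide)
    refine WP.seqSetReg (.sub (.reg hr₁.r1) (.lit (by omega)) (by omega)) ?_
    refine WP.loop (fun s' τ' => s'.reg 17 ≤ c.m - 1 ∧ TreeLeaf c.m (s'.arr 8) ∧
      (∀ i < c.m, s'.arr 8 (c.m + i) = i + 1) ∧
      (∀ v, s'.reg 17 < v → v < c.m → TreeNode μ.wt (s'.arr 8) v) ∧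
      (∀ v < 2 * c.m, s'.arr 8 v < c.X) ∧ τ' + 60 * s'.reg 17 ≤ τ + 90 * c.m + 30)
      (τ + 90 * c.m + 30) ?_ ?_ ?_ ?_ ?_
    · refine ⟨by simp, fun i hi => .inl (h1 i hi), h1, fun v hv hv' => ?_, h2, ?_⟩
      · simp at hv; omega
      · simp only [Expr.cost, State.setR_reg, if_true] at ht₁ ⊢; omega
    · rintro s' τ' ⟨-, -, -, -, -, ht⟩; omega
    · intros; trivial
    · rintro s' τ' hfr ⟨hle, hl, hl', hn, hb, ht⟩ hne
      have hne : s'.reg 17 ≠ 0 := hne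
      obtain ⟨r, hrr⟩ : ∃ r, s'.reg 17 = r := ⟨_, rfl⟩
      rw [hrr] at hle hn ht hne
      refine WP.seq (WP.mono (treeUpd_spec c hrr (by omega) (hb _ (by omega)) (hb _ (by omega))) ?_)
      rintro s₂ τ₂ hfr₂ ⟨h8, ht₂⟩
      have hr₂ : s₂.reg 17 = r := (hfr₂.reg 17 (by decide)).trans hrr
      refine WP.setReg (.sub (.reg hr₂) (.lit (by omega)) (by omega)) ⟨?_, ?_, ?_, ?_, ?_, ?_⟩
      · simp; omega
      · intro i hi
        simp only [State.setR_arr, h8]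
        rw [Function.update_of_ne (by omega)]
        exact hl i hi
      · intro i hi
        simp only [State.setR_arr, h8]
        rw [Function.update_of_ne (by omega)]
        exact hl' i hi
      · intro v hv hvm
        simp only [State.setR_arr, State.setR_reg, if_true, h8] at hv ⊢
        by_cases hvr : v = r
        · subst hvr
          exact treeNode_update_self (by omega)
        · exact (hn v (by omega) hvm).update_of_ne hvr (by omega)
      · intro v hv
        simp only [State.setR_arr, h8, Function.update_apply]
        split_ifs
        · exact better_lt (hb _ (by omega)) (hb _ (by omega))
        · exact hb v hv
      · simp only [Expr.cost, State.setR_reg, if_true] at ht₂ ⊢; omega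
    · rintro s' τ' hfr ⟨hle, hl, hl', hn, hb, ht⟩ he
      have he : s'.reg 17 = 0 := he
      rw [he] at hn
      exact ⟨⟨hl, fun v hv => hn v (by omega), hb⟩, hl', by simp only [Expr.cost]; omega⟩

theorem treePop_spec {s : State} {τ e : ℕ} (hr : c.Regs s) (he : s.reg 20 = e) (hem : e < c.m)
    (h : TreeInv c s) :
    WP μ treePop (fun s' τ' => TreeInv c s' ∧
      (∀ i < c.m, s'.arr 8 (c.m + i) = if i = e then 0 else s.arr 8 (c.m + i)) ∧
      τ' ≤ τ + 120 * c.L + 40) s τ := by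
  have hX := c.sq_X_le
  have hm := c.m_lt
  refine WP.seqSetArr (.add (.reg hr.r1) (.reg he) (by omega)) (.lit (by omega)) ?_
  refine WP.seqSetReg (.div (.add (.reg hr.r1) (.reg he) (by omega)) (.lit (by omega))
    (by omega)) ?_
  refine WP.loop (fun s' τ' => s'.reg 17 < c.m ∧ TreeLeaf c.m (s'.arr 8) ∧
      (∀ i < c.m, s'.arr 8 (c.m + i) = if i = e then 0 else s.arr 8 (c.m + i)) ∧
      (∀ v, 1 ≤ v → v ≠ s'.reg 17 → v < c.m → TreeNode μ.wt (s'.arr 8) v) ∧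
      (∀ v < 2 * c.m, s'.arr 8 v < c.X) ∧
      ∃ d, s'.reg 17 < 2 ^ d ∧ τ' + 60 * d ≤ τ + 120 * c.L + 20)
      (τ + 120 * c.L + 30) ?_ ?_ ?_ ?_ ?_
  · refine ⟨?_, ?_, ?_, ?_, ?_, 2 * c.L, ?_, ?_⟩
    · simp; omega
    · intro i hi
      simp only [State.setR_arr, State.setA_arr, if_true, Function.update_apply]
      split_ifs
      · exact .inr rfl
      · exact h.leaf i hi
    · intro i hi
      simp only [State.setR_arr, State.setA_arr, if_true, Function.update_apply, Nat.add_left_cancel_iff]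
    · intro v hv hne hvm
      simp only [State.setR_arr, State.setA_arr, if_true, State.setR_reg] at hne ⊢
      exact (h.node v hv hvm).update_of_ne (by omega) hne
    · intro v hv
      simp only [State.setR_arr, State.setA_arr, if_true, Function.update_apply]
      split_ifs
      · omega
      · exact h.bound v hv
    · simp only [State.setR_reg, if_true]
      have h1 : c.n ^ 2 ≤ 2 ^ (2 * c.L) := by
        rw [mul_comm 2, pow_mul]; exact Nat.pow_le_pow_left c.hL 2
      have := c.hm
      omega
    · simp only [Expr.cost]; omega
  · rintro s' τ' ⟨-, -, -, -, -, d, -, ht⟩; omega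
  · intros; trivial
  · rintro s' τ' hfr ⟨hlt, hl, hl', hn, hb, d, hd, ht⟩ hne
    have hne : s'.reg 17 ≠ 0 := hne
    obtain ⟨r, hrr⟩ : ∃ r, s'.reg 17 = r := ⟨_, rfl⟩
    rw [hrr] at hlt hn hd hne
    refine WP.seq (WP.mono (treeUpd_spec c hrr (by omega) (hb _ (by omega)) (hb _ (by omega))) ?_)
    rintro s₂ τ₂ hfr₂ ⟨h8, ht₂⟩
    have hr₂ : s₂.reg 17 = r := (hfr₂.reg 17 (by decide)).trans hrr
    refine WP.setReg (.div (.reg hr₂) (.lit (by omega)) (by omega)) ⟨?_, ?_, ?_, ?_, ?_, ?_⟩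
    · simp; omega
    · intro i hi
      simp only [State.setR_arr, h8]
      rw [Function.update_of_ne (by omega)]
      exact hl i hi
    · intro i hi
      simp only [State.setR_arr, h8]
      rw [Function.update_of_ne (by omega)]
      exact hl' i hi
    · intro v hv hne' hvm
      simp only [State.setR_arr, State.setR_reg, if_true, h8] at hne' ⊢
      by_cases hvr : v = r
      · subst hvr
        exact treeNode_update_self (by omega)
      · exact (hn v hv hvr hvm).update_of_ne hvr hne'
    · intro v hv
      simp only [State.setR_arr, h8, Function.update_apply]
      split_ifs
      · exact better_lt (hb _ (by omega)) (hb _ (by omega))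
      · exact hb v hv
    · rcases d with _ | d
      · simp at hd; omega
      · refine ⟨d, ?_, ?_⟩
        · simp only [State.setR_reg, if_true]
          rw [pow_succ] at hd; omega
        · simp only [Expr.cost] at ht₂ ⊢; omega
  · rintro s' τ' hfr ⟨hlt, hl, hl', hn, hb, d, hd, ht⟩ he'
    have he' : s'.reg 17 = 0 := he'
    rw [he'] at hn
    exact ⟨⟨hl, fun v hv => hn v hv (by omega), hb⟩, hl', by simp only [Expr.cost]; omega⟩

end Tree

/-! ## Incremental distance tables -/

open FTSpanner.Expr in
/-- Raises the table entry of vertex `33` in the row of source `28` to the value in register `31`,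
and pushes the vertex if this is an improvement. -/
def improve : Cmd :=
  .ite (bin .lt (get 11 (adr (adr (reg 25) (reg 28)) (reg 33))) (reg 31))
    (.seq (.setArr 11 (adr (adr (reg 25) (reg 28)) (reg 33)) (reg 31)) <|
      .seq (.setArr 12 (reg 29) (reg 33)) <|
      .setReg 29 (bin .add (reg 29) (lit 1)))
    .skip

open FTSpanner.Expr in
/-- Relaxes the edges at vertex `30`. -/
def relaxNeighbors : Cmd :=
  .forLt 32 (get 9 (adr (reg 25) (reg 30)))
    (.seq (.setReg 33 (get 10 (adr (adr (reg 25) (reg 30)) (reg 32)))) improve)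

open FTSpanner.Expr in
/-- Relaxes the edges at the topmost vertex of the stack. -/
def relaxTop : Cmd :=
  .seq (.setReg 29 (bin .sub (reg 29) (lit 1))) <|
  .seq (.setReg 30 (get 12 (reg 29))) <|
  .seq (.setReg 31 (bin .sub (get 11 (adr (adr (reg 25) (reg 28)) (reg 30))) (lit 1)))
    relaxNeighbors

open FTSpanner.Expr in
/-- Updates the row of source `28` after the insertion of the edge between `21` and `22`. -/
def relaxRow : Cmd :=
  .seq (.setReg 29 (lit 0)) <|
  .seq (.setReg 31 (bin .sub (get 11 (adr (adr (reg 25) (reg 28)) (reg 21))) (lit 1))) <|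
  .seq (.setReg 33 (reg 22)) <|
  .seq improve <|
  .seq (.setReg 31 (bin .sub (get 11 (adr (adr (reg 25) (reg 28)) (reg 22))) (lit 1))) <|
  .seq (.setReg 33 (reg 21)) <|
  .seq improve <|
  .loop (reg 29) relaxTop

/-- The array `f` holds a stack, topmost element first in the list. -/
def StackRep {n : ℕ} (f : ℕ → ℕ) : List (Fin n) → Prop
  | [] => True
  | t :: l => f l.length = t ∧ StackRep f l

theorem StackRep.congr {n : ℕ} {f f' : ℕ → ℕ} {l : List (Fin n)} (h : StackRep f l)
    (hf : ∀ i < l.length, f' i = f i) : StackRep f' l := by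
  induction l with
  | nil => trivial
  | cons t l ih =>
    refine ⟨?_, ih h.2 fun i hi => hf i ?_⟩
    · rw [hf _ (by simp), h.1]
    · simp; omega

/-- Entry `t` of a row with source `src` is at most `K` minus the distance from `src`, or zero. -/
def Sound {n : ℕ} (H : SimpleGraph (Fin n)) (K : ℕ) (src : Fin n) (ρ : Fin n → ℕ) : Prop :=
  ∀ t, ρ t ≠ 0 → ∃ p : H.Walk src t, p.length + ρ t ≤ K

theorem Sound.le {n : ℕ} {H : SimpleGraph (Fin n)} {K : ℕ} {src : Fin n} {ρ : Fin n → ℕ}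
    (h : Sound H K src ρ) (t : Fin n) : ρ t ≤ K := by
  by_cases h0 : ρ t = 0
  · omega
  · obtain ⟨p, hp⟩ := h t h0
    omega

theorem Sound.adj {n : ℕ} {H : SimpleGraph (Fin n)} {K : ℕ} {src : Fin n} {ρ : Fin n → ℕ}
    (h : Sound H K src ρ) {t t' : Fin n} (ht : H.Adj t t') (h0 : ρ t - 1 ≠ 0) :
    ∃ p : H.Walk src t', p.length + (ρ t - 1) ≤ K := by
  obtain ⟨p, hp⟩ := h t (by omega)
  exact ⟨p.concat ht, by rw [SimpleGraph.Walk.length_concat]; omega⟩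

/-- Along an edge the entries of a row drop by at most one, except where `E` allows it. -/
def ClosedBut {n : ℕ} (H : SimpleGraph (Fin n)) (ρ : Fin n → ℕ) (E : Fin n → Fin n → Prop) : Prop :=
  ∀ t t', H.Adj t t' → ρ t ≤ ρ t' + 1 ∨ E t t'

theorem ClosedBut.le_of_walk {n : ℕ} {H : SimpleGraph (Fin n)} {ρ : Fin n → ℕ}
    (h : ClosedBut H ρ fun _ _ => False) {s t : Fin n} (p : H.Walk s t) : ρ s ≤ ρ t + p.length := by
  induction p with
  | nil => simp
  | cons hadj p ih =>
    have := (h _ _ hadj).resolve_right id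
    simp only [SimpleGraph.Walk.length_cons]
    omega

/-- The potential of a row. -/
def rowPot {n : ℕ} (deg ρ : Fin n → ℕ) : ℕ := ∑ t, ρ t * (deg t + 1)

/-- The potential of a stack. -/
def stackPot {n : ℕ} (deg : Fin n → ℕ) (l : List (Fin n)) : ℕ := (l.map fun t => deg t + 1).sum

theorem rowPot_mono {n : ℕ} (deg : Fin n → ℕ) {ρ ρ' : Fin n → ℕ} (h : ∀ t, ρ t ≤ ρ' t) :
    rowPot deg ρ ≤ rowPot deg ρ' :=
  Finset.sum_le_sum fun t _ => Nat.mul_le_mul_right _ (h t)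

theorem rowPot_add_le {n : ℕ} (deg : Fin n → ℕ) {ρ ρ' : Fin n → ℕ} {t₀ : Fin n}
    (h : ∀ t, t ≠ t₀ → ρ' t = ρ t) (h₀ : ρ t₀ < ρ' t₀) :
    rowPot deg ρ + (deg t₀ + 1) ≤ rowPot deg ρ' := by
  unfold rowPot
  rw [← Finset.add_sum_erase _ _ (Finset.mem_univ t₀),
    ← Finset.add_sum_erase (a := t₀) _ (fun t => ρ' t * (deg t + 1)) (Finset.mem_univ t₀),
    Finset.sum_congr rfl fun t ht => by rw [← h t (Finset.ne_of_mem_erase ht)]]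
  have : (ρ t₀ + 1) * (deg t₀ + 1) ≤ ρ' t₀ * (deg t₀ + 1) := Nat.mul_le_mul_right _ h₀
  rw [add_mul, one_mul] at this
  omega

theorem sum_row_lt {n : ℕ} {ρ ρ' : Fin n → ℕ} {t₀ : Fin n}
    (h : ∀ t, t ≠ t₀ → ρ' t = ρ t) (h₀ : ρ t₀ < ρ' t₀) : ∑ t, ρ t + 1 ≤ ∑ t, ρ' t := by
  have := rowPot_add_le (fun _ => 0) h h₀
  simpa [rowPot] using this

section Tables

variable {μ : Machine} {c : Cfg μ}

variable (c) in
/-- The row of source `src` in table `g`. -/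
def row (s : State) (g : ℕ) (src t : Fin c.n) : ℕ := s.arr 11 (c.adr (c.adr g src) t)

variable (c) in
/-- The length of the adjacency list of `t` in graph `g`. -/
def degOf (s : State) (g : ℕ) (t : Fin c.n) : ℕ := s.arr 9 (c.adr g t)

theorem Fin.lt_X (c : Cfg μ) (t : Fin c.n) : (t : ℕ) < c.X := by
  have := c.n_lt; have := t.2; omega

variable (c) in
/-- The situation while the row of `src` is updated, starting from the state `s₀`. -/
structure RowState (H : SimpleGraph (Fin c.n)) (g : ℕ) (src : Fin c.n) (s₀ s : State)
    (stk : List (Fin c.n)) : Prop where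
  sp : s.reg 29 = stk.length
  stack : StackRep (s.arr 12) stk
  sound : Sound H (2 * c.k) src (row c s g src)
  mono : ∀ t, row c s₀ g src t ≤ row c s g src t
  other : ∀ g' x y, x < c.X → y < c.X → (g' ≠ g ∨ x ≠ src) →
    s.arr 11 (c.adr (c.adr g' x) y) = s₀.arr 11 (c.adr (c.adr g' x) y)
  size : stk.length ≤ ∑ t, row c s g src t

theorem sum_row_le {H : SimpleGraph (Fin c.n)} {src : Fin c.n} {ρ : Fin c.n → ℕ}
    (h : Sound H (2 * c.k) src ρ) : ∑ t, ρ t + 1 < c.X := by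
  have h1 : ∑ t, ρ t ≤ c.n * (2 * c.k) := by
    calc ∑ t, ρ t ≤ ∑ _t : Fin c.n, 2 * c.k := Finset.sum_le_sum fun t _ => h.le t
      _ = c.n * (2 * c.k) := by simp
  have h2 : c.n * (2 * c.k) ≤ c.n * (4 * c.n) :=
    Nat.mul_le_mul_left _ (by have := c.L_lt; have := c.hkL; omega)
  have h3 : c.n * (4 * c.n) = 4 * c.n ^ 2 := by ring
  have := c.sq_le_cube
  have := c.hX
  have := c.hn
  have := c.n_le_cube
  omega

theorem improve_spec {H : SimpleGraph (Fin c.n)} {g : ℕ} {src t' : Fin c.n} {s₀ s : State}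
    {stk : List (Fin c.n)} {τ val : ℕ} (deg : Fin c.n → ℕ) (hr : c.Regs s) (hg : g < c.X ^ 2)
    (h25 : s.reg 25 = g)
    (h28 : s.reg 28 = src) (h33 : s.reg 33 = t') (h31 : s.reg 31 = val)
    (h : RowState c H g src s₀ s stk)
    (hval : val ≠ 0 → ∃ p : H.Walk src t', p.length + val ≤ 2 * c.k) :
    WP μ improve (fun s' τ' => ∃ stk', RowState c H g src s₀ s' stk' ∧ (∀ x ∈ stk, x ∈ stk') ∧
      (∀ t, row c s g src t ≤ row c s' g src t) ∧
      (∀ t, row c s g src t < row c s' g src t → t ∈ stk') ∧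
      val ≤ row c s' g src t' ∧
      (∀ t, t ≠ t' → row c s' g src t = row c s g src t) ∧
      stackPot deg stk' + rowPot deg (row c s g src) ≤
        stackPot deg stk + rowPot deg (row c s' g src) ∧
      τ' ≤ τ + 40) s τ := by
  have hX := c.sq_X_le
  have hsrc := Fin.lt_X c src
  have ht' := Fin.lt_X c t'
  have hsum := sum_row_le h.sound
  have hsize := h.size
  have hgs : c.adr g src < c.X ^ 3 := c.adr_lt3 hg hsrc
  have eadr : ∀ s₁ : State, c.Regs s₁ → s₁.reg 25 = g → s₁.reg 28 = src → s₁.reg 33 = t' →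
      Ev μ s₁ (Expr.adr (Expr.adr (.reg 25) (.reg 28)) (.reg 33)) (c.adr (c.adr g src) t') :=
    fun s₁ h1 h2 h3 h4 => .adr h1 (.adr h1 (.reg h2) (.reg h3) (c.fit3 hg hsrc)) (.reg h4)
      (c.fit4 hgs ht')
  refine WP.iteLt (.get (eadr s hr h25 h28 h33) (v := row c s g src t') rfl) (.reg h31) c.one_lt
    (fun hlt => ?_) (fun hle => ?_)
  · refine WP.seqSetArr (eadr s hr h25 h28 h33) (.reg h31) ?_
    refine WP.seqSetArr (.reg (v := stk.length) (by simpa using h.sp)) (.reg (v := t') (by simpa using h33)) ?_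
    refine WP.setReg (.add (.reg (v := stk.length) (by simpa using h.sp)) (.lit (by omega)) (by omega)) ?_
    have key : ∀ g' x y, x < c.X → y < c.X →
        (((s.setA 11 (c.adr (c.adr g src) t') val).setA 12 stk.length t').setR 29
          (stk.length + 1)).arr 11 (c.adr (c.adr g' x) y) =
        if g' = g ∧ x = src ∧ y = t' then val else s.arr 11 (c.adr (c.adr g' x) y) := by
      intro g' x y hx hy
      simp only [State.setR_arr, State.setA_arr, Nat.reduceEqDiff, if_false, if_true]
      rw [c.upd3 hsrc hx ht' hy]
    have hrow : ∀ t, row c (((s.setA 11 (c.adr (c.adr g src) t') val).setA 12 stk.length t').setR 29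
          (stk.length + 1)) g src t = if t = t' then val else row c s g src t := by
      intro t
      unfold row
      rw [key g src t hsrc (Fin.lt_X c t)]
      simp [Fin.ext_iff]
    have hne : ∀ t, t ≠ t' → row c (((s.setA 11 (c.adr (c.adr g src) t') val).setA 12 stk.length
        t').setR 29 (stk.length + 1)) g src t = row c s g src t := fun t ht => by
      rw [hrow, if_neg ht]
    have heq : row c (((s.setA 11 (c.adr (c.adr g src) t') val).setA 12 stk.length
        t').setR 29 (stk.length + 1)) g src t' = val := by
      rw [hrow, if_pos rfl]
    have hle : ∀ t, row c s g src t ≤ row c (((s.setA 11 (c.adr (c.adr g src) t') val).setA 12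
        stk.length t').setR 29 (stk.length + 1)) g src t := fun t => by
      rw [hrow]; split_ifs with h1
      · rw [h1]; exact hlt.le
      · exact le_rfl
    refine ⟨t' :: stk, ⟨by simp, ⟨?_, ?_⟩, ?_, fun t => (h.mono t).trans (hle t), ?_, ?_⟩,
      fun x hx => List.mem_cons_of_mem _ hx, hle, fun t ht => ?_, heq.ge, hne, ?_, ?_⟩
    · simp
    · simp only [State.setR_arr, State.setA_arr, if_true]
      refine h.stack.congr fun i hi => ?_
      rw [Function.update_of_ne (by omega)]
      simp
    · intro t
      rw [hrow]
      split_ifs with h1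
      · subst h1; exact hval
      · exact h.sound t
    · intro g' x y hx hy hne'
      rw [key g' x y hx hy, if_neg (by tauto)]
      exact h.other g' x y hx hy hne'
    · have := sum_row_lt hne (by rw [heq]; exact hlt)
      simp only [List.length_cons]
      omega
    · by_cases h1 : t = t'
      · rw [h1]; exact List.mem_cons_self
      · rw [hne t h1] at ht; omega
    · have := rowPot_add_le deg hne (by rw [heq]; exact hlt)
      simp only [stackPot, List.map_cons, List.sum_cons] at this ⊢
      omega
    · simp only [Expr.cost, Expr.adr_cost]
      omega
  · refine WP.skip ⟨stk, h, fun _ h => h, fun _ => le_rfl, fun t ht => absurd ht (lt_irrefl _), hle,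
      fun _ _ => rfl, le_rfl, ?_⟩
    simp only [Expr.cost, Expr.adr_cost]
    omega

variable (c) in
/-- Graph number `g` in memory is `H`. -/
structure GraphRep (s : State) (g : ℕ) (H : SimpleGraph (Fin c.n)) : Prop where
  lst : ∀ t : Fin c.n, ∀ r < degOf c s g t, ∃ t' : Fin c.n,
    s.arr 10 (c.adr (c.adr g t) r) = t' ∧ H.Adj t t'
  mem : ∀ t t' : Fin c.n, H.Adj t t' → ∃ r < degOf c s g t, s.arr 10 (c.adr (c.adr g t) r) = t'
  sum : ∑ t, degOf c s g t = 2 * H.edgeSet.ncard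

theorem two_mul_ncard_edgeSet_le {n : ℕ} (H : SimpleGraph (Fin n)) :
    2 * H.edgeSet.ncard ≤ n ^ 2 := by
  classical
  rw [Set.ncard_eq_toFinset_card']
  have h := H.card_edgeFinset_le_card_choose_two
  rw [Fintype.card_fin] at h
  have h2 := Nat.choose_two_right n
  have h3 : n * (n - 1) ≤ n ^ 2 := by
    rw [pow_two]; exact Nat.mul_le_mul_left _ (Nat.sub_le _ _)
  change 2 * H.edgeFinset.card ≤ _
  omega

theorem GraphRep.deg_lt {s : State} {g : ℕ} {H : SimpleGraph (Fin c.n)} (h : GraphRep c s g H)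
    (t : Fin c.n) : degOf c s g t + 1 < c.X := by
  have h1 := Finset.single_le_sum (f := degOf c s g) (fun _ _ => Nat.zero_le _) (Finset.mem_univ t)
  have h2 := two_mul_ncard_edgeSet_le H
  have h3 := h.sum
  have := c.sq_le_cube
  have := c.hX
  have := c.hn
  have := c.n_le_cube
  omega

theorem GraphRep.congr {s s' : State} {g : ℕ} {H : SimpleGraph (Fin c.n)} (h : GraphRep c s g H)
    (h9 : s'.arr 9 = s.arr 9) (h10 : s'.arr 10 = s.arr 10) : GraphRep c s' g H := by
  have hd : degOf c s' g = degOf c s g := by funext t; simp only [degOf, h9]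
  exact ⟨by rw [hd, h10]; exact h.lst, by rw [hd, h10]; exact h.mem, by rw [hd]; exact h.sum⟩

theorem ClosedBut.trans {n : ℕ} {H : SimpleGraph (Fin n)} {ρ ρ' : Fin n → ℕ}
    {E : Fin n → Fin n → Prop} {stk stk' : List (Fin n)}
    (h : ClosedBut H ρ fun t t' => t ∈ stk ∨ E t t') (hs : ∀ x ∈ stk, x ∈ stk')
    (hm : ∀ t, ρ t ≤ ρ' t) (hc : ∀ t, ρ t < ρ' t → t ∈ stk') :
    ClosedBut H ρ' fun t t' => t ∈ stk' ∨ E t t' := by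
  intro t t' ht
  rcases (hm t).lt_or_eq with hlt | heq
  · exact .inr (.inl (hc t hlt))
  · rcases h t t' ht with h1 | h1 | h1
    · left; have := hm t'; omega
    · exact .inr (.inl (hs t h1))
    · exact .inr (.inr h1)

theorem relaxNeighbors_spec {H : SimpleGraph (Fin c.n)} {g : ℕ} {src t : Fin c.n} {s₀ s : State}
    {stk : List (Fin c.n)} {τ : ℕ} (hr : c.Regs s) (hg : g < c.X ^ 2)
    (h25 : s.reg 25 = g) (h28 : s.reg 28 = src) (h30 : s.reg 30 = t)
    (h31 : s.reg 31 = row c s g src t - 1)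
    (hH : GraphRep c s g H) (h : RowState c H g src s₀ s stk)
    (hcl : ClosedBut H (row c s g src) fun t₁ _ => t₁ ∈ stk ∨ t₁ = t) :
    WP μ relaxNeighbors (fun s' τ' => ∃ stk', RowState c H g src s₀ s' stk' ∧
      ClosedBut H (row c s' g src) (fun t₁ _ => t₁ ∈ stk' ∨ False) ∧
      stackPot (degOf c s g) stk' + rowPot (degOf c s g) (row c s g src) ≤
        stackPot (degOf c s g) stk + rowPot (degOf c s g) (row c s' g src) ∧
      τ' ≤ τ + 80 * degOf c s g t + 20) s τ := by
  have hX := c.sq_X_le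
  have ht := Fin.lt_X c t
  have hdeg := hH.deg_lt t
  have hgt : c.adr g t < c.X ^ 3 := c.adr_lt3 hg ht
  refine WP.forLt (degOf c s g t) (fun j s' τ' => ∃ stk', RowState c H g src s₀ s' stk' ∧
      row c s' g src t = row c s g src t ∧
      ClosedBut H (row c s' g src) (fun t₁ t₂ => t₁ ∈ stk' ∨
        (t₁ = t ∧ ∃ r, j ≤ r ∧ r < degOf c s g t ∧ s.arr 10 (c.adr (c.adr g t) r) = t₂)) ∧
      stackPot (degOf c s g) stk' + rowPot (degOf c s g) (row c s g src) ≤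
        stackPot (degOf c s g) stk + rowPot (degOf c s g) (row c s' g src) ∧
      τ' ≤ τ + 80 * j + 2) c.one_lt (by omega) ?_ ?_ ?_ ?_
  · refine ⟨stk, ⟨by simpa using h.sp, h.stack, h.sound, h.mono, h.other, h.size⟩, rfl, ?_, le_rfl,
      by simp⟩
    intro t₁ t₂ hadj
    rcases hcl t₁ t₂ hadj with h1 | h1 | rfl
    · exact .inl h1
    · exact .inr (.inl h1)
    · obtain ⟨r, hr, hr'⟩ := hH.mem _ _ hadj
      exact .inr (.inr ⟨rfl, r, Nat.zero_le _, hr, hr'⟩)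
  · intro j s' τ' hfr _ _ _
    exact .get (.adr (hr.frame hfr (by decide)) (.reg ((hfr.reg 25 (by decide)).trans h25))
      (.reg ((hfr.reg 30 (by decide)).trans h30)) (c.fit3 hg ht))
      (by rw [hfr.arr 9 (by decide)]; rfl)
  · rintro j s' τ' hfr hj hjd ⟨stk', hst, hrow, hcl', hpot, ht'⟩
    have hr' : c.Regs s' := hr.frame hfr (by decide)
    have h25' : s'.reg 25 = g := (hfr.reg 25 (by decide)).trans h25
    have h30' : s'.reg 30 = t := (hfr.reg 30 (by decide)).trans h30
    obtain ⟨t', ht'10, hadj⟩ := hH.lst t j hjd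
    refine WP.seqSetReg (v := t') (.get (.adr hr' (.adr hr' (.reg h25') (.reg h30') (c.fit3 hg ht))
      (.reg hj) (c.fit4 hgt (by omega))) (by rw [hfr.arr 10 (by decide)]; exact ht'10)) ?_
    refine WP.mono (improve_spec (H := H) (s₀ := s₀) (stk := stk') (src := src) (t' := t')
      (val := row c s g src t - 1) (degOf c s g) (hr'.setR _ (by norm_num)) hg (by simpa using h25')
      (by simpa using (hfr.reg 28 (by decide)).trans h28) (by simp)
      (by simpa using (hfr.reg 31 (by decide)).trans h31)
      ⟨by simpa using hst.sp, hst.stack, hst.sound, hst.mono, hst.other, hst.size⟩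
      (fun h0 => by rw [← hrow] at h0 ⊢; exact hst.sound.adj hadj h0)) ?_
    rintro s₂ τ₂ hfr₂ ⟨stk₂, hst₂, hsub, hle, hch, hval, hne, hpot₂, ht₂⟩
    have hrow₂ : row c s₂ g src t = row c s g src t := (hne t hadj.ne).trans hrow
    refine ⟨?_, stk₂, ⟨by simpa using hst₂.sp, hst₂.stack, hst₂.sound, hst₂.mono, hst₂.other,
      hst₂.size⟩, hrow₂, ?_, ?_, ?_⟩
    · rw [hfr₂.reg 32 (by decide)]; simpa using hj
    · intro t₁ t₂ hadj'
      rcases (hcl'.trans hsub hle hch) t₁ t₂ hadj' with h1 | h1 | ⟨h1, r, h2, h3, h4⟩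
      · exact .inl h1
      · exact .inr (.inl h1)
      · rcases h2.eq_or_lt with rfl | h2
        · left
          have : t₂ = t' := Fin.ext (h4.symm.trans ht'10)
          subst this
          show row c s₂ g src t₁ ≤ row c s₂ g src t₂ + 1
          rw [h1, hrow₂]
          omega
        · exact .inr (.inr ⟨h1, r, h2, h3, h4⟩)
    · change stackPot (degOf c s g) stk₂ + rowPot (degOf c s g) (row c s' g src) ≤ _ at hpot₂
      change _ ≤ _ + rowPot (degOf c s g) (row c s₂ g src)
      omega
    · simp only [Expr.cost, Expr.adr_cost] at ht₂
      omega
  · rintro s' τ' hfr - ⟨stk', hst, hrow, hcl', hpot, ht'⟩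
    refine ⟨stk', hst, fun t₁ t₂ hadj => ?_, hpot, ?_⟩
    · rcases hcl' t₁ t₂ hadj with h1 | h1 | ⟨h1, r, h2, h3, h4⟩
      · exact .inl h1
      · exact .inr (.inl h1)
      · omega
    · simp only [Expr.cost, Expr.adr_cost]
      omega

end Tables

section Tables

variable {μ : Machine} {c : Cfg μ}

theorem RowState.of_eq {H : SimpleGraph (Fin c.n)} {g : ℕ} {src : Fin c.n} {s₀ s s' : State}
    {stk : List (Fin c.n)} (h : RowState c H g src s₀ s stk) (h29 : s'.reg 29 = s.reg 29)
    (harr : s'.arr = s.arr) : RowState c H g src s₀ s' stk := by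
  have hrow : row c s' g src = row c s g src := by funext t; simp only [row, harr]
  exact ⟨h29.trans h.sp, by rw [harr]; exact h.stack, by rw [hrow]; exact h.sound,
    by rw [hrow]; exact h.mono, by rw [harr]; exact h.other, by rw [hrow]; exact h.size⟩

theorem relaxTop_spec {H : SimpleGraph (Fin c.n)} {g : ℕ} {src t : Fin c.n} {s₀ s : State}
    {stk : List (Fin c.n)} {τ : ℕ} (hr : c.Regs s) (hg : g < c.X ^ 2)
    (h25 : s.reg 25 = g) (h28 : s.reg 28 = src)
    (hH : GraphRep c s g H) (h : RowState c H g src s₀ s (t :: stk))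
    (hcl : ClosedBut H (row c s g src) fun t₁ _ => t₁ ∈ t :: stk ∨ False) :
    WP μ relaxTop (fun s' τ' => ∃ stk', RowState c H g src s₀ s' stk' ∧
      ClosedBut H (row c s' g src) (fun t₁ _ => t₁ ∈ stk' ∨ False) ∧
      stackPot (degOf c s g) stk' + rowPot (degOf c s g) (row c s g src) ≤
        stackPot (degOf c s g) stk + rowPot (degOf c s g) (row c s' g src) ∧
      τ' ≤ τ + 80 * degOf c s g t + 60) s τ := by
  have hX := c.sq_X_le
  have hsrc := Fin.lt_X c src
  have ht := Fin.lt_X c t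
  have hsum := sum_row_le h.sound
  have hsize := h.size
  have hsp := h.sp
  simp only [List.length_cons] at hsize hsp
  have hgs : c.adr g src < c.X ^ 3 := c.adr_lt3 hg hsrc
  have hle := (h.sound.le t).trans_lt (by have := c.k_lt; omega : 2 * c.k < c.X)
  refine WP.seqSetReg (v := stk.length) ((Ev.sub (.reg hsp) (.lit (by omega))
    (by omega)).congr (by omega)) ?_
  refine WP.seqSetReg (v := t) (.get (.reg (v := stk.length) (by simp)) (by simpa using h.stack.1)) ?_
  refine WP.seqSetReg (v := row c s g src t - 1) (.sub (.get (.adr ((hr.setR _ (by norm_num)).setR _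
    (by norm_num)) (.adr ((hr.setR _ (by norm_num)).setR _ (by norm_num))
    (.reg (by simpa using h25)) (.reg (by simpa using h28)) (c.fit3 hg hsrc))
    (.reg (v := t) (by simp)) (c.fit4 hgs ht)) rfl) (.lit (by omega))
    (by show row c s g src t < _; omega)) ?_
  have hr' := ((hr.setR (x := 29) stk.length (by norm_num)).setR (x := 30) t (by norm_num)).setR
    (x := 31) (row c s g src t - 1) (by norm_num)
  refine WP.mono (relaxNeighbors_spec (t := t) (H := H) (s₀ := s₀) (stk := stk) (src := src) hr' hg
    (by simpa using h25) (by simpa using h28) (by simp) (by simp; rfl) (hH.congr rfl rfl)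
    ⟨by simp, h.stack.2, h.sound, h.mono, h.other, by show stk.length ≤ ∑ t, row c s g src t; omega⟩
    ?_) ?_
  · intro t₁ t₂ hadj
    rcases hcl t₁ t₂ hadj with h1 | h1 | h1
    · exact .inl h1
    · rcases List.mem_cons.1 h1 with h1 | h1
      · exact .inr (.inr h1)
      · exact .inr (.inl h1)
    · exact h1.elim
  · rintro s' τ' hfr ⟨stk', hst, hcl', hpot, hτ⟩
    refine ⟨stk', hst, hcl', hpot, ?_⟩
    change τ' ≤ _ + 80 * degOf c s g t + 20 at hτ
    simp only [Expr.cost, Expr.adr_cost] at hτ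
    omega

theorem relaxRow_spec {H : SimpleGraph (Fin c.n)} {g : ℕ} {src u v : Fin c.n} {s : State}
    {τ : ℕ} (hr : c.Regs s) (hg : g < c.X ^ 2)
    (h21 : s.reg 21 = u) (h22 : s.reg 22 = v) (h25 : s.reg 25 = g) (h28 : s.reg 28 = src)
    (hH : GraphRep c s g H) (huv : H.Adj u v) (hs : Sound H (2 * c.k) src (row c s g src))
    (hcl : ClosedBut H (row c s g src) fun t t' => t = u ∧ t' = v ∨ t = v ∧ t' = u) :
    WP μ relaxRow (fun s' τ' => Sound H (2 * c.k) src (row c s' g src) ∧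
      ClosedBut H (row c s' g src) (fun _ _ => False) ∧
      (∀ t, row c s g src t ≤ row c s' g src t) ∧
      (∀ g' x y, x < c.X → y < c.X → (g' ≠ g ∨ x ≠ src) →
        s'.arr 11 (c.adr (c.adr g' x) y) = s.arr 11 (c.adr (c.adr g' x) y)) ∧
      τ' + 100 * rowPot (degOf c s g) (row c s g src) ≤
        τ + 100 * rowPot (degOf c s g) (row c s' g src) + 200) s τ := by
  have hX := c.sq_X_le
  have hsrc := Fin.lt_X c src
  have hu := Fin.lt_X c u
  have hv := Fin.lt_X c v
  have hk := c.k_lt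
  have hgs : c.adr g src < c.X ^ 3 := c.adr_lt3 hg hsrc
  have hbd : ∀ {s' : State}, Sound H (2 * c.k) src (row c s' g src) → ∀ t : Fin c.n,
      s'.arr 11 (c.adr (c.adr g src) t) < 2 ^ μ.W := fun h t => by
    have := h.le t
    simp only [row] at this
    omega
  refine WP.seqSetReg (.lit (by omega)) ?_
  have hr₀ := hr.setR (x := 29) 0 (by norm_num)
  refine WP.seqSetReg (v := row c s g src u - 1) (.sub (.get (.adr hr₀ (.adr hr₀
    (.reg (by simpa using h25)) (.reg (by simpa using h28)) (c.fit3 hg hsrc))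
    (.reg (v := u) (by simpa using h21)) (c.fit4 hgs hu)) rfl) (.lit (by omega)) (hbd hs u)) ?_
  refine WP.seqSetReg (v := v) (.reg (by simpa using h22)) (WP.seq ?_)
  have hr₁ := (hr₀.setR (x := 31) (row c s g src u - 1) (by norm_num)).setR (x := 33) v (by norm_num)
  refine WP.mono (improve_spec (H := H) (s₀ := s) (stk := []) (src := src) (t' := v)
    (val := row c s g src u - 1) (degOf c s g) hr₁ hg (by simpa using h25) (by simpa using h28)
    (by simp) (by simp) ⟨by simp, trivial, hs, fun _ => le_rfl, fun _ _ _ _ _ _ => rfl, by simp⟩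
    (fun h0 => hs.adj huv h0)) ?_
  rintro s₁ τ₁ hfr₁ ⟨stk₁, hst₁, hsub₁, hle₁, hch₁, hval₁, hne₁, hpot₁, ht₁⟩
  change ∀ t, row c s g src t ≤ _ at hle₁
  change ∀ t, row c s g src t < _ → _ at hch₁
  change ∀ t, t ≠ v → _ = row c s g src t at hne₁
  change _ + rowPot _ (row c s g src) ≤ _ at hpot₁
  have hr₂ : c.Regs s₁ := hr₁.frame hfr₁ (by decide)
  have h21₁ : s₁.reg 21 = u := by rw [hfr₁.reg 21 (by decide)]; simpa using h21
  have h22₁ : s₁.reg 22 = v := by rw [hfr₁.reg 22 (by decide)]; simpa using h22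
  have h25₁ : s₁.reg 25 = g := by rw [hfr₁.reg 25 (by decide)]; simpa using h25
  have h28₁ : s₁.reg 28 = src := by rw [hfr₁.reg 28 (by decide)]; simpa using h28
  refine WP.seqSetReg (v := row c s₁ g src v - 1) (.sub (.get (.adr hr₂ (.adr hr₂
    (.reg h25₁) (.reg h28₁) (c.fit3 hg hsrc)) (.reg h22₁) (c.fit4 hgs hv)) rfl)
    (.lit (by omega)) (hbd hst₁.sound v)) ?_
  refine WP.seqSetReg (v := u) (.reg (by simpa using h21₁)) (WP.seq ?_)
  have hr₃ := (hr₂.setR (x := 31) (row c s₁ g src v - 1) (by norm_num)).setR (x := 33) u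
    (by norm_num)
  refine WP.mono (improve_spec (H := H) (s₀ := s) (stk := stk₁) (src := src) (t' := u)
    (val := row c s₁ g src v - 1) (degOf c s g) hr₃ hg (by simpa using h25₁) (by simpa using h28₁)
    (by simp) (by simp) (hst₁.of_eq (by simp) rfl)
    (fun h0 => hst₁.sound.adj huv.symm h0)) ?_
  rintro s₂ τ₂ hfr₂ ⟨stk₂, hst₂, hsub₂, hle₂, hch₂, hval₂, hne₂, hpot₂, ht₂⟩
  change ∀ t, row c s₁ g src t ≤ _ at hle₂
  change ∀ t, row c s₁ g src t < _ → _ at hch₂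
  change ∀ t, t ≠ u → _ = row c s₁ g src t at hne₂
  change _ + rowPot _ (row c s₁ g src) ≤ _ at hpot₂
  have h9 : s₂.arr 9 = s.arr 9 := by
    rw [hfr₂.arr 9 (by decide)]; exact hfr₁.arr 9 (by decide)
  have h10 : s₂.arr 10 = s.arr 10 := by
    rw [hfr₂.arr 10 (by decide)]; exact hfr₁.arr 10 (by decide)
  have hr₄ : c.Regs s₂ := hr₃.frame hfr₂ (by decide)
  have h25₂ : s₂.reg 25 = g := by rw [hfr₂.reg 25 (by decide)]; simpa using h25₁
  have h28₂ : s₂.reg 28 = src := by rw [hfr₂.reg 28 (by decide)]; simpa using h28₁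
  have hcl₁ : ClosedBut H (row c s₁ g src) fun t t' => t ∈ stk₁ ∨ (t = v ∧ t' = u) := by
    have h0 : ClosedBut H (row c s g src) fun t t' => t ∈ ([] : List (Fin c.n)) ∨
        (t = u ∧ t' = v ∨ t = v ∧ t' = u) := fun t t' ht => (hcl t t' ht).imp_right .inr
    intro t t' ht
    rcases (h0.trans hsub₁ hle₁ hch₁) t t' ht with h1 | h1 | ⟨rfl, rfl⟩ | h1
    · exact .inl h1
    · exact .inr (.inl h1)
    · left
      rw [hne₁ t ht.ne]; omega
    · exact .inr (.inr h1)
  have hcl₂ : ClosedBut H (row c s₂ g src) fun t t' => t ∈ stk₂ ∨ False := by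
    intro t t' ht
    rcases (hcl₁.trans hsub₂ hle₂ hch₂) t t' ht with h1 | h1 | ⟨rfl, rfl⟩
    · exact .inl h1
    · exact .inr (.inl h1)
    · left
      rw [hne₂ t ht.ne]; omega
  have hd : ∀ {s' : State}, s'.arr 9 = s.arr 9 → degOf c s' g = degOf c s g := fun h => by
    funext t; simp only [degOf, h]
  refine WP.loop (fun s' τ' => ∃ stk, RowState c H g src s s' stk ∧
    ClosedBut H (row c s' g src) (fun t₁ _ => t₁ ∈ stk ∨ False) ∧
    τ' + 100 * stackPot (degOf c s g) stk + 100 * rowPot (degOf c s g) (row c s g src) ≤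
      τ + 100 * rowPot (degOf c s g) (row c s' g src) + 180)
    (τ + 100 * rowPot (degOf c s g) (fun _ => 2 * c.k) + 180) ?_ ?_ ?_ ?_ ?_
  · refine ⟨stk₂, hst₂, hcl₂, ?_⟩
    have : stackPot (degOf c s g) [] = 0 := rfl
    simp only [Expr.cost, Expr.adr_cost] at ht₁ ht₂
    omega
  · rintro s' τ' ⟨stk, hst, -, ht⟩
    have := rowPot_mono (degOf c s g) fun t => hst.sound.le t
    omega
  · intros; trivial
  · rintro s' τ' hfr ⟨stk, hst, hcl', ht⟩ hne
    have hne : s'.reg 29 ≠ 0 := hne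
    rw [hst.sp] at hne
    have h9' : s'.arr 9 = s.arr 9 := (hfr.arr 9 (by decide)).trans h9
    have h10' : s'.arr 10 = s.arr 10 := (hfr.arr 10 (by decide)).trans h10
    cases stk with
    | nil => simp at hne
    | cons t stk =>
      refine WP.mono (relaxTop_spec (hr₄.frame hfr (by decide)) hg
        ((hfr.reg 25 (by decide)).trans h25₂) ((hfr.reg 28 (by decide)).trans h28₂)
        (hH.congr h9' h10') hst hcl') ?_
      rintro s₃ τ₃ hfr₃ ⟨stk₃, hst₃, hcl₃, hpot₃, ht₃⟩
      rw [hd h9'] at hpot₃ ht₃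
      refine ⟨stk₃, hst₃, hcl₃, ?_⟩
      have : stackPot (degOf c s g) (t :: stk) = degOf c s g t + 1 + stackPot (degOf c s g) stk := by
        simp [stackPot]
      simp only [Expr.cost] at ht₃
      omega
  · rintro s' τ' hfr ⟨stk, hst, hcl', ht⟩ h0
    have h0 : s'.reg 29 = 0 := h0
    rw [hst.sp, List.length_eq_zero_iff] at h0
    subst h0
    refine ⟨hst.sound, fun t t' hadj => ?_, hst.mono, hst.other, ?_⟩
    · rcases hcl' t t' hadj with h1 | h1 | h1
      · exact .inl h1
      · simp at h1
      · exact h1.elim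
    · simp only [Expr.cost]
      have : stackPot (degOf c s g) [] = 0 := rfl
      omega

end Tables

open FTSpanner.Expr in
/-- Updates the rows of all sources of colour `26` at position `23`. -/
def relaxClass : Cmd :=
  .forLt 27 (get 5 (adr (reg 23) (reg 26)))
    (.seq (.setReg 28 (get 4 (adr (adr (reg 23) (reg 26)) (reg 27)))) relaxRow)

open FTSpanner.Expr in
/-- Inserts the edge between `21` and `22` into graph `25` of position `23`. -/
def insertEdge : Cmd :=
  .seq (.setArr 10 (adr (adr (reg 25) (reg 21)) (get 9 (adr (reg 25) (reg 21)))) (reg 22)) <|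
  .seq (.setArr 9 (adr (reg 25) (reg 21)) (bin .add (get 9 (adr (reg 25) (reg 21))) (lit 1))) <|
  .seq (.setArr 10 (adr (adr (reg 25) (reg 22)) (get 9 (adr (reg 25) (reg 22)))) (reg 21)) <|
  .seq (.setArr 9 (adr (reg 25) (reg 22)) (bin .add (get 9 (adr (reg 25) (reg 22))) (lit 1))) <|
  .seq (.setArr 11 (adr (adr (reg 25) (reg 21)) (reg 21)) (reg 6)) <|
  .seq (.setArr 11 (adr (adr (reg 25) (reg 22)) (reg 22)) (reg 6)) <|
  .seq (.setReg 26 (get 3 (adr (reg 21) (reg 23)))) <|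
  .seq relaxClass <|
  .seq (.setReg 26 (get 3 (adr (reg 22) (reg 23)))) relaxClass

section Tables

variable {μ : Machine} {c : Cfg μ}

variable (c) in
/-- The potential of table `g`. -/
def tabPot (s : State) (g : ℕ) : ℕ := ∑ src, rowPot (degOf c s g) (row c s g src)

theorem tabPot_row {s s' : State} {g : ℕ} {src : Fin c.n} (hd : degOf c s' g = degOf c s g)
    (h : ∀ x, x ≠ src → row c s' g x = row c s g x) :
    tabPot c s g + rowPot (degOf c s g) (row c s' g src) =
      tabPot c s' g + rowPot (degOf c s g) (row c s g src) := by
  unfold tabPot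
  rw [hd, ← Finset.add_sum_erase _ _ (Finset.mem_univ src),
    ← Finset.add_sum_erase _ (fun x => rowPot (degOf c s g) (row c s' g x)) (Finset.mem_univ src),
    Finset.sum_congr rfl fun x hx => by rw [← h x (Finset.ne_of_mem_erase hx)]]
  ring

theorem relaxClass_spec {H : SimpleGraph (Fin c.n)} {g a x : ℕ} {u v : Fin c.n} {s : State}
    {τ : ℕ} (hr : c.Regs s) (hg : g < c.X ^ 2) (ha : a < c.N) (hx : x < c.q)
    (h21 : s.reg 21 = u) (h22 : s.reg 22 = v) (h23 : s.reg 23 = a) (h25 : s.reg 25 = g)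
    (h26 : s.reg 26 = x) (hC : ClassInv c s a c.n)
    (hH : GraphRep c s g H) (huv : H.Adj u v)
    (hs : ∀ src, Sound H (2 * c.k) src (row c s g src))
    (hcl : ∀ src, ClosedBut H (row c s g src) fun t t' => t = u ∧ t' = v ∨ t = v ∧ t' = u) :
    WP μ relaxClass (fun s' τ' => (∀ src, Sound H (2 * c.k) src (row c s' g src)) ∧
      (∀ src, ClosedBut H (row c s' g src) fun t t' => t = u ∧ t' = v ∨ t = v ∧ t' = u) ∧
      (∀ src, ClosedBut H (row c s g src) (fun _ _ => False) →
        ClosedBut H (row c s' g src) fun _ _ => False) ∧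
      (∀ src : Fin c.n, ∀ r < s.arr 5 (c.adr a x), s.arr 4 (c.adr (c.adr a x) r) = src →
        ClosedBut H (row c s' g src) fun _ _ => False) ∧
      (∀ src t, row c s g src t ≤ row c s' g src t) ∧
      (∀ g' y z, y < c.X → z < c.X → g' ≠ g →
        s'.arr 11 (c.adr (c.adr g' y) z) = s.arr 11 (c.adr (c.adr g' y) z)) ∧
      τ' + 100 * tabPot c s g ≤ τ + 100 * tabPot c s' g + 250 * c.cap + 20) s τ := by
  have hX := c.sq_X_le
  have hqX := c.two_q_lt
  have hNX := c.N_lt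
  have hcX := c.cap_lt
  have hle := hC.le x hx
  refine WP.forLt (s.arr 5 (c.adr a x)) (fun j s' τ' =>
      (∀ src, Sound H (2 * c.k) src (row c s' g src)) ∧
      (∀ src, ClosedBut H (row c s' g src) fun t t' => t = u ∧ t' = v ∨ t = v ∧ t' = u) ∧
      (∀ src, ClosedBut H (row c s g src) (fun _ _ => False) →
        ClosedBut H (row c s' g src) fun _ _ => False) ∧
      (∀ src : Fin c.n, ∀ r < j, s.arr 4 (c.adr (c.adr a x) r) = src →
        ClosedBut H (row c s' g src) fun _ _ => False) ∧
      (∀ src t, row c s g src t ≤ row c s' g src t) ∧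
      (∀ g' y z, y < c.X → z < c.X → g' ≠ g →
        s'.arr 11 (c.adr (c.adr g' y) z) = s.arr 11 (c.adr (c.adr g' y) z)) ∧
      τ' + 100 * tabPot c s g ≤ τ + 100 * tabPot c s' g + 250 * j + 2)
      c.one_lt (by omega) ?_ ?_ ?_ ?_
  · exact ⟨hs, hcl, fun _ h => h, fun _ _ h => by omega, fun _ _ => le_rfl, fun _ _ _ _ _ _ => rfl,
      by
      show τ + 2 + 100 * tabPot c s g ≤ τ + 100 * tabPot c s g + 250 * 0 + 2; omega⟩
  · intro j s' τ' hfr _ _ _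
    exact .get (.adr (hr.frame hfr (by decide)) (.reg ((hfr.reg 23 (by decide)).trans h23))
      (.reg ((hfr.reg 26 (by decide)).trans h26)) (c.fit2 (by omega) (by omega)))
      (by rw [hfr.arr 5 (by decide)])
  · rintro j s' τ' hfr hj hjl ⟨h1, h2, h3, h4, h5, h6, h7⟩
    have hr' : c.Regs s' := hr.frame hfr (by decide)
    obtain ⟨src, hsrc⟩ : ∃ src : Fin c.n, s.arr 4 (c.adr (c.adr a x) j) = src :=
      ⟨⟨_, hC.lst x hx j hjl⟩, rfl⟩
    have h9 : s'.arr 9 = s.arr 9 := hfr.arr 9 (by decide)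
    have hd : degOf c s' g = degOf c s g := by funext t; simp only [degOf, h9]
    refine WP.seqSetReg (v := src) (.get (.adr hr' (.adr hr'
      (.reg ((hfr.reg 23 (by decide)).trans h23)) (.reg ((hfr.reg 26 (by decide)).trans h26))
      (c.fit2 (by omega) (by omega))) (.reg hj) (c.fit3 (c.adr_lt (by omega) (by omega))
        (by omega))) (by rw [hfr.arr 4 (by decide)]; exact hsrc)) ?_
    refine WP.mono (relaxRow_spec (u := u) (v := v) (H := H) (src := src) (hr'.setR _ (by norm_num)) hg
      (by simpa using (hfr.reg 21 (by decide)).trans h21)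
      (by simpa using (hfr.reg 22 (by decide)).trans h22)
      (by simpa using (hfr.reg 25 (by decide)).trans h25) (by simp)
      (hH.congr h9 (hfr.arr 10 (by decide))) huv (h1 src) (h2 src)) ?_
    rintro s₂ τ₂ hfr₂ ⟨hs₂, hcl₂, hm₂, ho₂, ht₂⟩
    change ∀ t, row c s' g src t ≤ row c s₂ g src t at hm₂
    have hrow : ∀ y, y ≠ src → row c s₂ g y = row c s' g y := fun y hy => by
      funext t
      exact ho₂ g y t (Fin.lt_X c y) (Fin.lt_X c t) (.inr fun h => hy (Fin.ext h))
    have hd₂ : degOf c s₂ g = degOf c s g := by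
      funext t
      simp only [degOf, hfr₂.arr 9 (by decide)]
      exact congrArg (fun f : ℕ → ℕ => f _) h9
    have hpot := tabPot_row (c := c) (s := s') (s' := s₂) (g := g) (src := src) (hd₂.trans hd.symm) hrow
    change τ₂ + 100 * rowPot (degOf c s' g) (row c s' g src) ≤
      _ + 100 * rowPot (degOf c s' g) (row c s₂ g src) + 200 at ht₂
    refine ⟨?_, fun y => ?_, fun y => ?_, fun y hy => ?_, fun y r hrj hy => ?_, fun y t => ?_,
      fun g' y z hy hz hne => ?_, ?_⟩
    · rw [hfr₂.reg 27 (by decide)]; simpa using hj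
    · change Sound H (2 * c.k) y (row c s₂ g y)
      by_cases hy : y = src
      · rw [hy]; exact hs₂
      · rw [hrow y hy]; exact h1 y
    · change ClosedBut H (row c s₂ g y) _
      by_cases hy : y = src
      · rw [hy]; exact fun t t' ht => .inl ((hcl₂ t t' ht).resolve_right id)
      · rw [hrow y hy]; exact h2 y
    · change ClosedBut H (row c s₂ g y) _
      by_cases hy' : y = src
      · rw [hy']; exact hcl₂
      · rw [hrow y hy']; exact h3 y hy
    · change ClosedBut H (row c s₂ g y) _
      by_cases hy' : y = src
      · rw [hy']; exact hcl₂
      · rw [hrow y hy']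
        rcases Nat.lt_succ_iff_lt_or_eq.1 hrj with hrj | rfl
        · exact h4 y r hrj hy
        · exact absurd (Fin.ext (hy.symm.trans hsrc)) hy'
    · change _ ≤ row c s₂ g y t
      by_cases hy : y = src
      · rw [hy]; exact (h5 src t).trans (hm₂ t)
      · rw [hrow y hy]; exact h5 y t
    · exact (ho₂ g' y z hy hz (.inl hne)).trans (h6 g' y z hy hz hne)
    · change _ ≤ _ + 100 * tabPot c s₂ g + _ + _
      simp only [Expr.cost, Expr.adr_cost] at ht₂
      omega
  · rintro s' τ' hfr - ⟨h1, h2, h3, h4, h5, h6, h7⟩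
    refine ⟨h1, h2, h3, h4, h5, h6, ?_⟩
    simp only [Expr.cost, Expr.adr_cost]
    omega

variable (c) in
/-- Table `g` in memory represents `H` and the distances in `H`. -/
structure TableRep (s : State) (g : ℕ) (H : SimpleGraph (Fin c.n)) : Prop where
  graph : GraphRep c s g H
  sound : ∀ src, Sound H (2 * c.k) src (row c s g src)
  closed : ∀ src, ClosedBut H (row c s g src) fun _ _ => False
  diag : ∀ t t', H.Adj t t' → row c s g t t = 2 * c.k

variable (c) in
/-- Table `g` is the same in both states. -/
structure SameTable (s s' : State) (g : ℕ) : Prop where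
  deg : ∀ x < c.X, s'.arr 9 (c.adr g x) = s.arr 9 (c.adr g x)
  adj : ∀ x < c.X, ∀ y < c.X, s'.arr 10 (c.adr (c.adr g x) y) = s.arr 10 (c.adr (c.adr g x) y)
  tab : ∀ x < c.X, ∀ y < c.X, s'.arr 11 (c.adr (c.adr g x) y) = s.arr 11 (c.adr (c.adr g x) y)

theorem SameTable.degOf_eq {s s' : State} {g : ℕ} (h : SameTable c s s' g) :
    degOf c s' g = degOf c s g := funext fun t => h.deg t (Fin.lt_X c t)

theorem SameTable.row_eq {s s' : State} {g : ℕ} (h : SameTable c s s' g) (src : Fin c.n) :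
    row c s' g src = row c s g src :=
  funext fun t => h.tab src (Fin.lt_X c src) t (Fin.lt_X c t)

theorem SameTable.tabPot_eq {s s' : State} {g : ℕ} (h : SameTable c s s' g) :
    tabPot c s' g = tabPot c s g := by
  unfold tabPot
  rw [h.degOf_eq]
  exact Finset.sum_congr rfl fun src _ => by rw [h.row_eq]

theorem SameTable.trans {s s' s'' : State} {g : ℕ} (h : SameTable c s s' g)
    (h' : SameTable c s' s'' g) : SameTable c s s'' g :=
  ⟨fun x hx => (h'.deg x hx).trans (h.deg x hx),
    fun x hx y hy => (h'.adj x hx y hy).trans (h.adj x hx y hy),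
    fun x hx y hy => (h'.tab x hx y hy).trans (h.tab x hx y hy)⟩

theorem SameTable.of_arr {s s' : State} {g : ℕ} (h9 : s'.arr 9 = s.arr 9)
    (h10 : s'.arr 10 = s.arr 10) (h11 : s'.arr 11 = s.arr 11) : SameTable c s s' g :=
  ⟨fun _ _ => by rw [h9], fun _ _ _ _ => by rw [h10], fun _ _ _ _ => by rw [h11]⟩

theorem TableRep.congr {s s' : State} {g : ℕ} {H : SimpleGraph (Fin c.n)} (h : TableRep c s g H)
    (hs : SameTable c s s' g) : TableRep c s' g H where
  graph := by
    refine ⟨fun t r hr => ?_, fun t t' ht => ?_, ?_⟩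
    · rw [hs.degOf_eq] at hr
      rw [hs.adj t (Fin.lt_X c t) r (by have := h.graph.deg_lt t; omega)]
      exact h.graph.lst t r hr
    · obtain ⟨r, hr, hr'⟩ := h.graph.mem t t' ht
      refine ⟨r, by rwa [hs.degOf_eq], ?_⟩
      rw [hs.adj t (Fin.lt_X c t) r (by have := h.graph.deg_lt t; omega), hr']
    · rw [hs.degOf_eq]; exact h.graph.sum
  sound src := by rw [hs.row_eq]; exact h.sound src
  closed src := by rw [hs.row_eq]; exact h.closed src
  diag t t' ht := by rw [hs.row_eq]; exact h.diag t t' ht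

theorem TableRep.far {s : State} {g : ℕ} {H : SimpleGraph (Fin c.n)} (h : TableRep c s g H)
    {u v : Fin c.n} (huv : u ≠ v) (h0 : row c s g u v = 0) (p : H.Walk u v) :
    2 * c.k ≤ p.length := by
  cases p with
  | nil => exact absurd rfl huv
  | cons hadj p =>
    have := (h.closed u).le_of_walk (.cons hadj p)
    rw [h.diag _ _ hadj, h0] at this
    omega

theorem TableRep.near {s : State} {g : ℕ} {H : SimpleGraph (Fin c.n)} (h : TableRep c s g H)
    {u v : Fin c.n} (h0 : row c s g u v ≠ 0) : ∃ p : H.Walk u v, p.length ≤ 2 * c.k - 1 := by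
  obtain ⟨p, hp⟩ := h.sound u v h0
  exact ⟨p, by omega⟩

end Tables

section Tables

variable {μ : Machine} {c : Cfg μ}

theorem ClosedBut.mono_row {n : ℕ} {H : SimpleGraph (Fin n)} {ρ ρ' : Fin n → ℕ} {u : Fin n}
    {E : Fin n → Fin n → Prop} (h : ClosedBut H ρ fun _ _ => False)
    (hle : ∀ t, ρ t ≤ ρ' t) (heq : ∀ t t', H.Adj t t' → ρ' t ≠ ρ t → t = u)
    (hu : ∀ t', H.Adj u t' → ρ' u = ρ u) : ClosedBut H ρ' E := by
  intro t t' ht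
  left
  have h1 := (h t t' ht).resolve_right id
  have h2 := hle t'
  by_cases h3 : ρ' t = ρ t
  · omega
  · have := heq t t' ht h3
    subst this
    exact absurd (hu t' ht) h3

/-- The adjacency lists after the insertion of an edge. -/
theorem GraphRep.insert {s s' : State} {g : ℕ} {H : SimpleGraph (Fin c.n)} (h : GraphRep c s g H)
    {u v : Fin c.n} (huv : u ≠ v) (hadj : ¬ H.Adj u v)
    (h9 : ∀ t : Fin c.n, degOf c s' g t =
      degOf c s g t + (if t = u then 1 else 0) + if t = v then 1 else 0)
    (h10 : ∀ t : Fin c.n, ∀ r < c.X, s'.arr 10 (c.adr (c.adr g t) r) =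
      if t = v ∧ r = degOf c s g v then (u : ℕ) else
        if t = u ∧ r = degOf c s g u then (v : ℕ) else s.arr 10 (c.adr (c.adr g t) r)) :
    GraphRep c s' g (H ⊔ SimpleGraph.edge u v) := by
  refine ⟨fun t r hr => ?_, fun t t' ht => ?_, ?_⟩
  · have hd := h.deg_lt t
    rw [h9] at hr
    rw [h10 t r (by split_ifs at hr <;> omega)]
    by_cases h1 : t = v ∧ r = degOf c s g v
    · rw [if_pos h1]
      refine ⟨u, rfl, .inr ?_⟩
      rw [SimpleGraph.edge_adj, h1.1]
      exact ⟨.inr ⟨rfl, rfl⟩, huv.symm⟩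
    · rw [if_neg h1]
      by_cases h2 : t = u ∧ r = degOf c s g u
      · rw [if_pos h2]
        refine ⟨v, rfl, .inr ?_⟩
        rw [SimpleGraph.edge_adj, h2.1]
        exact ⟨.inl ⟨rfl, rfl⟩, huv⟩
      · rw [if_neg h2]
        obtain ⟨t', ht', ha⟩ := h.lst t r (by
          by_cases htu : t = u
          · have htv : t ≠ v := fun h => huv (htu.symm.trans h)
            rw [if_pos htu, if_neg htv] at hr
            have : r ≠ degOf c s g t := fun h => h2 ⟨htu, by rw [h, htu]⟩
            omega
          · by_cases htv : t = v
            · rw [if_neg htu, if_pos htv] at hr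
              have : r ≠ degOf c s g t := fun h => h1 ⟨htv, by rw [h, htv]⟩
              omega
            · rw [if_neg htu, if_neg htv] at hr
              omega)
        exact ⟨t', ht', .inl ha⟩
  · rcases ht with ht | ht
    · obtain ⟨r, hr, hr'⟩ := h.mem t t' ht
      have hd := h.deg_lt t
      refine ⟨r, by rw [h9]; omega, ?_⟩
      rw [h10 t r (by omega), if_neg, if_neg, hr']
      · rintro ⟨rfl, rfl⟩; omega
      · rintro ⟨rfl, rfl⟩; omega
    · rw [SimpleGraph.edge_adj] at ht
      rcases ht.1 with ⟨rfl, rfl⟩ | ⟨rfl, rfl⟩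
      · refine ⟨degOf c s g t, by rw [h9, if_pos rfl]; omega, ?_⟩
        have := h.deg_lt t
        rw [h10 _ _ (by omega), if_neg (fun h => huv h.1), if_pos ⟨rfl, rfl⟩]
      · refine ⟨degOf c s g t, by rw [h9, if_pos (rfl : t = t)]; omega, ?_⟩
        have := h.deg_lt t
        rw [h10 _ _ (by omega), if_pos ⟨rfl, rfl⟩]
  · rw [Finset.sum_congr rfl fun t _ => h9 t, Finset.sum_add_distrib, Finset.sum_add_distrib,
      Finset.sum_ite_eq', Finset.sum_ite_eq', if_pos (Finset.mem_univ _),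
      if_pos (Finset.mem_univ _), h.sum, ncard_edgeSet_sup_edge huv hadj]
    ring

theorem insertEdge_spec {H : SimpleGraph (Fin c.n)} {g a : ℕ} {u v : Fin c.n} {s : State}
    {τ : ℕ} (hr : c.Regs s) (hg : g < c.X ^ 2) (ha : a < c.N)
    (h21 : s.reg 21 = u) (h22 : s.reg 22 = v) (h23 : s.reg 23 = a) (h25 : s.reg 25 = g)
    (hC : ClassInv c s a c.n) (hT : TableRep c s g H) (huv : u ≠ v) (hadj : ¬ H.Adj u v)
    (hcol : ∀ t t', H.Adj t t' → s.arr 3 (c.adr t a) + s.arr 3 (c.adr t' a) =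
      s.arr 3 (c.adr u a) + s.arr 3 (c.adr v a)) :
    WP μ insertEdge (fun s' τ' => TableRep c s' g (H ⊔ SimpleGraph.edge u v) ∧
      (∀ g', g' ≠ g → SameTable c s s' g') ∧
      τ' + 100 * tabPot c s g ≤ τ + 100 * tabPot c s' g + 500 * c.cap + 300) s τ := by
  have hX := c.sq_X_le
  have hNX := c.N_lt
  have hqX := c.two_q_lt
  have hkX := c.k_lt
  have hu := Fin.lt_X c u
  have hv := Fin.lt_X c v
  have hcu := hC.col u u.2
  have hcv := hC.col v v.2
  have hdu := hT.graph.deg_lt u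
  have hdv := hT.graph.deg_lt v
  have huv' : (u : ℕ) ≠ v := fun h => huv (Fin.ext h)
  have hgu : c.adr g u < c.X ^ 3 := c.adr_lt3 hg hu
  have hgv : c.adr g v < c.X ^ 3 := c.adr_lt3 hg hv
  have eu : ∀ s₁ : State, c.Regs s₁ → s₁.reg 25 = g → s₁.reg 21 = u →
      Ev μ s₁ (Expr.adr (.reg 25) (.reg 21)) (c.adr g u) :=
    fun s₁ h1 h2 h3 => .adr h1 (.reg h2) (.reg h3) (c.fit3 hg hu)
  have ev : ∀ s₁ : State, c.Regs s₁ → s₁.reg 25 = g → s₁.reg 22 = v →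
      Ev μ s₁ (Expr.adr (.reg 25) (.reg 22)) (c.adr g v) :=
    fun s₁ h1 h2 h3 => .adr h1 (.reg h2) (.reg h3) (c.fit3 hg hv)
  have hr₁ := hr.setA 10 (c.adr (c.adr g u) (degOf c s g u)) v
  refine WP.seqSetArr (.adr hr (eu s hr h25 h21) (.get (eu s hr h25 h21) (v := degOf c s g u) rfl)
    (c.fit4 hgu (by omega))) (.reg h22) ?_
  refine WP.seqSetArr (eu _ hr₁ h25 h21) (.add (.get (eu _ hr₁ h25 h21) (v := degOf c s g u)
    (by simp; rfl)) (.lit (by omega)) (by omega)) ?_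
  have hr₂ := hr₁.setA 9 (c.adr g u) (degOf c s g u + 1)
  have hdv' : ((s.setA 10 (c.adr (c.adr g u) (degOf c s g u)) v).setA 9 (c.adr g u)
      (degOf c s g u + 1)).arr 9 (c.adr g v) = degOf c s g v := by
    simp only [State.setA_arr, if_true, Nat.reduceEqDiff, if_false]
    rw [c.upd2 hu hv, if_neg (by omega)]
    rfl
  refine WP.seqSetArr (.adr hr₂ (ev _ hr₂ h25 h22) (.get (ev _ hr₂ h25 h22) (v := degOf c s g v)
    hdv') (c.fit4 hgv (by omega))) (.reg h21) ?_
  have hr₃ := hr₂.setA 10 (c.adr (c.adr g v) (degOf c s g v)) u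
  refine WP.seqSetArr (ev _ hr₃ h25 h22) (.add (.get (ev _ hr₃ h25 h22) (v := degOf c s g v)
    (by simpa using hdv')) (.lit (by omega)) (by omega)) ?_
  have hr₄ := hr₃.setA 9 (c.adr g v) (degOf c s g v + 1)
  refine WP.seqSetArr (.adr hr₄ (eu _ hr₄ h25 h21) (.reg h21) (c.fit4 hgu hu)) (.reg hr₄.r6) ?_
  have hr₅ := hr₄.setA 11 (c.adr (c.adr g u) u) (2 * c.k)
  refine WP.seqSetArr (.adr hr₅ (ev _ hr₅ h25 h22) (.reg h22) (c.fit4 hgv hv)) (.reg hr₅.r6) ?_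
  have hr₆ := hr₅.setA 11 (c.adr (c.adr g v) v) (2 * c.k)
  obtain ⟨s₁, hs₁⟩ : ∃ s₁, s₁ = ((((((s.setA 10 (c.adr (c.adr g u) (degOf c s g u)) v).setA 9
    (c.adr g u) (degOf c s g u + 1)).setA 10 (c.adr (c.adr g v) (degOf c s g v)) u).setA 9
    (c.adr g v) (degOf c s g v + 1)).setA 11 (c.adr (c.adr g u) u) (2 * c.k)).setA 11
    (c.adr (c.adr g v) v) (2 * c.k)) := ⟨_, rfl⟩
  rw [← hs₁] at hr₆ ⊢
  have hreg : s₁.reg = s.reg := by rw [hs₁]; rfl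
  have a3 : s₁.arr 3 = s.arr 3 := by rw [hs₁]; simp
  have a4 : s₁.arr 4 = s.arr 4 := by rw [hs₁]; simp
  have a5 : s₁.arr 5 = s.arr 5 := by rw [hs₁]; simp
  have k9 : ∀ g' x, x < c.X → s₁.arr 9 (c.adr g' x) =
      if g' = g ∧ x = v then degOf c s g v + 1 else
        if g' = g ∧ x = u then degOf c s g u + 1 else s.arr 9 (c.adr g' x) := by
    intro g' x hx
    rw [hs₁]
    simp only [State.setA_arr, if_true, Nat.reduceEqDiff, if_false]
    rw [c.upd2 hv hx, c.upd2 hu hx]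
  have k10 : ∀ g' x y, x < c.X → y < c.X → s₁.arr 10 (c.adr (c.adr g' x) y) =
      if g' = g ∧ x = v ∧ y = degOf c s g v then (u : ℕ) else
        if g' = g ∧ x = u ∧ y = degOf c s g u then (v : ℕ) else
          s.arr 10 (c.adr (c.adr g' x) y) := by
    intro g' x y hx hy
    rw [hs₁]
    simp only [State.setA_arr, if_true, Nat.reduceEqDiff, if_false]
    rw [c.upd3 hv hx (by omega) hy, c.upd3 hu hx (by omega) hy]
  have k11 : ∀ g' x y, x < c.X → y < c.X → s₁.arr 11 (c.adr (c.adr g' x) y) =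
      if g' = g ∧ x = v ∧ y = v then 2 * c.k else
        if g' = g ∧ x = u ∧ y = u then 2 * c.k else s.arr 11 (c.adr (c.adr g' x) y) := by
    intro g' x y hx hy
    rw [hs₁]
    simp only [State.setA_arr, if_true, Nat.reduceEqDiff, if_false]
    rw [c.upd3 hv hx hv hy, c.upd3 hu hx hu hy]
  have hd₁ : ∀ t : Fin c.n, degOf c s₁ g t =
      degOf c s g t + (if t = u then 1 else 0) + if t = v then 1 else 0 := by
    intro t
    unfold degOf
    rw [k9 g t (Fin.lt_X c t)]
    by_cases htv : t = v
    · rw [if_pos ⟨rfl, by rw [htv]⟩, if_neg (fun h => huv (h.symm.trans htv)), if_pos htv, htv]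
      rfl
    · rw [if_neg (fun h => htv (Fin.ext h.2)), if_neg htv]
      by_cases htu : t = u
      · rw [if_pos ⟨rfl, by rw [htu]⟩, if_pos htu, htu]; rfl
      · rw [if_neg (fun h => htu (Fin.ext h.2)), if_neg htu]; rfl
  have hrow₁ : ∀ x t : Fin c.n, row c s₁ g x t =
      if (x = v ∧ t = v) ∨ (x = u ∧ t = u) then 2 * c.k else row c s g x t := by
    intro x t
    unfold row
    rw [k11 g x t (Fin.lt_X c x) (Fin.lt_X c t)]
    simp only [true_and, Fin.val_inj]
    split_ifs <;> first | rfl | tauto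
  have hG₁ : GraphRep c s₁ g (H ⊔ SimpleGraph.edge u v) := by
    refine hT.graph.insert huv hadj hd₁ fun t r hr => ?_
    rw [k10 g t r (Fin.lt_X c t) hr]
    simp only [true_and, Fin.val_inj]
  have hle₁ : ∀ x t : Fin c.n, row c s g x t ≤ row c s₁ g x t := by
    intro x t
    rw [hrow₁]
    split_ifs
    · exact (hT.sound x).le t
    · exact le_rfl
  have hs₁' : ∀ src, Sound (H ⊔ SimpleGraph.edge u v) (2 * c.k) src (row c s₁ g src) := by
    intro src t h0
    rw [hrow₁] at h0 ⊢
    split_ifs at h0 ⊢ with h1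
    · rcases h1 with ⟨rfl, rfl⟩ | ⟨rfl, rfl⟩
      · exact ⟨.nil, by simp⟩
      · exact ⟨.nil, by simp⟩
    · obtain ⟨p, hp⟩ := hT.sound src t h0
      exact ⟨p.mapLe le_sup_left, by simpa using hp⟩
  have hcl₁ : ∀ src, ClosedBut (H ⊔ SimpleGraph.edge u v) (row c s₁ g src)
      fun t t' => t = u ∧ t' = v ∨ t = v ∧ t' = u := by
    intro src t t' htt
    rcases htt with htt | htt
    · left
      refine (ClosedBut.mono_row (u := src) (E := fun _ _ => False) (hT.closed src) (hle₁ src)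
        (fun t t' _ hne => ?_) (fun t' hs => ?_) t t' htt).resolve_right id
      · rw [hrow₁] at hne
        split_ifs at hne with h1
        · rcases h1 with ⟨rfl, rfl⟩ | ⟨rfl, rfl⟩ <;> rfl
        · exact absurd rfl hne
      · rw [hrow₁]
        split_ifs
        · exact (hT.diag _ _ hs).symm
        · rfl
    · rw [SimpleGraph.edge_adj] at htt
      exact .inr htt.1
  have hpot₁ : tabPot c s g ≤ tabPot c s₁ g := by
    refine Finset.sum_le_sum fun src _ => Finset.sum_le_sum fun t _ => ?_
    refine Nat.mul_le_mul (hle₁ src t) ?_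
    rw [hd₁]; omega
  have hC₁ : ClassInv c s₁ a c.n := hC.congr (fun _ _ => by rw [a3]) (fun _ _ _ _ => by rw [a4])
    (fun _ _ => by rw [a5])
  have huvH : (H ⊔ SimpleGraph.edge u v).Adj u v :=
    .inr (by rw [SimpleGraph.edge_adj]; exact ⟨.inl ⟨rfl, rfl⟩, huv⟩)
  rw [← hreg] at h21 h22 h23 h25
  refine WP.seqSetReg (.get (.adr hr₆ (.reg h21) (.reg h23) (c.fit2 hu (by omega)))
    (v := s.arr 3 (c.adr u a)) (by rw [a3])) (WP.seq ?_)
  have hr₇ := hr₆.setR (x := 26) (s.arr 3 (c.adr u a)) (by norm_num)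
  refine WP.mono (relaxClass_spec (u := u) (v := v) (a := a) (x := s.arr 3 (c.adr u a)) hr₇ hg ha hcu
    (by simpa using h21) (by simpa using h22) (by simpa using h23) (by simpa using h25) (by simp)
    (hC₁.of_arr rfl) (hG₁.congr rfl rfl) huvH hs₁' hcl₁) ?_
  rintro s₂ τ₂ hfr₂ ⟨hs₂, hcl₂, -, hlst₂, hm₂, ho₂, ht₂⟩
  have hr₈ : c.Regs s₂ := hr₇.frame hfr₂ (by decide)
  have b3 : s₂.arr 3 = s.arr 3 := (hfr₂.arr 3 (by decide)).trans a3
  have b4 : s₂.arr 4 = s.arr 4 := (hfr₂.arr 4 (by decide)).trans a4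
  have b5 : s₂.arr 5 = s.arr 5 := (hfr₂.arr 5 (by decide)).trans a5
  have b9 : s₂.arr 9 = s₁.arr 9 := hfr₂.arr 9 (by decide)
  have b10 : s₂.arr 10 = s₁.arr 10 := hfr₂.arr 10 (by decide)
  have h21₂ : s₂.reg 21 = u := by rw [hfr₂.reg 21 (by decide)]; simpa using h21
  have h22₂ : s₂.reg 22 = v := by rw [hfr₂.reg 22 (by decide)]; simpa using h22
  have h23₂ : s₂.reg 23 = a := by rw [hfr₂.reg 23 (by decide)]; simpa using h23
  have h25₂ : s₂.reg 25 = g := by rw [hfr₂.reg 25 (by decide)]; simpa using h25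
  have hC₂ : ClassInv c s₂ a c.n := hC.congr (fun _ _ => by rw [b3]) (fun _ _ _ _ => by rw [b4])
    (fun _ _ => by rw [b5])
  refine WP.seqSetReg (.get (.adr hr₈ (.reg h22₂) (.reg h23₂) (c.fit2 hv (by omega)))
    (v := s.arr 3 (c.adr v a)) (by rw [b3])) ?_
  have hr₉ := hr₈.setR (x := 26) (s.arr 3 (c.adr v a)) (by norm_num)
  refine WP.mono (relaxClass_spec (u := u) (v := v) (a := a) (x := s.arr 3 (c.adr v a)) hr₉ hg ha hcv
    (by simpa using h21₂) (by simpa using h22₂) (by simpa using h23₂) (by simpa using h25₂) (by simp)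
    (hC₂.of_arr rfl) (hG₁.congr b9 b10) huvH hs₂ hcl₂) ?_
  rintro s₃ τ₃ hfr₃ ⟨hs₃, hcl₃, hkeep₃, hlst₃, hm₃, ho₃, ht₃⟩
  have d9 : s₃.arr 9 = s₁.arr 9 := (hfr₃.arr 9 (by decide)).trans b9
  have d10 : s₃.arr 10 = s₁.arr 10 := (hfr₃.arr 10 (by decide)).trans b10
  have hcol' : ∀ t t' : Fin c.n, (H ⊔ SimpleGraph.edge u v).Adj t t' →
      s.arr 3 (c.adr t a) + s.arr 3 (c.adr t' a) =
      s.arr 3 (c.adr u a) + s.arr 3 (c.adr v a) := by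
    rintro t t' (h | h)
    · exact hcol t t' h
    · rw [SimpleGraph.edge_adj] at h
      rcases h.1 with ⟨rfl, rfl⟩ | ⟨rfl, rfl⟩
      · rfl
      · exact add_comm _ _
  have hclosed : ∀ src, ClosedBut (H ⊔ SimpleGraph.edge u v) (row c s₃ g src)
      fun _ _ => False := by
    intro src
    by_cases h1 : s.arr 3 (c.adr src a) = s.arr 3 (c.adr u a)
    · obtain ⟨r, hr, hr'⟩ := hC.mem src src.2
      rw [h1] at hr hr'
      exact hkeep₃ src (hlst₂ src r (by simpa [a5] using hr) (by simpa [a4] using hr'))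
    · by_cases h2 : s.arr 3 (c.adr src a) = s.arr 3 (c.adr v a)
      · obtain ⟨r, hr, hr'⟩ := hC.mem src src.2
        rw [h2] at hr hr'
        exact hlst₃ src r (by simpa [b5] using hr) (by simpa [b4] using hr')
      · have hzero : ∀ t : Fin c.n, s.arr 3 (c.adr t a) = s.arr 3 (c.adr u a) ∨
            s.arr 3 (c.adr t a) = s.arr 3 (c.adr v a) → row c s₃ g src t = 0 := by
          intro t ht
          by_contra h0
          obtain ⟨p, -⟩ := hs₃ src t h0
          have := color_of_mem_support (c := fun x : Fin c.n => s.arr 3 (c.adr x a)) hcol' p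
            p.end_mem_support
          omega
        intro t t' htt
        rcases hcl₃ src t t' htt with h | ⟨rfl, rfl⟩ | ⟨rfl, rfl⟩
        · exact .inl h
        · left; rw [hzero _ (.inl rfl)]; omega
        · left; rw [hzero _ (.inr rfl)]; omega
  have hmono : ∀ x t, row c s₁ g x t ≤ row c s₃ g x t := fun x t => (hm₂ x t).trans (hm₃ x t)
  have hfull : ∀ x, row c s₁ g x x = 2 * c.k → row c s₃ g x x = 2 * c.k := fun x hx => by
    have h1 := hmono x x
    have h2 := (hs₃ x).le x
    omega
  refine ⟨⟨hG₁.congr d9 d10, hs₃, hclosed, fun t t' htt => hfull t ?_⟩, fun g' hne => ?_, ?_⟩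
  · rw [hrow₁]
    rcases htt with htt | htt
    · rw [hT.diag t t' htt]; simp
    · rw [SimpleGraph.edge_adj] at htt
      rcases htt.1 with ⟨rfl, rfl⟩ | ⟨rfl, rfl⟩ <;> simp
  · refine ⟨fun x hx => ?_, fun x hx y hy => ?_, fun x hx y hy => ?_⟩
    · rw [d9, k9 g' x hx, if_neg (fun h => hne h.1), if_neg (fun h => hne h.1)]
    · rw [d10, k10 g' x y hx hy, if_neg (fun h => hne h.1), if_neg (fun h => hne h.1)]
    · have e1 := ho₃ g' x y hx hy hne
      have e2 := ho₂ g' x y hx hy hne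
      simp only [State.setR_arr] at e1 e2
      rw [e1, e2, k11 g' x y hx hy, if_neg (fun h => hne h.1), if_neg (fun h => hne h.1)]
  · change _ + 100 * tabPot c s₁ g ≤ _ at ht₂
    change _ + 100 * tabPot c s₂ g ≤ _ at ht₃
    simp only [Expr.cost, Expr.adr_cost] at ht₂ ht₃
    omega

end Tables

section Store

variable {μ : Machine} {c : Cfg μ}

variable (c) in
/-- The colour of vertex `v` at position `a`. -/
def colOf (s : State) (v : Fin c.n) (a : ℕ) : ℕ := s.arr 3 (c.adr v a)

theorem colOf_congr {s s' : State} (h : s'.arr 3 = s.arr 3) : colOf c s' = colOf c s := by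
  funext v a
  simp only [colOf, h]

theorem CodeDone.col_lt {s : State} (h : CodeDone c s) {a : ℕ} (ha : a < c.N) (v : Fin c.n) :
    colOf c s v a < c.q := (h.cls a ha).col v v.2

theorem CodeDone.card_class_le {s : State} (h : CodeDone c s) {a : ℕ} (ha : a < c.N) (x : ℕ) :
    (Finset.univ.filter fun v => colOf c s v a = x).card ≤ c.cap := by
  by_cases hx : x < c.q
  · have h1 := (h.cls a ha).le x hx
    rw [(h.cls a ha).cnt x hx] at h1
    refine le_trans (Finset.card_le_card_of_injOn (fun v : Fin c.n => (v : ℕ)) ?_ ?_) h1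
    · intro v hv
      have hv : colOf c s v a = x := by simpa using hv
      simp only [Finset.coe_filter, Finset.mem_range, Set.mem_ofPred_eq]
      exact ⟨v.2, hv⟩
    · exact fun _ _ _ _ h => Fin.ext h
  · rw [Finset.card_eq_zero.2]
    · omega
    · refine Finset.filter_eq_empty_iff.2 fun v _ hv => hx ?_
      rw [← hv]
      exact h.col_lt ha v

theorem CodeDone.card_agree_le {s : State} (h : CodeDone c s) {u v : Fin c.n} (huv : u ≠ v) :
    ((Finset.range c.N).filter fun a => colOf c s u a = colOf c s v a).card ≤ 3 * c.L := by
  rcases lt_or_gt_of_ne (fun h => huv (Fin.ext h) : (u : ℕ) ≠ v) with h1 | h1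
  · exact h.agree v v.2 u h1
  · refine le_trans (le_of_eq ?_) (h.agree u u.2 v h1)
    congr 1
    exact Finset.filter_congr fun a _ => eq_comm

theorem CodeDone.congr {s s' : State} (h : CodeDone c s) (h3 : s'.arr 3 = s.arr 3)
    (h4 : s'.arr 4 = s.arr 4) (h5 : s'.arr 5 = s.arr 5) : CodeDone c s' where
  cls a ha := (h.cls a ha).congr (fun _ _ => by rw [h3]) (fun _ _ _ _ => by rw [h4])
    (fun _ _ => by rw [h5])
  agree := by rw [h3]; exact h.agree

theorem tabPot_le {s : State} {g B : ℕ} {H : SimpleGraph (Fin c.n)} (h : TableRep c s g H)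
    (hB : ∀ t, {x | H.Reachable t x}.ncard ≤ B) :
    tabPot c s g ≤ 2 * c.k * B * (2 * H.edgeSet.ncard + c.n) := by
  classical
  have h1 : ∀ t, ∑ src, row c s g src t ≤ 2 * c.k * B := by
    intro t
    have h2 : ∑ src, row c s g src t ≤
        ∑ src, if src ∈ (Finset.univ.filter fun x => H.Reachable t x) then 2 * c.k else 0 := by
      refine Finset.sum_le_sum fun src _ => ?_
      by_cases h0 : row c s g src t = 0
      · rw [h0]; exact Nat.zero_le _
      · obtain ⟨p, hp⟩ := h.sound src t h0
        rw [if_pos (by simpa using ⟨p.reverse⟩)]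
        omega
    refine h2.trans ?_
    rw [Finset.sum_ite_mem, Finset.univ_inter, Finset.sum_const, smul_eq_mul, mul_comm]
    refine Nat.mul_le_mul_left _ ((hB t).trans' (le_of_eq ?_))
    rw [← Set.ncard_coe_finset]
    congr 1
    ext x
    simp
  calc tabPot c s g = ∑ t, (∑ src, row c s g src t) * (degOf c s g t + 1) := by
        unfold tabPot rowPot
        rw [Finset.sum_comm]
        exact Finset.sum_congr rfl fun t _ => (Finset.sum_mul _ _ _).symm
    _ ≤ ∑ t, 2 * c.k * B * (degOf c s g t + 1) :=
        Finset.sum_le_sum fun t _ => Nat.mul_le_mul_right _ (h1 t)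
    _ = 2 * c.k * B * (2 * H.edgeSet.ncard + c.n) := by
        rw [← Finset.mul_sum, Finset.sum_add_distrib, h.graph.sum]
        simp

variable (c) in
/-- The indices of the tables in use. -/
def idx : Finset (ℕ × ℕ) := Finset.range c.N ×ˢ Finset.range (2 * c.q)

theorem mem_idx {p : ℕ × ℕ} : p ∈ idx c ↔ p.1 < c.N ∧ p.2 < 2 * c.q := by
  simp [idx]

theorem card_idx : (idx c).card = c.N * (2 * c.q) := by simp [idx]

variable (c) in
/-- The total potential of all tables. -/
def totalPot (s : State) : ℕ := ∑ p ∈ idx c, tabPot c s (c.adr p.1 p.2)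

variable (c) in
/-- The total number of edges in all graphs. -/
noncomputable def edgeCount (Hg : ℕ → ℕ → SimpleGraph (Fin c.n)) : ℕ :=
  ∑ p ∈ idx c, (Hg p.1 p.2).edgeSet.ncard

variable (c) in
/-- All tables represent their graphs. -/
def Store (s : State) (Hg : ℕ → ℕ → SimpleGraph (Fin c.n)) : Prop :=
  ∀ p ∈ idx c, TableRep c s (c.adr p.1 p.2) (Hg p.1 p.2)

theorem Store.congr {s s' : State} {Hg : ℕ → ℕ → SimpleGraph (Fin c.n)} (h : Store c s Hg)
    (h9 : s'.arr 9 = s.arr 9) (h10 : s'.arr 10 = s.arr 10) (h11 : s'.arr 11 = s.arr 11) :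
    Store c s' Hg := fun p hp => (h p hp).congr (.of_arr h9 h10 h11)

theorem totalPot_congr {s s' : State}
    (h9 : s'.arr 9 = s.arr 9) (h10 : s'.arr 10 = s.arr 10) (h11 : s'.arr 11 = s.arr 11) :
    totalPot c s' = totalPot c s :=
  Finset.sum_congr rfl fun _ _ => (SameTable.of_arr h9 h10 h11).tabPot_eq

theorem idx_adr_lt {p : ℕ × ℕ} (hp : p ∈ idx c) : c.adr p.1 p.2 < c.X ^ 2 := by
  rw [mem_idx] at hp
  have := c.N_lt
  have := c.two_q_lt
  exact c.adr_lt (by omega) (by omega)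

theorem idx_adr_inj {p p' : ℕ × ℕ} (hp : p ∈ idx c) (hp' : p' ∈ idx c) :
    c.adr p.1 p.2 = c.adr p'.1 p'.2 ↔ p = p' := by
  rw [mem_idx] at hp hp'
  have := c.two_q_lt
  rw [c.adr_inj (by omega) (by omega), Prod.ext_iff]

theorem sum_add_of_eq_off {ι : Type*} [DecidableEq ι] {S : Finset ι} {F F' : ι → ℕ} {i : ι}
    (hi : i ∈ S) (h : ∀ j ∈ S, j ≠ i → F' j = F j) :
    ∑ j ∈ S, F j + F' i = ∑ j ∈ S, F' j + F i := by
  rw [← Finset.add_sum_erase S F hi, ← Finset.add_sum_erase S F' hi,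
    Finset.sum_congr rfl fun j hj => (h j (Finset.mem_of_mem_erase hj) (Finset.ne_of_mem_erase hj))]
  ring

theorem store_empty {s : State} (hz : ∀ i, s.arr 9 i = 0 ∧ s.arr 11 i = 0) :
    Store c s fun _ _ => ⊥ := by
  intro p _
  have hd : ∀ t, degOf c s (c.adr p.1 p.2) t = 0 := fun t => (hz _).1
  have hrow : ∀ t t', row c s (c.adr p.1 p.2) t t' = 0 := fun t t' => (hz _).2
  refine ⟨⟨fun t r hr => ?_, fun _ _ h => absurd h id, by simp [hd]⟩, fun src t h => ?_,
    fun src t t' h => absurd h id, fun _ _ h => absurd h id⟩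
  · rw [hd] at hr; omega
  · exact absurd (hrow _ _) h

variable (c) in
/-- The positions at which `u` and `v` are far apart. -/
def farSet (s : State) (u v : Fin c.n) : Finset ℕ :=
  (Finset.range c.N).filter fun a => row c s (c.adr a (colOf c s u a + colOf c s v a)) u v = 0

theorem farSet_congr {s s' : State} (h3 : s'.arr 3 = s.arr 3) (h11 : s'.arr 11 = s.arr 11)
    (u v : Fin c.n) : farSet c s' u v = farSet c s u v :=
  Finset.filter_congr fun a _ => by simp only [colOf, row, h3, h11]

theorem CodeDone.mem_idx {s : State} (h : CodeDone c s) {a : ℕ} (ha : a < c.N) (u v : Fin c.n) :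
    (a, colOf c s u a + colOf c s v a) ∈ idx c := by
  have h1 := h.col_lt ha u
  have h2 := h.col_lt ha v
  exact FTSpanner.mem_idx.2 ⟨ha, by dsimp only; omega⟩

theorem edgeCount_insertAt {col : Fin c.n → ℕ → ℕ} {Hg : ℕ → ℕ → SimpleGraph (Fin c.n)}
    {u v : Fin c.n} (huv : u ≠ v) {A : Finset ℕ}
    (hA : ∀ a ∈ A, (a, col u a + col v a) ∈ idx c ∧ ¬ (Hg a (col u a + col v a)).Adj u v) :
    edgeCount c (insertAt col Hg u v A) = edgeCount c Hg + A.card := by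
  have h1 : ∀ p : ℕ × ℕ, (insertAt col Hg u v A p.1 p.2).edgeSet.ncard =
      (Hg p.1 p.2).edgeSet.ncard + if p ∈ A.image (fun a => (a, col u a + col v a)) then 1 else 0 := by
    rintro ⟨a, σ⟩
    unfold insertAt
    by_cases h : a ∈ A ∧ σ = col u a + col v a
    · obtain ⟨ha, rfl⟩ := h
      rw [if_pos ⟨ha, rfl⟩, if_pos (Finset.mem_image_of_mem _ ha),
        ncard_edgeSet_sup_edge huv (hA a ha).2]
    · rw [if_neg h, if_neg]
      · rfl
      · simp only [Finset.mem_image, Prod.mk.injEq, not_exists, not_and]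
        rintro a' ha' rfl rfl
        exact h ⟨ha', rfl⟩
  unfold edgeCount
  rw [Finset.sum_congr rfl fun p _ => h1 p, Finset.sum_add_distrib, Finset.sum_ite_mem,
    Finset.inter_eq_right.2]
  · rw [Finset.sum_const, smul_eq_mul, mul_one, Finset.card_image_of_injective]
    exact fun a b h => congrArg Prod.fst h
  · intro p hp
    obtain ⟨a, ha, rfl⟩ := Finset.mem_image.1 hp
    exact (hA a ha).1

theorem insertAt_insert {col : Fin c.n → ℕ → ℕ} {Hg : ℕ → ℕ → SimpleGraph (Fin c.n)}
    {u v : Fin c.n} {A : Finset ℕ} {b : ℕ} (hb : b ∉ A) (a σ : ℕ) :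
    insertAt col Hg u v (insert b A) a σ =
      if a = b ∧ σ = col u b + col v b then insertAt col Hg u v A a σ ⊔ SimpleGraph.edge u v
      else insertAt col Hg u v A a σ := by
  unfold insertAt
  by_cases h : a = b
  · subst h
    simp only [Finset.mem_insert_self, true_and, hb, false_and, if_false]
  · simp only [Finset.mem_insert, h, false_or, false_and, if_false]

end Store

/-! ## The main loop -/

open FTSpanner.Expr in
/-- The graph at position `23` that is responsible for the edge between `21` and `22`. -/
def graphExpr : Expr :=
  adr (reg 23) (bin .add (get 3 (adr (reg 21) (reg 23))) (get 3 (adr (reg 22) (reg 23))))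

open FTSpanner.Expr in
/-- Counts the positions at which `21` and `22` are far apart. -/
def countFar : Cmd :=
  .seq (.setReg 24 (lit 0)) <|
  .forLt 23 (reg 8) <|
    .seq (.setReg 25 graphExpr) <|
    .ite (get 11 (adr (adr (reg 25) (reg 21)) (reg 22))) .skip
      (.setReg 24 (bin .add (reg 24) (lit 1)))

open FTSpanner.Expr in
/-- Inserts the edge between `21` and `22` at position `23` if these are far apart. -/
def insertIfFar : Cmd :=
  .seq (.setReg 25 graphExpr) <|
  .ite (get 11 (adr (adr (reg 25) (reg 21)) (reg 22))) .skip insertEdge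

/-- Inserts the edge between `21` and `22` wherever these are far apart. -/
def insertFar : Cmd := .forLt 23 (.reg 8) insertIfFar

open FTSpanner.Expr in
/-- Processes the lightest remaining edge. -/
def processEdge : Cmd :=
  .seq (.setReg 20 (bin .sub (get 8 (lit 1)) (lit 1))) <|
  .seq treePop <|
  .seq (.setReg 21 (get 0 (reg 20))) <|
  .seq (.setReg 22 (get 1 (reg 20))) <|
  .seq countFar <|
  .ite (bin .lt (bin .mul (lit 2) (reg 24)) (reg 8)) .skip
    (.seq (.setArr 2 (reg 20) (lit 1)) insertFar)

/-- The greedy algorithm. -/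
def mainLoop : Cmd := .forLt 34 (.reg 1) processEdge

section Main

variable {μ : Machine} {c : Cfg μ}

theorem ev_graphExpr {s : State} {u v : Fin c.n} {a : ℕ} (hr : c.Regs s) (hC : CodeDone c s)
    (ha : a < c.N) (h21 : s.reg 21 = u) (h22 : s.reg 22 = v) (h23 : s.reg 23 = a) :
    Ev μ s graphExpr (c.adr a (colOf c s u a + colOf c s v a)) := by
  have hX := c.sq_X_le
  have hN := c.N_lt
  have hq := c.two_q_lt
  have h1 := hC.col_lt ha u
  have h2 := hC.col_lt ha v
  exact .adr hr (.reg h23) (.add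
    (.get (.adr hr (.reg h21) (.reg h23) (c.fit2 (Fin.lt_X c u) (by omega))) rfl)
    (.get (.adr hr (.reg h22) (.reg h23) (c.fit2 (Fin.lt_X c v) (by omega))) rfl) (by
      show colOf c s u a + colOf c s v a < _; omega))
    (c.fit2 (by omega) (by show colOf c s u a + colOf c s v a < _; omega))

theorem ev_row {s : State} {u v : Fin c.n} {g : ℕ} (hr : c.Regs s) (hg : g < c.X ^ 2)
    (h21 : s.reg 21 = u) (h22 : s.reg 22 = v) (h25 : s.reg 25 = g) :
    Ev μ s (.get 11 (.adr (.adr (.reg 25) (.reg 21)) (.reg 22))) (row c s g u v) :=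
  .get (.adr hr (.adr hr (.reg h25) (.reg h21) (c.fit3 hg (Fin.lt_X c u))) (.reg h22)
    (c.fit4 (c.adr_lt3 hg (Fin.lt_X c u)) (Fin.lt_X c v))) rfl

theorem filter_lt_succ (A : Finset ℕ) (a : ℕ) : A.filter (· < a + 1) =
    if a ∈ A then insert a (A.filter (· < a)) else A.filter (· < a) := by
  ext b
  split_ifs with h <;>
  · simp only [Finset.mem_filter, Finset.mem_insert, Nat.lt_succ_iff_lt_or_eq]
    grind

theorem countFar_spec {s : State} {u v : Fin c.n} {τ : ℕ} (hr : c.Regs s) (hC : CodeDone c s)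
    (h21 : s.reg 21 = u) (h22 : s.reg 22 = v) :
    WP μ countFar (fun s' τ' => s'.reg 24 = (farSet c s u v).card ∧ τ' ≤ τ + 60 * c.N + 20) s τ := by
  have hX := c.sq_X_le
  have hN := c.N_lt
  refine WP.seqSetReg (.lit (by omega)) ?_
  refine WP.forLt c.N (fun j s' τ' => s'.reg 24 = ((farSet c s u v).filter (· < j)).card ∧
    τ' ≤ τ + 60 * j + 10) c.one_lt (by omega) ?_ ?_ ?_ ?_
  · simp [Expr.cost]
  · intro j s' τ' hfr _ _ _
    exact .reg ((hr.setR (x := 24) 0 (by norm_num)).frame hfr (by decide)).r8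
  · rintro a s' τ' hfr ha haN ⟨h1, ht⟩
    have hr' : c.Regs s' := (hr.setR (x := 24) 0 (by norm_num)).frame hfr (by decide)
    have h21' : s'.reg 21 = u := by rw [hfr.reg 21 (by decide)]; simpa using h21
    have h22' : s'.reg 22 = v := by rw [hfr.reg 22 (by decide)]; simpa using h22
    have e3 : s'.arr 3 = s.arr 3 := hfr.arr 3 (by decide)
    have e4 : s'.arr 4 = s.arr 4 := hfr.arr 4 (by decide)
    have e5 : s'.arr 5 = s.arr 5 := hfr.arr 5 (by decide)
    have e11 : s'.arr 11 = s.arr 11 := hfr.arr 11 (by decide)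
    have hC' := hC.congr e3 e4 e5
    have hg := idx_adr_lt (hC'.mem_idx haN u v)
    have hrw : row c s' (c.adr a (colOf c s' u a + colOf c s' v a)) u v = 0 ↔
        a ∈ farSet c s u v := by
      rw [← farSet_congr e3 e11]
      simp [farSet, haN]
    have hcard : ((farSet c s u v).filter (· < a)).card ≤ a := by
      calc _ ≤ (Finset.range a).card :=
            Finset.card_le_card fun b hb => by simp at hb ⊢; exact hb.2
        _ = a := Finset.card_range a
    refine WP.seqSetReg (ev_graphExpr hr' hC' haN h21' h22' ha) ?_
    refine WP.ite (ev_row (hr'.setR (x := 25) _ (by norm_num)) hg (by simpa using h21')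
      (by simpa using h22') (by simp)) (fun h => ?_) (fun h => ?_)
    · have h : row c s' (c.adr a (colOf c s' u a + colOf c s' v a)) u v ≠ 0 := h
      rw [ne_eq, hrw] at h
      refine WP.skip ⟨by simpa using ha, ?_, ?_⟩
      · rw [filter_lt_succ, if_neg h]; simpa using h1
      · simp only [graphExpr, Expr.cost, Expr.adr_cost]; omega
    · have h : row c s' (c.adr a (colOf c s' u a + colOf c s' v a)) u v = 0 := h
      rw [hrw] at h
      refine WP.setReg (.add (.reg (by simpa using h1)) (.lit (by omega)) (by omega))
        ⟨by simpa using ha, ?_, ?_⟩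
      · rw [filter_lt_succ, if_pos h, Finset.card_insert_of_notMem (by simp)]; simp
      · simp only [graphExpr, Expr.cost, Expr.adr_cost]; omega
  · rintro s' τ' hfr _ ⟨h1, ht⟩
    refine ⟨?_, ?_⟩
    · rw [h1, Finset.filter_true_of_mem]
      intro b hb
      simp [farSet] at hb
      exact hb.1
    · simp only [Expr.cost]; omega

end Main

section Main

variable {μ : Machine} {c : Cfg μ}

theorem totalPot_setR (s : State) (x v : ℕ) : totalPot c (s.setR x v) = totalPot c s :=
  totalPot_congr rfl rfl rfl

theorem totalPot_add {s s' : State} {p₀ : ℕ × ℕ} (h₀ : p₀ ∈ idx c)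
    (h : ∀ p ∈ idx c, p ≠ p₀ → SameTable c s s' (c.adr p.1 p.2)) :
    totalPot c s + tabPot c s' (c.adr p₀.1 p₀.2) =
      totalPot c s' + tabPot c s (c.adr p₀.1 p₀.2) := by
  have h1 : ∀ p ∈ idx c, p ≠ p₀ → tabPot c s' (c.adr p.1 p.2) = tabPot c s (c.adr p.1 p.2) :=
    fun p hp hne => (h p hp hne).tabPot_eq
  generalize hF : (fun p : ℕ × ℕ => tabPot c s (c.adr p.1 p.2)) = F
  generalize hF' : (fun p : ℕ × ℕ => tabPot c s' (c.adr p.1 p.2)) = F'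
  have h2 : ∀ p, tabPot c s (c.adr p.1 p.2) = F p := fun p => congrFun hF p
  have h3 : ∀ p, tabPot c s' (c.adr p.1 p.2) = F' p := fun p => congrFun hF' p
  simp only [totalPot, h2, h3] at h1 ⊢
  exact sum_add_of_eq_off h₀ h1

theorem insertIfFar_spec {s : State} {u v : Fin c.n} {a σ τ : ℕ} {H : SimpleGraph (Fin c.n)}
    (hr : c.Regs s) (hC : CodeDone c s) (ha : a < c.N) (h21 : s.reg 21 = u) (h22 : s.reg 22 = v)
    (h23 : s.reg 23 = a) (huv : u ≠ v) (hσ : σ = colOf c s u a + colOf c s v a)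
    (hT : TableRep c s (c.adr a σ) H)
    (hcol : ∀ t t', H.Adj t t' → colOf c s t a + colOf c s t' a = σ) :
    WP μ insertIfFar (fun s' τ' =>
      (row c s (c.adr a σ) u v = 0 → TableRep c s' (c.adr a σ) (H ⊔ SimpleGraph.edge u v) ∧
        τ' + 100 * tabPot c s (c.adr a σ) ≤
          τ + 100 * tabPot c s' (c.adr a σ) + 500 * c.cap + 340) ∧
      (row c s (c.adr a σ) u v ≠ 0 → TableRep c s' (c.adr a σ) H ∧
        τ' + 100 * tabPot c s (c.adr a σ) ≤ τ + 100 * tabPot c s' (c.adr a σ) + 40) ∧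
      ∀ g, g ≠ c.adr a σ → SameTable c s s' g) s τ := by
  have hk := c.hk
  have hidx := hC.mem_idx ha u v
  have hg := idx_adr_lt hidx
  have eG := ev_graphExpr hr hC ha h21 h22 h23
  dsimp only at hg
  rw [← hσ] at eG hidx hg
  have hset : ∀ g, SameTable c s (s.setR 25 (c.adr a σ)) g := fun g => .of_arr rfl rfl rfl
  refine WP.seqSetReg eG ?_
  have hr' := hr.setR (x := 25) (c.adr a σ) (by norm_num)
  refine WP.ite (ev_row hr' hg (by simpa using h21) (by simpa using h22) (by simp))
    (fun h => ?_) (fun h => ?_)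
  · have h : row c s (c.adr a σ) u v ≠ 0 := h
    refine WP.skip ⟨fun h0 => absurd h0 h, fun _ => ⟨hT.congr (hset _), ?_⟩, fun g _ => hset g⟩
    rw [(hset _).tabPot_eq]
    simp only [graphExpr, Expr.cost, Expr.adr_cost]; omega
  · have h : row c s (c.adr a σ) u v = 0 := h
    have hadj : ¬ H.Adj u v := fun hadj => by
      have := hT.far huv h (SimpleGraph.Walk.cons hadj .nil)
      simp at this
      omega
    refine WP.mono (insertEdge_spec (u := u) (v := v) (a := a) hr' hg ha (by simpa using h21)
      (by simpa using h22) (by simpa using h23) (by simp) ((hC.cls a ha).of_arr rfl)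
      (hT.congr (hset _)) huv hadj fun t t' htt => (hcol t t' htt).trans hσ) ?_
    rintro s₂ τ₂ hfr₂ ⟨hnew, hold, ht₂⟩
    refine ⟨fun _ => ⟨hnew, ?_⟩, fun h0 => absurd h h0, fun g hne => (hset g).trans (hold g hne)⟩
    rw [(hset _).tabPot_eq] at ht₂
    simp only [graphExpr, Expr.cost, Expr.adr_cost] at ht₂
    omega

theorem insertFar_spec {s : State} {u v : Fin c.n} {τ : ℕ} {Hg : ℕ → ℕ → SimpleGraph (Fin c.n)}
    (hr : c.Regs s) (hC : CodeDone c s) (h21 : s.reg 21 = u) (h22 : s.reg 22 = v) (huv : u ≠ v)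
    (hS : Store c s Hg)
    (hcol : ∀ a σ t t', (Hg a σ).Adj t t' → colOf c s t a + colOf c s t' a = σ) :
    WP μ insertFar (fun s' τ' => Store c s' (insertAt (colOf c s) Hg u v (farSet c s u v)) ∧
      τ' + 100 * totalPot c s ≤ τ + 60 * c.N + 10 + 100 * totalPot c s' +
        (500 * c.cap + 300) * (farSet c s u v).card) s τ := by
  have hX := c.sq_X_le
  have hN := c.N_lt
  obtain ⟨K, hK⟩ : ∃ K, K = 500 * c.cap + 300 := ⟨_, rfl⟩
  rw [← hK]
  refine WP.forLt c.N (fun j s' τ' =>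
    Store c s' (insertAt (colOf c s) Hg u v ((farSet c s u v).filter (· < j))) ∧
    (∀ p ∈ idx c, j ≤ p.1 → SameTable c s s' (c.adr p.1 p.2)) ∧
    τ' + 100 * totalPot c s ≤ τ + 60 * j + 2 + 100 * totalPot c s' +
      K * ((farSet c s u v).filter (· < j)).card) c.one_lt (by omega) ?_ ?_ ?_ ?_
  · refine ⟨fun p hp => ?_, fun p hp _ => .of_arr rfl rfl rfl, ?_⟩
    · have := (hS.congr (s' := s.setR 23 0) rfl rfl rfl) p hp
      simpa [insertAt] using this
    · rw [totalPot_setR]; simp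
  · intro j s' τ' hfr _ _ _
    exact .reg (hr.frame hfr (by decide)).r8
  · rintro a s' τ' hfr ha haN ⟨h1, h2, ht⟩
    have e3 : s'.arr 3 = s.arr 3 := hfr.arr 3 (by decide)
    have hC' := hC.congr e3 (hfr.arr 4 (by decide)) (hfr.arr 5 (by decide))
    have hidx := hC.mem_idx haN u v
    obtain ⟨σ, hσ⟩ : ∃ σ, σ = colOf c s u a + colOf c s v a := ⟨_, rfl⟩
    rw [← hσ] at hidx
    have hsame : insertAt (colOf c s) Hg u v ((farSet c s u v).filter (· < a)) a σ = Hg a σ := by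
      simp [insertAt]
    have hrep := h1 _ hidx
    dsimp only at hrep
    rw [hsame] at hrep
    refine WP.mono (insertIfFar_spec (hr.frame hfr (by decide)) hC' haN
      ((hfr.reg 21 (by decide)).trans h21) ((hfr.reg 22 (by decide)).trans h22) ha huv
      (by rw [colOf_congr e3]; exact hσ) hrep (by rw [colOf_congr e3]; exact hcol a σ)) ?_
    rintro s₂ τ₂ hfr₂ ⟨hyes, hno, hold⟩
    have hoff : ∀ p ∈ idx c, p ≠ (a, σ) → SameTable c s' s₂ (c.adr p.1 p.2) := fun p hp hne =>
      hold _ fun hh => hne ((idx_adr_inj hp hidx).1 hh)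
    have hpot := totalPot_add hidx hoff
    dsimp only at hpot
    have hset : ∀ g, SameTable c s₂ (s₂.setR 23 (a + 1)) g := fun g => .of_arr rfl rfl rfl
    have hrow : row c s' (c.adr a σ) u v = 0 ↔ a ∈ farSet c s u v := by
      rw [(h2 _ hidx le_rfl).row_eq u, hσ]
      simp [farSet, haN]
    refine ⟨(hfr₂.reg 23 (by decide)).trans ha, fun p hp => TableRep.congr ?_ (hset _),
      fun p hp hle => ((h2 p hp (by omega)).trans (hoff p hp ?_)).trans (hset _), ?_⟩
    · by_cases hpa : p = (a, σ)
      · subst hpa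
        rw [filter_lt_succ]
        split_ifs with h
        · rw [insertAt_insert (by simp), if_pos ⟨rfl, hσ⟩, hsame]
          exact (hyes (hrow.2 h)).1
        · rw [hsame]
          exact (hno (mt hrow.1 h)).1
      · have hins : insertAt (colOf c s) Hg u v ((farSet c s u v).filter (· < a + 1)) p.1 p.2 =
            insertAt (colOf c s) Hg u v ((farSet c s u v).filter (· < a)) p.1 p.2 := by
          rw [filter_lt_succ]
          split_ifs
          · rw [insertAt_insert (by simp),
              if_neg fun hh => hpa (Prod.ext hh.1 (hh.2.trans hσ.symm))]
          · rfl
        rw [hins]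
        exact (h1 p hp).congr (hoff p hp hpa)
    · rintro rfl
      simp at hle
    · rw [totalPot_setR, filter_lt_succ]
      split_ifs with h
      · have h3 := (hyes (hrow.2 h)).2
        rw [Finset.card_insert_of_notMem (by simp), mul_add K, mul_one]
        simp only [Expr.cost] at h3 ⊢
        omega
      · have h3 := (hno (mt hrow.1 h)).2
        simp only [Expr.cost] at h3 ⊢
        omega
  · rintro s' τ' hfr _ ⟨h1, -, ht⟩
    rw [Finset.filter_true_of_mem] at h1 ht
    · refine ⟨h1, ?_⟩
      simp only [Expr.cost]; omega
    all_goals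
      intro b hb
      simp [farSet] at hb
      exact hb.1

variable (c) in
/-- The state of the main loop. -/
structure MainInv (e : Fin c.m → Fin c.n × Fin c.n) (w : Sym2 (Fin c.n) → ℝ≥0) (s : State)
    (Hg : ℕ → ℕ → SimpleGraph (Fin c.n)) (proc acc : Finset (Fin c.m)) : Prop where
  code : CodeDone c s
  tree : TreeInv c s
  leaf : ∀ i : Fin c.m, s.arr 8 (c.m + i) = 0 ↔ i ∈ proc
  out : ∀ i : Fin c.m, s.arr 2 i ≠ 0 ↔ i ∈ acc
  fst : ∀ i : Fin c.m, s.arr 0 i = (e i).1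
  snd : ∀ i : Fin c.m, s.arr 1 i = (e i).2
  span : SpannerInv e w (colOf c s) c.N c.k Hg proc acc
  store : Store c s Hg
  count : c.N * acc.card ≤ 2 * edgeCount c Hg

theorem MainInv.of_arr {e : Fin c.m → Fin c.n × Fin c.n} {w : Sym2 (Fin c.n) → ℝ≥0} {s s' : State}
    {Hg : ℕ → ℕ → SimpleGraph (Fin c.n)} {proc acc : Finset (Fin c.m)}
    (h : MainInv c e w s Hg proc acc) (hA : s'.arr = s.arr) : MainInv c e w s' Hg proc acc where
  code := h.code.congr (by rw [hA]) (by rw [hA]) (by rw [hA])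
  tree := ⟨by rw [hA]; exact h.tree.leaf, by rw [hA]; exact h.tree.node,
    by rw [hA]; exact h.tree.bound⟩
  leaf := by rw [hA]; exact h.leaf
  out := by rw [hA]; exact h.out
  fst := by rw [hA]; exact h.fst
  snd := by rw [hA]; exact h.snd
  span := by rw [colOf_congr (s := s) (by rw [hA])]; exact h.span
  store := h.store.congr (by rw [hA]) (by rw [hA]) (by rw [hA])
  count := h.count

/-- The root of the tree is the lightest edge that has not been processed. -/
theorem MainInv.exists_next {e : Fin c.m → Fin c.n × Fin c.n} {w : Sym2 (Fin c.n) → ℝ≥0}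
    {s : State} {Hg : ℕ → ℕ → SimpleGraph (Fin c.n)} {proc acc : Finset (Fin c.m)}
    (h : MainInv c e w s Hg proc acc) (hwt : ∀ i : Fin c.m, μ.wt i = w s((e i).1, (e i).2))
    (hlt : proc.card < c.m) : ∃ i, i ∉ proc ∧ s.arr 8 1 = i + 1 ∧
      ∀ j ∉ proc, w s((e i).1, (e i).2) ≤ w s((e j).1, (e j).2) := by
  have hroot : ∀ j ∉ proc, s.arr 8 1 ≠ 0 ∧ μ.wt (s.arr 8 1 - 1) ≤ μ.wt j := by
    intro j hj
    have h1 := (h.leaf j).not.2 hj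
    have h2 := tree_root_le h.tree.node (c.m + j) (by omega) (by omega) h1
    rw [(h.tree.leaf j j.2).resolve_right h1] at h2
    simpa using h2
  obtain ⟨j, hj⟩ : ∃ j, j ∉ proc := by
    by_contra hcon
    push Not at hcon
    have := Finset.card_le_card (show Finset.univ ⊆ proc from fun x _ => hcon x)
    simp at this
    omega
  obtain ⟨i, him, hi1, hi2⟩ := tree_active h.tree.leaf h.tree.node (2 * c.m - 1) 1 (by omega)
    le_rfl (by omega) (hroot j hj).1
  refine ⟨⟨i, him⟩, ?_, hi1, fun j hj => ?_⟩
  · rw [← h.leaf]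
    dsimp only
    omega
  · have h3 := (hroot j hj).2
    rw [hi1, Nat.add_sub_cancel, hwt] at h3
    exact (hwt ⟨i, him⟩) ▸ h3

end Main

section Main

variable {μ : Machine} {c : Cfg μ} {e : Fin c.m → Fin c.n × Fin c.n} {w : Sym2 (Fin c.n) → ℝ≥0}

theorem two_mul_card_range_sdiff {N : ℕ} {A : Finset ℕ} (hA : A ⊆ Finset.range N)
    (h : 2 * A.card < N) : N < 2 * (Finset.range N \ A).card := by
  rw [Finset.card_sdiff_of_subset hA, Finset.card_range]
  omega

theorem processEdge_spec {s : State} {τ : ℕ} {Hg : ℕ → ℕ → SimpleGraph (Fin c.n)}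
    {proc acc : Finset (Fin c.m)} (hr : c.Regs s) (h : MainInv c e w s Hg proc acc)
    (hwt : ∀ i : Fin c.m, μ.wt i = w s((e i).1, (e i).2)) (hne : ∀ i, (e i).1 ≠ (e i).2)
    (hlt : proc.card < c.m) :
    WP μ processEdge (fun s' τ' => ∃ Hg' proc' acc', MainInv c e w s' Hg' proc' acc' ∧
      proc'.card = proc.card + 1 ∧
      τ' + 100 * totalPot c s + (500 * c.cap + 300) * edgeCount c Hg ≤
        τ + 120 * c.N + 120 * c.L + 150 + 100 * totalPot c s' +
          (500 * c.cap + 300) * edgeCount c Hg') s τ := by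
  have hX := c.sq_X_le
  have hN := c.N_lt
  have hk := c.hk
  have hm := c.m_lt
  obtain ⟨K, hK⟩ : ∃ K, K = 500 * c.cap + 300 := ⟨_, rfl⟩
  rw [← hK]
  obtain ⟨i, hi, hroot, hmin⟩ := h.exists_next hwt hlt
  refine WP.seqSetReg (v := i) ((Ev.sub (.get (.lit (by omega)) hroot) (.lit (by omega))
    (by omega)).congr (by omega)) (WP.seq ?_)
  have hr₁ := hr.setR (x := 20) i (by norm_num)
  refine WP.mono (treePop_spec hr₁ (by simp) i.2 (h.of_arr (s' := s.setR 20 i) rfl).tree) ?_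
  rintro s₁ τ₁ hfr₁ ⟨htree, hleaf, ht₁⟩
  have hr₂ : c.Regs s₁ := hr₁.frame hfr₁ (by decide)
  have h20 : s₁.reg 20 = i := by rw [hfr₁.reg 20 (by decide)]; simp
  have a0 : s₁.arr 0 = s.arr 0 := hfr₁.arr 0 (by decide)
  have a1 : s₁.arr 1 = s.arr 1 := hfr₁.arr 1 (by decide)
  have a2 : s₁.arr 2 = s.arr 2 := hfr₁.arr 2 (by decide)
  have a3 : s₁.arr 3 = s.arr 3 := hfr₁.arr 3 (by decide)
  have a4 : s₁.arr 4 = s.arr 4 := hfr₁.arr 4 (by decide)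
  have a5 : s₁.arr 5 = s.arr 5 := hfr₁.arr 5 (by decide)
  have a9 : s₁.arr 9 = s.arr 9 := hfr₁.arr 9 (by decide)
  have a10 : s₁.arr 10 = s.arr 10 := hfr₁.arr 10 (by decide)
  have a11 : s₁.arr 11 = s.arr 11 := hfr₁.arr 11 (by decide)
  refine WP.seqSetReg (v := (e i).1) (.get (.reg h20) (by rw [a0]; exact h.fst i)) ?_
  refine WP.seqSetReg (v := (e i).2) (.get (.reg (v := i) (by simpa using h20))
    (by simp only [State.setR_arr, a1]; exact h.snd i)) (WP.seq ?_)
  have hr₃ := (hr₂.setR (x := 21) (e i).1 (by norm_num)).setR (x := 22) (e i).2 (by norm_num)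
  have hC₁ : CodeDone c ((s₁.setR 21 (e i).1).setR 22 (e i).2) := h.code.congr a3 a4 a5
  refine WP.mono (countFar_spec (u := (e i).1) (v := (e i).2) hr₃ hC₁ (by simp) (by simp)) ?_
  rintro s₂ τ₂ hfr₂ ⟨h24, ht₂⟩
  have hr₄ : c.Regs s₂ := hr₃.frame hfr₂ (by decide)
  have hA₂ : ∀ a, s₂.arr a = s₁.arr a := fun a => hfr₂.arr a (by simp [countFar, Cmd.forLt, Cmd.arrs])
  have h20₂ : s₂.reg 20 = i := by rw [hfr₂.reg 20 (by decide)]; simpa using h20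
  have h21₂ : s₂.reg 21 = (e i).1 := by rw [hfr₂.reg 21 (by decide)]; simp
  have h22₂ : s₂.reg 22 = (e i).2 := by rw [hfr₂.reg 22 (by decide)]; simp
  have hcol : colOf c s₂ = colOf c s := colOf_congr (by rw [hA₂, a3])
  change s₂.reg 24 = (farSet c s₁ _ _).card at h24
  rw [farSet_congr a3 a11] at h24
  have hfar : farSet c s₂ (e i).1 (e i).2 = farSet c s (e i).1 (e i).2 :=
    farSet_congr (by rw [hA₂, a3]) (by rw [hA₂, a11]) _ _
  generalize hA : farSet c s (e i).1 (e i).2 = A at h24 hfar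
  have hAN : A ⊆ Finset.range c.N := by rw [← hA]; exact Finset.filter_subset _ _
  have hAcard : A.card ≤ c.N := by simpa using Finset.card_le_card hAN
  have hC₂ : CodeDone c s₂ := h.code.congr (by rw [hA₂, a3]) (by rw [hA₂, a4]) (by rw [hA₂, a5])
  have hS₂ : Store c s₂ Hg := h.store.congr (by rw [hA₂, a9]) (by rw [hA₂, a10]) (by rw [hA₂, a11])
  have hpot₂ : totalPot c s₂ = totalPot c s :=
    totalPot_congr (by rw [hA₂, a9]) (by rw [hA₂, a10]) (by rw [hA₂, a11])
  have htree₂ : TreeInv c s₂ := ⟨by rw [hA₂]; exact htree.leaf, by rw [hA₂]; exact htree.node,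
    by rw [hA₂]; exact htree.bound⟩
  have hleaf₂ : ∀ j : Fin c.m, s₂.arr 8 (c.m + j) = 0 ↔ j ∈ insert i proc := by
    intro j
    rw [hA₂, hleaf j j.2, Finset.mem_insert, ← h.leaf j, ← Fin.val_inj]
    split_ifs with hji <;> simp [hji]
  have hproc : (insert i proc).card = proc.card + 1 := Finset.card_insert_of_notMem hi
  have hiacc : i ∉ acc := fun hh => hi (h.span.acc_sub hh)
  have hrow : ∀ a ∈ Finset.range c.N,
      (a ∈ A ↔ row c s (c.adr a (colOf c s (e i).1 a + colOf c s (e i).2 a)) (e i).1 (e i).2 = 0) := by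
    intro a ha
    rw [← hA]
    simp only [farSet, Finset.mem_filter, ha, true_and]
  have hrep : ∀ a ∈ Finset.range c.N, TableRep c s
      (c.adr a (colOf c s (e i).1 a + colOf c s (e i).2 a))
      (Hg a (colOf c s (e i).1 a + colOf c s (e i).2 a)) := fun a ha =>
    h.store _ (h.code.mem_idx (Finset.mem_range.1 ha) _ _)
  refine WP.iteLt (.mul (.lit (by omega)) (.reg h24) (by omega)) (.reg hr₄.r8) c.one_lt
    (fun hlt => ?_) (fun hge => ?_)
  · refine WP.skip ⟨Hg, insert i proc, acc, ⟨hC₂, htree₂, hleaf₂, ?_, ?_, ?_, ?_, hS₂, h.count⟩, hproc, ?_⟩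
    · rw [hA₂, a2]; exact h.out
    · rw [hA₂, a0]; exact h.fst
    · rw [hA₂, a1]; exact h.snd
    · rw [hcol]
      refine h.span.reject hi hmin (A := Finset.range c.N \ A) Finset.sdiff_subset
        (two_mul_card_range_sdiff hAN hlt) fun a ha => ?_
      rw [Finset.mem_sdiff] at ha
      exact (hrep a ha.1).near (mt (hrow a ha.1).2 ha.2)
    · rw [hpot₂]
      simp only [Expr.cost] at ht₁ ht₂ ⊢
      omega
  · refine WP.seqSetArr (.reg h20₂) (.lit (by omega)) ?_
    have hfarwalk : ∀ a ∈ A, ∀ p : (Hg a (colOf c s (e i).1 a + colOf c s (e i).2 a)).Walk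
        (e i).1 (e i).2, 2 * c.k ≤ p.length := fun a ha p =>
      (hrep a (hAN ha)).far (hne i) ((hrow a (hAN ha)).1 ha) p
    have hcount := edgeCount_insertAt (c := c) (col := colOf c s) (Hg := Hg) (hne i) (A := A)
      fun a ha => ⟨h.code.mem_idx (Finset.mem_range.1 (hAN ha)) _ _, fun hadj => by
        have := hfarwalk a ha (SimpleGraph.Walk.cons hadj .nil)
        simp at this
        omega⟩
    refine WP.mono (insertFar_spec (u := (e i).1) (v := (e i).2) (Hg := Hg) (hr₄.setA 2 i 1)
      (hC₂.congr rfl rfl rfl) h21₂ h22₂ (hne i) (hS₂.congr rfl rfl rfl) ?_) ?_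
    · rw [colOf_congr (s := s₂) (s' := s₂.setA 2 i 1) rfl, hcol]; exact h.span.color
    rintro s₃ τ₃ hfr₃ ⟨hS₃, ht₃⟩
    rw [colOf_congr (s := s₂) (s' := s₂.setA 2 i 1) rfl, hcol,
      farSet_congr (s := s₂) (s' := s₂.setA 2 i 1) rfl rfl, hfar] at hS₃
    rw [farSet_congr (s := s₂) (s' := s₂.setA 2 i 1) rfl rfl, hfar,
      totalPot_congr (s := s₂) (s' := s₂.setA 2 i 1) rfl rfl rfl, hpot₂, ← hK] at ht₃
    have b : ∀ a, a ≠ 2 → a ∉ insertFar.arrs → s₃.arr a = s₁.arr a := fun a h2 ha => by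
      rw [hfr₃.arr a ha, ← hA₂]
      simp [h2]
    have b2 : s₃.arr 2 = Function.update (s.arr 2) i 1 := by
      rw [hfr₃.arr 2 (by decide)]
      simp [hA₂, a2]
    have b8 := b 8 (by decide) (by decide)
    refine ⟨_, insert i proc, insert i acc, ⟨?_, ?_, ?_, ?_, ?_, ?_, ?_, hS₃, ?_⟩, hproc, ?_⟩
    · exact h.code.congr ((b 3 (by decide) (by decide)).trans a3)
        ((b 4 (by decide) (by decide)).trans a4) ((b 5 (by decide) (by decide)).trans a5)
    · exact ⟨by rw [b8]; exact htree.leaf, by rw [b8]; exact htree.node,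
        by rw [b8]; exact htree.bound⟩
    · rw [b8, ← hA₂]; exact hleaf₂
    · intro j
      rw [b2, Finset.mem_insert, ← h.out j, Function.update_apply, ← Fin.val_inj]
      split_ifs with hji <;> simp [hji]
    · rw [b 0 (by decide) (by decide), a0]; exact h.fst
    · rw [b 1 (by decide) (by decide), a1]; exact h.snd
    · rw [colOf_congr (s := s) ((b 3 (by decide) (by decide)).trans a3)]
      exact h.span.accept hi hmin hfarwalk
    · rw [hcount, Finset.card_insert_of_notMem hiacc, mul_add, mul_add, mul_one]
      exact Nat.add_le_add h.count hge
    · rw [hcount, mul_add K]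
      simp only [Expr.cost] at ht₁ ht₂ ht₃ ⊢
      omega

theorem mainLoop_spec {s : State} {τ : ℕ} (hr : c.Regs s)
    (h : MainInv c e w s (fun _ _ => ⊥) ∅ ∅)
    (hwt : ∀ i : Fin c.m, μ.wt i = w s((e i).1, (e i).2)) (hne : ∀ i, (e i).1 ≠ (e i).2) :
    WP μ mainLoop (fun s' τ' => ∃ Hg acc, MainInv c e w s' Hg Finset.univ acc ∧
      τ' ≤ τ + c.m * (120 * c.N + 120 * c.L + 160) + 10 + 100 * totalPot c s' +
        (500 * c.cap + 300) * edgeCount c Hg) s τ := by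
  have hX := c.sq_X_le
  have hm := c.m_lt
  obtain ⟨M, hM⟩ : ∃ M, M = 120 * c.N + 120 * c.L + 160 := ⟨_, rfl⟩
  rw [← hM]
  refine WP.forLt c.m (fun j s' τ' => ∃ Hg proc acc, MainInv c e w s' Hg proc acc ∧
    proc.card = j ∧ τ' ≤ τ + j * M + 2 + 100 * totalPot c s' +
        (500 * c.cap + 300) * edgeCount c Hg) c.one_lt (by omega) ?_ ?_ ?_ ?_
  · exact ⟨_, _, _, h.of_arr rfl, rfl, by omega⟩
  · intro j s' τ' hfr _ _ _
    exact .reg (hr.frame hfr (by decide)).r1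
  · rintro j s' τ' hfr hj hjm ⟨Hg, proc, acc, hI, hcard, ht⟩
    refine WP.mono (processEdge_spec (hr.frame hfr (by decide)) hI hwt hne (hcard ▸ hjm)) ?_
    rintro s₂ τ₂ hfr₂ ⟨Hg', proc', acc', hI', hcard', ht'⟩
    refine ⟨(hfr₂.reg 34 (by decide)).trans hj, Hg', proc', acc', hI'.of_arr rfl,
      by omega, ?_⟩
    rw [totalPot_setR, add_mul]
    simp only [Expr.cost] at ht'
    omega
  · rintro s' τ' hfr _ ⟨Hg, proc, acc, hI, hcard, ht⟩
    have : proc = Finset.univ := Finset.eq_univ_of_card _ (by simpa using hcard)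
    subst this
    refine ⟨Hg, acc, hI, ?_⟩
    simp only [Expr.cost]
    omega

/-- Bounds for the total size of the graphs and for their potential. -/
theorem MainInv.bounds {s : State} {Hg : ℕ → ℕ → SimpleGraph (Fin c.n)}
    {proc acc : Finset (Fin c.m)} (h : MainInv c e w s Hg proc acc) {D : ℕ}
    (hD : 2 * c.cap ≤ D ^ c.k) :
    edgeCount c Hg ≤ c.N * (2 * c.q) * (D * c.n) ∧
      totalPot c s ≤ c.N * (2 * c.q) * (2 * c.k * (2 * c.cap) * (2 * (D * c.n) + c.n)) := by
  have h1 : ∀ p ∈ idx c, (Hg p.1 p.2).edgeSet.ncard ≤ D * c.n := fun p hp =>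
    h.span.ncard_edgeSet_le c.hk (h.code.card_class_le (mem_idx.1 hp).1) hD _
  rw [← card_idx]
  refine ⟨Finset.sum_le_card_nsmul _ _ _ h1, Finset.sum_le_card_nsmul _ _ _ fun p hp => ?_⟩
  refine (tabPot_le (h.store p hp) fun t =>
    h.span.ncard_reachable_le (h.code.card_class_le (mem_idx.1 hp).1) _ t).trans ?_
  have := h1 p hp
  gcongr

end Main

/-! ## The whole program -/

open FTSpanner.Expr in
/-- Finds the least `L ≥ 1` with `n ≤ 2 ^ L`. -/
def findLog : Cmd :=
  .seq (.setReg 4 (lit 1)) <|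
  .seq (.setReg 5 (lit 2)) <|
  .loop (bin .lt (reg 5) (reg 0))
    (.seq (.setReg 5 (bin .mul (lit 2) (reg 5))) (.setReg 4 (bin .add (reg 4) (lit 1))))

open FTSpanner.Expr in
/-- Computes the parameters. -/
def setup : Cmd :=
  .seq (.ite (bin .lt (reg 0) (reg 2)) (.setReg 2 (reg 0)) .skip) <|
  .seq findLog <|
  .seq (.ite (bin .lt (reg 4) (reg 3)) (.setReg 3 (reg 4)) .skip) <|
  .seq (.setReg 6 (bin .mul (lit 2) (reg 3))) <|
  .seq (.setReg 7 (bin .mul (lit 33) (reg 2))) <|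
  .seq (.setReg 8 (bin .mul (bin .mul (lit 32) (reg 2)) (reg 4))) <|
  .seq (.setReg 9 (bin .add (bin .div (reg 0) (reg 2)) (lit 1))) <|
  .setReg 10 (bin .mul (bin .mul (bin .mul (lit 128) (reg 0)) (reg 0)) (reg 0))

/-- The spanner algorithm. -/
def spannerProg : Cmd := .seq setup <| .seq buildCode <| .seq buildTree mainLoop

section Program

variable {μ : Machine} {c : Cfg μ}

theorem findLog_spec {s : State} {τ : ℕ} (h0 : s.reg 0 = c.n)
    (hmin : ∀ l, 1 ≤ l → c.n ≤ 2 ^ l → c.L ≤ l) :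
    WP μ findLog (fun s' τ' => s'.reg 4 = c.L ∧ τ' ≤ τ + 20 * c.L + 20) s τ := by
  have hX := c.sq_X_le
  have hnX := c.n_lt
  have hLX := c.L_lt
  have hL1 : 1 ≤ c.L := c.hk.trans c.hkL
  refine WP.seqSetReg (.lit (by omega)) (WP.seqSetReg (.lit (by omega)) ?_)
  refine WP.loop (fun s' τ' => s'.reg 0 = c.n ∧ 1 ≤ s'.reg 4 ∧ s'.reg 4 ≤ c.L ∧
    s'.reg 5 = 2 ^ s'.reg 4 ∧ τ' ≤ τ + 20 * s'.reg 4) (τ + 20 * c.L) ?_ ?_ ?_ ?_ ?_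
  · simp [h0, hL1, Expr.cost]
  · rintro s' τ' ⟨-, -, h1, -, h2⟩; omega
  · intros; exact ⟨trivial, trivial, c.one_lt⟩
  · rintro s' τ' - ⟨h0', h1, h2, h3, ht⟩ hcond
    have hlt : s'.reg 5 < c.n := by
      simp only [Expr.val, BinOp.eval, h0'] at hcond
      by_contra hh; simp [hh] at hcond
    refine WP.seqSetReg (v := 2 * s'.reg 5) (.mul (.lit (by omega)) (.reg rfl) (by omega)) ?_
    refine WP.setReg (v := s'.reg 4 + 1) (.add (.reg (by simp)) (.lit (by omega)) (by omega)) ?_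
    have hlt' : s'.reg 4 < c.L := by
      rw [h3] at hlt
      by_contra hh
      have := Nat.pow_le_pow_right (n := 2) (by norm_num) (not_lt.1 hh)
      have := c.hL
      omega
    refine ⟨by simpa using h0', by simp, by simpa using hlt', by simp [h3, pow_succ'], ?_⟩
    simp only [Expr.cost, State.setR_reg, if_true]
    omega
  · rintro s' τ' - ⟨h0', h1, h2, h3, ht⟩ hcond
    have hge : c.n ≤ s'.reg 5 := by
      simp only [Expr.val, BinOp.eval, h0'] at hcond
      by_contra hh; simp [not_le.1 hh] at hcond
    have := hmin _ h1 (h3 ▸ hge)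
    refine ⟨by omega, ?_⟩
    simp only [Expr.cost]
    omega

theorem setup_spec {s : State} {τ : ℕ} (h0 : s.reg 0 = c.n) (h1 : s.reg 1 = c.m)
    (h2 : c.f = min (s.reg 2) c.n) (h3 : c.k = min (s.reg 3) c.L)
    (hmin : ∀ l, 1 ≤ l → c.n ≤ 2 ^ l → c.L ≤ l) :
    WP μ setup (fun s' τ' => c.Regs s' ∧ τ' ≤ τ + 20 * c.L + 100) s τ := by
  have hX := c.sq_X_le
  have hnX := c.n_lt
  have hLX := c.L_lt
  have hqX := c.two_q_lt
  have hNX := c.N_lt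
  have hcX := c.cap_lt
  have hkX := c.k_lt
  have hf := c.hf
  have hfn := c.hfn
  have hsq := c.sq_le_cube
  have hXX := c.hX
  refine WP.seq (WP.mono (Q := fun s' τ' => s'.reg 2 = c.f ∧ τ' ≤ τ + 10) ?_ ?_)
  · refine WP.iteLt (.reg h0) (.reg rfl) c.one_lt (fun h => ?_) (fun h => ?_)
    · refine WP.setReg (.reg h0) ⟨by simp; omega, ?_⟩
      simp only [Expr.cost]; omega
    · refine WP.skip ⟨by omega, ?_⟩
      simp only [Expr.cost]; omega
  rintro s₁ τ₁ hfr₁ ⟨g2, ht₁⟩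
  have g0 : s₁.reg 0 = c.n := (hfr₁.reg 0 (by decide)).trans h0
  refine WP.seq (WP.mono (findLog_spec g0 hmin) ?_)
  rintro s₂ τ₂ hfr₂ ⟨g4, ht₂⟩
  refine WP.seq (WP.mono (Q := fun s' τ' => s'.reg 3 = c.k ∧ τ' ≤ τ₂ + 10) ?_ ?_)
  · have g3 : s₂.reg 3 = s.reg 3 := (hfr₂.reg 3 (by decide)).trans (hfr₁.reg 3 (by decide))
    refine WP.iteLt (.reg g4) (.reg g3) c.one_lt (fun h => ?_) (fun h => ?_)
    · refine WP.setReg (.reg g4) ⟨by simp; omega, ?_⟩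
      simp only [Expr.cost]; omega
    · refine WP.skip ⟨by omega, ?_⟩
      simp only [Expr.cost]; omega
  rintro s₃ τ₃ hfr₃ ⟨k3, ht₃⟩
  have k0 : s₃.reg 0 = c.n :=
    (hfr₃.reg 0 (by decide)).trans ((hfr₂.reg 0 (by decide)).trans g0)
  have k1 : s₃.reg 1 = c.m := (hfr₃.reg 1 (by decide)).trans
    ((hfr₂.reg 1 (by decide)).trans ((hfr₁.reg 1 (by decide)).trans h1))
  have k2 : s₃.reg 2 = c.f := (hfr₃.reg 2 (by decide)).trans ((hfr₂.reg 2 (by decide)).trans g2)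
  have k4 : s₃.reg 4 = c.L := (hfr₃.reg 4 (by decide)).trans g4
  have hN : 32 * c.f * c.L = c.N := rfl
  have hq : 33 * c.f = c.q := rfl
  have hcap : c.n / c.f + 1 = c.cap := rfl
  have e1 : 128 * c.n * c.n = 128 * c.n ^ 2 := by ring
  have e2 : 128 * c.n * c.n * c.n = c.X := by rw [hXX]; ring
  refine WP.seqSetReg (v := 2 * c.k) (.mul (.lit (by omega)) (.reg k3) (by omega)) ?_
  refine WP.seqSetReg (v := c.q) (.mul (.lit (by omega)) (.reg (by simpa using k2)) (by omega)) ?_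
  refine WP.seqSetReg (v := c.N) (.mul (.mul (.lit (by omega)) (.reg (by simpa using k2))
    (by omega)) (.reg (by simpa using k4)) (by omega)) ?_
  refine WP.seqSetReg (v := c.cap) (.add (.div (.reg (by simpa using k0)) (.reg (by simpa using k2))
    (by omega)) (.lit (by omega)) (by omega)) ?_
  refine WP.setReg (v := c.X) ((Ev.mul (.mul (.mul (.lit (by omega)) (.reg (by simpa using k0))
    (by omega)) (.reg (by simpa using k0)) (by omega)) (.reg (by simpa using k0))
    (by omega)).congr e2) ⟨⟨?_, ?_, ?_, ?_, ?_, ?_, ?_, ?_, ?_, ?_⟩, ?_⟩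
  all_goals try simp [k0, k1, k2, k3, k4]
  simp only [Expr.cost]
  omega

variable {e : Fin c.m → Fin c.n × Fin c.n} {w : Sym2 (Fin c.n) → ℝ≥0}

theorem spannerProg_spec {s : State} {τ : ℕ} (h0 : s.reg 0 = c.n) (h1 : s.reg 1 = c.m)
    (h2 : c.f = min (s.reg 2) c.n) (h3 : c.k = min (s.reg 3) c.L)
    (hmin : ∀ l, 1 ≤ l → c.n ≤ 2 ^ l → c.L ≤ l) (hz : ∀ a i, 2 ≤ a → s.arr a i = 0)
    (ha0 : ∀ i : Fin c.m, s.arr 0 i = (e i).1) (ha1 : ∀ i : Fin c.m, s.arr 1 i = (e i).2)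
    (hwt : ∀ i : Fin c.m, μ.wt i = w s((e i).1, (e i).2)) (hne : ∀ i, (e i).1 ≠ (e i).2) :
    WP μ spannerProg (fun s' τ' => ∃ Hg acc, MainInv c e w s' Hg Finset.univ acc ∧
      τ' ≤ τ + 20 * c.L + 200 + (c.n * (c.N * (120 * c.n + 60 * c.q + 320) + 20)) + 100 * c.m +
        c.m * (120 * c.N + 120 * c.L + 160) + 100 * totalPot c s' +
        (500 * c.cap + 300) * edgeCount c Hg) s τ := by
  refine WP.seq (WP.mono (setup_spec h0 h1 h2 h3 hmin) ?_)
  rintro s₁ τ₁ hfr₁ ⟨hr₁, ht₁⟩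
  have a : ∀ x, s₁.arr x = s.arr x := fun x => hfr₁.arr x (by simp [setup, findLog, Cmd.arrs])
  refine WP.seq (WP.mono (buildCode_spec hr₁ fun i => by simp [a, hz]) ?_)
  rintro s₂ τ₂ hfr₂ ⟨hC, ht₂⟩
  have b : ∀ x, x ∉ buildCode.arrs → s₂.arr x = s.arr x := fun x hx => (hfr₂.arr x hx).trans (a x)
  have hr₂ : c.Regs s₂ := hr₁.frame hfr₂ (by decide)
  refine WP.seq (WP.mono (buildTree_spec hr₂ fun i => by
    rw [b 8 (by decide)]; exact hz _ _ (by norm_num)) ?_)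
  rintro s₃ τ₃ hfr₃ ⟨hT, hleaf, ht₃⟩
  have d : ∀ x, x ∉ buildCode.arrs → x ∉ buildTree.arrs → s₃.arr x = s.arr x := fun x hx hx' =>
    (hfr₃.arr x hx').trans (b x hx)
  refine WP.mono (mainLoop_spec (e := e) (w := w) (hr₂.frame hfr₃ (by decide)) ⟨?_, hT, ?_, ?_, ?_, ?_,
    spannerInv_empty _ _ _ _ _, store_empty fun i => ?_, by simp⟩ hwt hne) ?_
  · exact hC.congr (hfr₃.arr 3 (by decide)) (hfr₃.arr 4 (by decide)) (hfr₃.arr 5 (by decide))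
  · intro i; rw [hleaf i i.2]; simp
  · intro i; rw [d 2 (by decide) (by decide), hz _ _ le_rfl]; simp
  · intro i; rw [d 0 (by decide) (by decide)]; exact ha0 i
  · intro i; rw [d 1 (by decide) (by decide)]; exact ha1 i
  · rw [d 9 (by decide) (by decide), d 11 (by decide) (by decide)]
    exact ⟨hz _ _ (by norm_num), hz _ _ (by norm_num)⟩
  · rintro s₄ τ₄ - ⟨Hg, acc, hI, ht₄⟩
    exact ⟨Hg, acc, hI, by omega⟩

end Program

section Bounds

/-- The arithmetic behind the running time. -/
theorem time_le {n m f k L D q N cap I B T : ℕ} (hn : 1 ≤ n) (hf : 1 ≤ f) (hfn : f ≤ n)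
    (hk : 1 ≤ k) (hkL : k ≤ L) (hD : 1 ≤ D) (hq : q = 33 * f) (hN : N = 32 * f * L)
    (hcap : cap = n / f + 1) (hI : I ≤ N * (2 * q) * (D * n))
    (hB : B ≤ N * (2 * q) * (2 * k * (2 * cap) * (2 * (D * n) + n)))
    (hT : T ≤ 20 * L + 200 + (n * (N * (120 * n + 60 * q + 320) + 20)) + 100 * m +
      m * (120 * N + 120 * L + 160) + 100 * B + (500 * cap + 300) * I) :
    T ≤ 10000000 * (L ^ 2 * (f * n ^ 2 * D + m * f ^ 2)) := by
  have hL : 1 ≤ L := hk.trans hkL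
  have hfc : f * cap ≤ 2 * n := by
    have := Nat.mul_div_le n f
    rw [hcap, mul_add, mul_one]
    omega
  have hcap1 : 1 ≤ cap := hcap ▸ Nat.le_add_left _ _
  have hLL : L ≤ L ^ 2 := Nat.le_self_pow (by norm_num) _
  have hnn : n ≤ n ^ 2 := Nat.le_self_pow (by norm_num) _
  have hff : f ≤ f ^ 2 := Nat.le_self_pow (by norm_num) _
  obtain ⟨U, hU⟩ : ∃ U, U = L ^ 2 * (f * n ^ 2 * D) := ⟨_, rfl⟩
  obtain ⟨V, hV⟩ : ∃ V, V = L ^ 2 * (m * f ^ 2) := ⟨_, rfl⟩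
  have t1 : L ≤ U := by
    calc L ≤ L ^ 2 * (1 * 1 ^ 2 * 1) := by omega
      _ ≤ U := by rw [hU]; gcongr
  have t0 : 1 ≤ U := hL.trans t1
  have t2 : n ≤ U := by
    calc n ≤ 1 ^ 2 * (1 * n ^ 2 * 1) := by omega
      _ ≤ U := by rw [hU]; gcongr
  have t3 : n * (N * (120 * n + 60 * q + 320)) ≤ 77440 * U := by
    calc n * (N * (120 * n + 60 * q + 320)) ≤ n * (N * (2420 * n)) := by
          gcongr; omega
      _ = 77440 * (L * (f * n ^ 2 * 1)) := by rw [hN]; ring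
      _ ≤ 77440 * U := by rw [hU]; gcongr
  have t4 : m ≤ V := by
    calc m = 1 ^ 2 * (m * 1 ^ 2) := by ring
      _ ≤ V := by rw [hV]; gcongr
  have t5 : m * N ≤ 32 * V := by
    calc m * N = 32 * (L * (m * f)) := by rw [hN]; ring
      _ ≤ 32 * V := by rw [hV]; gcongr
  have t6 : m * L ≤ V := by
    calc m * L = L * (m * 1 ^ 2) := by ring
      _ ≤ V := by rw [hV]; gcongr
  have t7 : B ≤ 50688 * U := by
    calc B ≤ N * (2 * q) * (2 * k * (2 * cap) * (2 * (D * n) + n)) := hB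
      _ ≤ N * (2 * q) * (2 * L * (2 * cap) * (2 * (D * n) + D * n)) := by
          gcongr; exact Nat.le_mul_of_pos_left _ hD
      _ = 25344 * (L ^ 2 * (f * (f * cap) * (D * n))) := by rw [hN, hq]; ring
      _ ≤ 25344 * (L ^ 2 * (f * (2 * n) * (D * n))) := by gcongr
      _ = 50688 * U := by rw [hU]; ring
  have t8 : (500 * cap + 300) * I ≤ 3379200 * U := by
    calc (500 * cap + 300) * I ≤ (800 * cap) * (N * (2 * q) * (D * n)) := by
          gcongr; omega
      _ = 1689600 * (L * (f * (f * cap) * (D * n))) := by rw [hN, hq]; ring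
      _ ≤ 1689600 * (L ^ 2 * (f * (2 * n) * (D * n))) := by gcongr
      _ = 3379200 * U := by rw [hU]; ring
  have e1 : n * (N * (120 * n + 60 * q + 320) + 20) =
      n * (N * (120 * n + 60 * q + 320)) + 20 * n := by ring
  have e2 : m * (120 * N + 120 * L + 160) = 120 * (m * N) + 120 * (m * L) + 160 * m := by ring
  have e3 : L ^ 2 * (f * n ^ 2 * D + m * f ^ 2) = U + V := by rw [hU, hV]; ring
  rw [e1, e2] at hT
  rw [e3]
  omega

/-- An integer upper bound of the `k`-th root of `2 * cap`. -/
theorem exists_root_bound {n f k cap : ℕ} (hf : 1 ≤ f) (hfn : f ≤ n) (hk : 1 ≤ k)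
    (hcap : cap = n / f + 1) : ∃ D : ℕ, 1 ≤ D ∧ 2 * cap ≤ D ^ k ∧
      (D : ℝ) ≤ 5 * ((n : ℝ) / f) ^ (1 / (k : ℝ)) := by
  have hf' : (0 : ℝ) < f := by exact_mod_cast hf
  have hk' : (1 : ℝ) ≤ k := by exact_mod_cast hk
  have hr : (1 : ℝ) ≤ (n : ℝ) / f := by
    rw [le_div_iff₀ hf', one_mul]; exact_mod_cast hfn
  have hρ : 1 ≤ ((n : ℝ) / f) ^ (1 / (k : ℝ)) := Real.one_le_rpow hr (by positivity)
  refine ⟨⌈4 * ((n : ℝ) / f) ^ (1 / (k : ℝ))⌉₊, ?_, ?_, ?_⟩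
  · rw [Nat.one_le_ceil_iff]; positivity
  · have h1 : (2 * cap : ℝ) ≤ (4 * ((n : ℝ) / f) ^ (1 / (k : ℝ))) ^ k := by
      have h2 : ((n : ℝ) / f) = (((n : ℝ) / f) ^ (1 / (k : ℝ))) ^ k := by
        rw [← Real.rpow_natCast, ← Real.rpow_mul (by positivity), one_div_mul_cancel (by positivity),
          Real.rpow_one]
      have h3 : (4 : ℝ) ≤ 4 ^ k := by
        simpa using pow_le_pow_right₀ (by norm_num : (1 : ℝ) ≤ 4) hk
      have h4 : (cap : ℝ) ≤ (n : ℝ) / f + 1 := by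
        rw [hcap, Nat.cast_add, Nat.cast_one]
        gcongr
        exact Nat.cast_div_le
      rw [mul_pow, ← h2]
      calc (2 * cap : ℝ) ≤ 4 * ((n : ℝ) / f) := by linarith
        _ ≤ _ := by gcongr
    exact_mod_cast h1.trans (pow_le_pow_left₀ (by positivity) (Nat.le_ceil _) k)
  · have := Nat.ceil_lt_add_one (show 0 ≤ 4 * ((n : ℝ) / f) ^ (1 / (k : ℝ)) by positivity)
    linarith

/-- Truncating `f` at `n` and `k` at about `log n` costs at most a factor of two. -/
theorem truncated_bound {n f k L : ℕ} (hn : 1 ≤ n) (hf : 1 ≤ f) (hk : 1 ≤ k) (hL : 1 ≤ L)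
    (hnL : n ≤ 2 ^ L) :
    ((min f n : ℕ) : ℝ) * ((n : ℝ) / (min f n : ℕ)) ^ (1 / ((min k L : ℕ) : ℝ)) ≤
      2 * ((f : ℝ) ^ (1 - 1 / (k : ℝ)) * (n : ℝ) ^ (1 / (k : ℝ))) := by
  obtain ⟨g, hg⟩ : ∃ g, g = min f n := ⟨_, rfl⟩
  rw [← hg]
  have hg1 : 1 ≤ g := by omega
  have hgn : g ≤ n := by omega
  have hgf : g ≤ f := by omega
  have hg' : (0 : ℝ) < g := by exact_mod_cast hg1
  have hg1' : (1 : ℝ) ≤ g := by exact_mod_cast hg1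
  have hn' : (1 : ℝ) ≤ n := by exact_mod_cast hn
  have hk' : (1 : ℝ) ≤ k := by exact_mod_cast hk
  have hr : (1 : ℝ) ≤ (n : ℝ) / g := by
    rw [le_div_iff₀ hg', one_mul]; exact_mod_cast hgn
  have hk1 : 1 / (k : ℝ) ≤ 1 := by rw [div_le_one (by positivity)]; exact hk'
  have hroot : ((n : ℝ) / g) ^ (1 / ((min k L : ℕ) : ℝ)) ≤ 2 * ((n : ℝ) / g) ^ (1 / (k : ℝ)) := by
    have hρ : 1 ≤ ((n : ℝ) / g) ^ (1 / (k : ℝ)) := Real.one_le_rpow hr (by positivity)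
    rcases le_total k L with h | h
    · rw [min_eq_left h]; linarith
    · rw [min_eq_right h]
      have hL' : (0 : ℝ) < L := by exact_mod_cast hL
      have h1 : ((n : ℝ) / g) ^ (1 / (L : ℝ)) ≤ ((2 : ℝ) ^ L) ^ (1 / (L : ℝ)) := by
        refine Real.rpow_le_rpow (by positivity) ?_ (by positivity)
        exact (div_le_self (by positivity) hg1').trans (by exact_mod_cast hnL)
      rw [← Real.rpow_natCast, ← Real.rpow_mul (by norm_num), mul_one_div_cancel hL'.ne',
        Real.rpow_one] at h1
      linarith
  calc (g : ℝ) * ((n : ℝ) / g) ^ (1 / ((min k L : ℕ) : ℝ))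
      ≤ g * (2 * ((n : ℝ) / g) ^ (1 / (k : ℝ))) := by gcongr
    _ = 2 * ((g : ℝ) ^ (1 - 1 / (k : ℝ)) * (n : ℝ) ^ (1 / (k : ℝ))) := by
        rw [Real.div_rpow (by positivity) (by positivity), Real.rpow_sub hg', Real.rpow_one]
        ring
    _ ≤ _ := by
        gcongr

end Bounds

/-! ## From runs to probabilities -/

theorem expectedTime_le {W T : ℕ} {wt : ℕ → ℝ≥0} {p : Cmd} {s : State}
    (h : ∀ coin, ∃ t s', Exec W wt coin p s t s' ∧ t ≤ T) : expectedTime W wt p s ≤ T := by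
  have : IsProbabilityMeasure coinLaw := by unfold coinLaw; infer_instance
  refine (lintegral_mono (g := fun _ => (T : ℝ≥0∞)) fun coin => ?_).trans (by simp)
  obtain ⟨t, s', he, ht⟩ := h coin
  exact (iInf₂_le t ⟨s', he⟩).trans (Nat.cast_le.2 ht)

theorem haltProb_eq_one {W : ℕ} {wt : ℕ → ℝ≥0} {p : Cmd} {s : State} {Q : State → Prop}
    (h : ∀ coin, ∃ t s', Exec W wt coin p s t s' ∧ Q s') : haltProb W wt p s Q = 1 := by
  have : IsProbabilityMeasure coinLaw := by unfold coinLaw; infer_instance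
  rw [haltProb, Set.eq_univ_of_forall (s := {coin | _}) h, measure_univ]

theorem IsVFTSpanner.mono {n : ℕ} {G H : SimpleGraph (Fin n)} {w : Sym2 (Fin n) → ℝ≥0}
    {f t f' t' : ℕ} (h : IsVFTSpanner G w (min f' n) t H) (hf : f ≤ f') (ht : t ≤ t') :
    IsVFTSpanner G w f t' H := by
  refine ⟨h.1, fun F hF u v hu hv => (h.2 F ?_ u v hu hv).trans ?_⟩
  · have := F.card_le_univ
    rw [Fintype.card_fin] at this
    omega
  · gcongr

theorem two_mul_length_le {n m : ℕ} {G : SimpleGraph (Fin n)} {e : Fin m → Fin n × Fin n}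
    (he : IsEdgeList G e) : 2 * m ≤ n ^ 2 := by
  have h := two_mul_ncard_edgeSet_le G
  rw [← he.2, ← Set.image_univ, Set.ncard_image_of_injective _ he.1, Set.ncard_univ,
    Nat.card_eq_fintype_card, Fintype.card_fin] at h
  exact h

theorem word_size_le {n Y : ℕ} (hn : n ≤ Y) (hY : 4 ≤ Y) : (128 * n ^ 3) ^ 6 ≤ Y ^ 40 := by
  calc (128 * n ^ 3) ^ 6 = 4 ^ 21 * n ^ 18 := by ring
    _ ≤ Y ^ 21 * Y ^ 18 := by gcongr
    _ = Y ^ 39 := (pow_add _ _ _).symm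
    _ ≤ Y ^ 40 := Nat.pow_le_pow_right (by omega) (by norm_num)

/-- The parameters for a given input. -/
def Cfg.ofInput (μ : Machine) {n m f k : ℕ} (hn : 1 ≤ n) (hf : 1 ≤ f) (hk : 1 ≤ k)
    (hm : 2 * m ≤ n ^ 2) (hW : (n + f + k + 2) ^ 40 ≤ 2 ^ μ.W) : Cfg μ where
  n := n
  m := m
  f := min f n
  k := min k (max 1 (Nat.clog 2 n))
  L := max 1 (Nat.clog 2 n)
  X := 128 * n ^ 3
  hn := hn
  hf := le_min hf hn
  hfn := min_le_right _ _
  hk := le_min hk (le_max_left _ _)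
  hkL := min_le_right _ _
  hL := (Nat.le_pow_clog (by norm_num) n).trans
    (Nat.pow_le_pow_right (by norm_num) (le_max_right _ _))
  hL' := by
    rcases le_or_gt 2 n with h | h
    · have h1 := Nat.pow_pred_clog_lt_self (b := 2) (by norm_num) h
      have h2 := Nat.clog_pos (b := 2) (by norm_num) h
      rw [max_eq_right h2, ← Nat.succ_pred_eq_of_pos h2, pow_succ]
      omega
    · have : n = 1 := by omega
      subst this
      simp
  hm := hm
  hX := rfl
  hW := by
    refine (word_size_le ?_ ?_).trans hW <;> omega

theorem log_bound {n : ℕ} (hn : 1 ≤ n) {L : ℕ} (hL : 2 ^ L ≤ 2 * n) :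
    (L : ℝ) ≤ 2 * (1 + Real.log n) := by
  have h1 : (L : ℝ) * Real.log 2 ≤ Real.log 2 + Real.log n := by
    rw [← Real.log_pow, ← Real.log_mul (by norm_num) (by positivity)]
    exact Real.log_le_log (by positivity) (by exact_mod_cast hL)
  have h2 : 0 ≤ Real.log n := Real.log_natCast_nonneg n
  have h3 : (1 : ℝ) / 2 < Real.log 2 := by have := Real.log_two_gt_d9; linarith
  by_contra hcon
  push Not at hcon
  nlinarith [Real.log_two_lt_d9]

theorem ncard_outGraph_le {n m : ℕ} {e : Fin m → Fin n × Fin n} {s : State} {acc : Finset (Fin m)}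
    (h : ∀ i : Fin m, s.arr 2 i ≠ 0 ↔ i ∈ acc) : (outGraph e s).edgeSet.ncard ≤ acc.card := by
  classical
  have hsub : (outGraph e s).edgeSet ⊆ (acc.image fun i => s((e i).1, (e i).2) : Finset _) := by
    rw [outGraph, SimpleGraph.edgeSet_fromEdgeSet]
    rintro x ⟨⟨i, hi, rfl⟩, -⟩
    exact Finset.mem_coe.2 (Finset.mem_image_of_mem _ ((h i).1 hi))
  refine (Set.ncard_le_ncard hsub).trans ?_
  rw [Set.ncard_coe_finset]
  exact Finset.card_image_le

theorem outGraph_eq {n m : ℕ} {e : Fin m → Fin n × Fin n} {s : State} {acc : Finset (Fin m)}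
    (h : ∀ i : Fin m, s.arr 2 i ≠ 0 ↔ i ∈ acc) :
    outGraph e s = SimpleGraph.fromEdgeSet {x | ∃ i ∈ acc, x = s((e i).1, (e i).2)} := by
  unfold outGraph
  simp only [h]

/-- Every run of the program is fast and returns a sparse fault-tolerant spanner. -/
theorem spannerProg_run {n m f k : ℕ} (hn : 1 ≤ n) (hf : 1 ≤ f) (hk : 1 ≤ k)
    {G : SimpleGraph (Fin n)} (w : Sym2 (Fin n) → ℝ≥0) {e : Fin m → Fin n × Fin n}
    (he : IsEdgeList G e) {W : ℕ} (hW : (n + f + k + 2) ^ 40 ≤ 2 ^ W) {L D : ℕ}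
    (hL : L = max 1 (Nat.clog 2 n)) (hD1 : 1 ≤ D)
    (hD : 2 * (n / min f n + 1) ≤ D ^ min k L) (coin : ℕ → Bool) :
    ∃ t s', Exec W (weightArray e w) coin spannerProg (initState e f k) t s' ∧
      t ≤ 10000000 * (L ^ 2 * (min f n * n ^ 2 * D + m * min f n ^ 2)) ∧
      IsVFTSpanner G w f (2 * k - 1) (outGraph e s') ∧
      (outGraph e s').edgeSet.ncard ≤ 132 * (min f n * D) * n := by
  subst hL
  let μ : Machine := ⟨W, weightArray e w, coin⟩
  let c : Cfg μ := .ofInput μ hn hf hk (two_mul_length_le he) hW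
  have hmin : ∀ l, 1 ≤ l → c.n ≤ 2 ^ l → c.L ≤ l := fun l h1 h2 =>
    max_le h1 (Nat.clog_le_of_le_pow h2)
  have hwt : ∀ i : Fin m, weightArray e w i = w s((e i).1, (e i).2) := fun i => by
    simp [weightArray]
  have hne : ∀ i, (e i).1 ≠ (e i).2 := fun i => by
    have h : s((e i).1, (e i).2) ∈ G.edgeSet := by rw [← he.2]; exact ⟨i, rfl⟩
    exact ((SimpleGraph.mem_edgeSet _).1 h).ne
  obtain ⟨t, s', hex, Hg, acc, hI, ht⟩ := spannerProg_spec (c := c) (e := e) (w := w) (τ := 0)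
    (s := initState e f k) rfl rfl rfl rfl hmin
    (fun a i ha => by rcases a with _ | _ | a <;> first | omega | rfl)
    (fun i => dif_pos i.2) (fun i => dif_pos i.2) hwt hne
  obtain ⟨hE, hP⟩ := hI.bounds hD
  refine ⟨t, s', hex, ?_, ?_, (ncard_outGraph_le hI.out).trans ?_⟩
  · rw [zero_add, zero_add] at ht
    exact time_le (n := n) (m := m) (f := min f n) (D := D) (q := c.q) (N := c.N)
      (cap := c.cap) hn c.hf c.hfn c.hk c.hkL hD1 rfl rfl rfl hE hP ht
  · have hspan := hI.span.isVFTSpanner (f := min f n) (B := 3 * c.L) he c.hk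
      (fun u v huv => hI.code.card_agree_le huv) (by
        show 4 * min f n * (3 * c.L) ≤ 32 * min f n * c.L
        calc 4 * min f n * (3 * c.L) = 12 * (min f n * c.L) := by ring
          _ ≤ 32 * (min f n * c.L) := by omega
          _ = _ := by ring) (outGraph_eq hI.out)
    refine hspan.mono le_rfl ?_
    have : c.k ≤ k := min_le_left _ _
    omega
  · have hN : 0 < c.N := by
      have := c.hf
      have := c.hk.trans c.hkL
      unfold Cfg.N
      positivity
    refine Nat.le_of_mul_le_mul_left ?_ hN
    calc c.N * acc.card ≤ 2 * edgeCount c Hg := hI.count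
      _ ≤ 2 * (c.N * (2 * c.q) * (D * n)) := Nat.mul_le_mul_left _ hE
      _ = 2 * (c.N * (2 * (33 * min f n)) * (D * n)) := rfl
      _ = c.N * (132 * (min f n * D) * n) := by ring

theorem real_bounds {n m f k L D : ℕ} (hn : 1 ≤ n) (hf : 1 ≤ f) (hk : 1 ≤ k) (hL : 1 ≤ L)
    (hnL : n ≤ 2 ^ L) (hLn : 2 ^ L ≤ 2 * n)
    (hD : (D : ℝ) ≤ 5 * ((n : ℝ) / (min f n : ℕ)) ^ (1 / ((min k L : ℕ) : ℝ))) :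
    ((10000000 * (L ^ 2 * (min f n * n ^ 2 * D + m * min f n ^ 2)) : ℕ) : ℝ) ≤
      1000000000 * (1 + Real.log n) ^ 2 *
        ((f : ℝ) ^ (1 - 1 / (k : ℝ)) * (n : ℝ) ^ (2 + 1 / (k : ℝ)) + (m : ℝ) * (f : ℝ) ^ 2) ∧
    ((132 * (min f n * D) * n : ℕ) : ℝ) ≤
      1000000000 * (f : ℝ) ^ (1 - 1 / (k : ℝ)) * (n : ℝ) ^ (1 + 1 / (k : ℝ)) := by
  have hn' : (0 : ℝ) < n := by exact_mod_cast hn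
  have htr := truncated_bound hn hf hk hL hnL
  have hlog := log_bound hn hLn
  have hlog0 : 0 ≤ Real.log n := Real.log_natCast_nonneg n
  rw [Real.rpow_add hn' 2, Real.rpow_add hn' 1, Real.rpow_one, Real.rpow_ofNat]
  have hg : ((min f n : ℕ) : ℝ) ≤ f := by exact_mod_cast min_le_left f n
  obtain ⟨R, hR⟩ : ∃ R : ℝ, R = (f : ℝ) ^ (1 - 1 / (k : ℝ)) * (n : ℝ) ^ (1 / (k : ℝ)) := ⟨_, rfl⟩
  have hR0 : 0 ≤ R := by rw [hR]; positivity
  rw [← hR] at htr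
  have hgD : ((min f n : ℕ) : ℝ) * D ≤ 10 * R := by
    calc ((min f n : ℕ) : ℝ) * D
        ≤ (min f n : ℕ) * (5 * ((n : ℝ) / (min f n : ℕ)) ^ (1 / ((min k L : ℕ) : ℝ))) := by gcongr
      _ = 5 * ((min f n : ℕ) * ((n : ℝ) / (min f n : ℕ)) ^ (1 / ((min k L : ℕ) : ℝ))) := by ring
      _ ≤ 5 * (2 * R) := by gcongr
      _ = 10 * R := by ring
  have e1 : (f : ℝ) ^ (1 - 1 / (k : ℝ)) * ((n : ℝ) ^ 2 * (n : ℝ) ^ (1 / (k : ℝ))) = n ^ 2 * R := by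
    rw [hR]; ring
  have e2 : 1000000000 * (f : ℝ) ^ (1 - 1 / (k : ℝ)) * ((n : ℝ) * (n : ℝ) ^ (1 / (k : ℝ))) =
      1000000000 * n * R := by rw [hR]; ring
  rw [e1, e2]
  generalize min f n = g at hg hgD
  constructor
  · push_cast
    calc (10000000 : ℝ) * (L ^ 2 * (g * n ^ 2 * D + m * g ^ 2))
        = 10000000 * (L ^ 2 * (n ^ 2 * (g * D) + m * g ^ 2 * 1)) := by ring
      _ ≤ 10000000 * ((2 * (1 + Real.log n)) ^ 2 * (n ^ 2 * (10 * R) + m * f ^ 2 * 10)) := by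
          gcongr; norm_num
      _ = 400000000 * ((1 + Real.log n) ^ 2 * (n ^ 2 * R + m * f ^ 2)) := by ring
      _ ≤ 1000000000 * ((1 + Real.log n) ^ 2 * (n ^ 2 * R + m * f ^ 2)) := by
          gcongr; norm_num
      _ = _ := by ring
  · push_cast
    calc (132 : ℝ) * (g * D) * n ≤ 132 * (10 * R) * n := by gcongr
      _ = 1320 * (n * R) := by ring
      _ ≤ 1000000000 * (n * R) := by gcongr; norm_num
      _ = _ := by ring

end FTSpanner

theorem theorem1 :
    ∃ (p : Cmd) (b d : ℕ) (C : ℝ),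
      ∀ (n m f k : ℕ) (_ : 1 ≤ n) (_ : 1 ≤ f) (_ : 1 ≤ k)
        (G : SimpleGraph (Fin n)) (w : Sym2 (Fin n) → ℝ≥0)
        (e : Fin m → Fin n × Fin n) (_ : IsEdgeList G e)
        (W : ℕ) (_ : (n + f + k + 2) ^ b ≤ 2 ^ W),
        expectedTime W (weightArray e w) p (initState e f k) ≤
            ENNReal.ofReal (C * (1 + Real.log n) ^ d *
              ((f : ℝ) ^ (1 - 1 / (k : ℝ)) * (n : ℝ) ^ (2 + 1 / (k : ℝ))
                + (m : ℝ) * (f : ℝ) ^ 2)) ∧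
          ENNReal.ofReal (1 - 1 / (n : ℝ)) ≤
            haltProb W (weightArray e w) p (initState e f k) (fun s =>
              IsVFTSpanner G w f (2 * k - 1) (outGraph e s) ∧
              ((outGraph e s).edgeSet.ncard : ℝ) ≤
                C * (f : ℝ) ^ (1 - 1 / (k : ℝ)) * (n : ℝ) ^ (1 + 1 / (k : ℝ))) := by
  refine ⟨spannerProg, 40, 2, 1000000000, ?_⟩
  intro n m f k hn hf hk G w e he W hW
  obtain ⟨L, hL⟩ : ∃ L, L = max 1 (Nat.clog 2 n) := ⟨_, rfl⟩
  have hL1 : 1 ≤ L := hL ▸ le_max_left _ _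
  let c : Cfg ⟨W, weightArray e w, fun _ => true⟩ :=
    .ofInput _ hn hf hk (two_mul_length_le he) hW
  obtain ⟨D, hD1, hD, hDr⟩ := exists_root_bound (n := n) (f := min f n) (k := min k L)
    (le_min hf hn) (min_le_right _ _) (le_min hk hL1) rfl
  obtain ⟨htime, hsize⟩ := real_bounds (m := m) hn hf hk hL1 (hL ▸ c.hL) (hL ▸ c.hL') hDr
  have hrun := spannerProg_run hn hf hk w he hW hL hD1 hD
  constructor
  · refine (expectedTime_le fun coin => ?_).trans
      ((ENNReal.ofReal_natCast _).symm.le.trans (ENNReal.ofReal_le_ofReal htime))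
    obtain ⟨t, s', hex, ht, -⟩ := hrun coin
    exact ⟨t, s', hex, ht⟩
  · rw [haltProb_eq_one fun coin => ?_]
    · exact ENNReal.ofReal_le_one.2 (sub_le_self _ (by positivity))
    · obtain ⟨t, s', hex, -, h1, h2⟩ := hrun coin
      exact ⟨t, s', hex, h1, (Nat.cast_le.2 h2).trans hsize⟩
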